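/- Let $\alpha\in(1,2]$ and let $\mathbb D$ be the open unit disk. Let $Co(\alpha)$ be the class of functions $f$ on $\mathbb D$ such that (i) $f$ is analytic in $\mathbb D$ with $f(0)=0$, $f'(0)=1$ and $f(1)=\infty$, that is, $|f(z)|\to\infty$ as $z\to1$ in $\mathbb D$; (ii) $f$ maps $\mathbb D$ conformally (injectively) onto a set whose complement in $\mathbb C$ is convex; (iii) the opening angle of $f(\mathbb D)$ at $\infty$, that is, $\lim_{R\to\infty}\big|\{\theta\in(-\pi,\pi]: Re^{i\theta}\in f(\mathbb D)\}\big|$, exists and is at most $\pi\alpha$. Let $\Pi_{\alpha-1}=K(\alpha-1,0)$ be the Kaplan class of all nonvanishing analytic functions $s$ in $\mathbb D$ with $s(0)=1$ such that for all $0<r<1$ and $\theta_1<\theta_2<\theta_1+2\pi$ $$-(\alpha-1)\pi\le\int_{\theta_1}^{\theta_2}\Big\{\mathrm{Re}\,\frac{re^{i\theta}s'(re^{i\theta})}{s(re^{i\theta})}-\frac{\alpha-1}{2}\Big\}\,d\theta\le 0 .$$ Theorem. Let $f:\mathbb D\to\mathbb C$. (a) $f\in Co(\alpha)$ if and only if there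 is $s\in\Pi_{\alpha-1}$ such that $$f(z)=\int_0^z\frac{s(t)}{(1-t)^{\alpha+1}}\,dt,\qquad z\in\mathbb D,$$ where the power is the principal branch; and every such $s$ is given by $s(z)=(1-z)^{\alpha+1}f'(z)$. (b) Equivalently, $f\in Co(\alpha)$ if and only if $f$ is analytic in $\mathbb D$ with $f(0)=0$, $f'(0)=1$, and the function $s(z)=(1-z)^{\alpha+1}f'(z)$ has no zero in $\mathbb D$ and satisfies $$\mathrm{Re}\Big(z\frac{s'(z)}{s(z)}\Big)<\frac{\alpha-1}{2},\qquad z\in\mathbb D .$$ -/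

import Mathlib

open Set Filter Topology MeasureTheory

noncomputable section

namespace Concave

/-- The open unit disk. -/
def unitDisk : Set ℂ := Metric.ball 0 1

/-- The angular measure of `Ω` on the circle `|w| = R`, that is, the length of the set of
arguments `θ ∈ (-π, π]` with `R * exp (i θ) ∈ Ω`. -/
def angularMeasure (Ω : Set ℂ) (R : ℝ) : ℝ :=
  (volume {θ : ℝ | θ ∈ Ioc (-Real.pi) Real.pi ∧
    (R : ℂ) * Complex.exp (θ * Complex.I) ∈ Ω}).toReal

/-- `Ω` has opening angle `φ` at infinity: the angular measure of `Ω` on the circle of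
radius `R` tends to `φ` as `R → ∞`. For a closed sector and its complement this is the usual
angle, and for the complement of an unbounded convex set `K` it is `2π` minus the angle of the
cone of the directions in which `K` is unbounded. -/
def HasOpeningAngleAtInfinity (Ω : Set ℂ) (φ : ℝ) : Prop :=
  Tendsto (angularMeasure Ω) atTop (𝓝 φ)

/-- The class `Co(α)` of concave univalent functions. Only the values of `f` on the unit disk
matter. -/
structure IsCo (α : ℝ) (f : ℂ → ℂ) : Prop where
  /-- `f` is analytic in the unit disk. -/
  analytic : DifferentiableOn ℂ f unitDisk
  apply_zero : f 0 = 0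
  deriv_zero : deriv f 0 = 1
  /-- `f(1) = ∞`. -/
  map_one : Tendsto f (𝓝[unitDisk] 1) (Bornology.cobounded ℂ)
  /-- `f` maps the unit disk conformally onto its image. -/
  injOn : InjOn f unitDisk
  /-- The complement of the image is convex. -/
  convex_compl : Convex ℝ (f '' unitDisk)ᶜ
  /-- The opening angle of the image at infinity is at most `π α`. -/
  opening_angle : ∃ φ : ℝ, HasOpeningAngleAtInfinity (f '' unitDisk) φ ∧ φ ≤ Real.pi * α

/-- The Kaplan class `K(a, b)`. -/
structure IsKaplan (a b : ℝ) (s : ℂ → ℂ) : Prop where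
  analytic : DifferentiableOn ℂ s unitDisk
  ne_zero : ∀ z ∈ unitDisk, s z ≠ 0
  apply_zero : s 0 = 1
  integral_bounds : ∀ r : ℝ, 0 < r → r < 1 → ∀ θ₁ θ₂ : ℝ, θ₁ < θ₂ → θ₂ < θ₁ + 2 * Real.pi →
    (∫ θ in θ₁..θ₂, ((circleMap 0 r θ * deriv s (circleMap 0 r θ) /
        s (circleMap 0 r θ)).re - (a - b) / 2)) ∈ Icc (-(a * Real.pi)) (b * Real.pi)

/-- The class `Π_λ`, which is `K(λ, 0)` for `λ ≥ 0` and `K(0, -λ)` for `λ < 0`. -/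
def IsPi (l : ℝ) (s : ℂ → ℂ) : Prop :=
  (0 ≤ l ∧ IsKaplan l 0 s) ∨ (l < 0 ∧ IsKaplan 0 (-l) s)

/-- The integral `∫_0^z g(t) dt` along the straight segment from `0` to `z`. -/
def segmentIntegral (g : ℂ → ℂ) (z : ℂ) : ℂ :=
  ∫ u in (0 : ℝ)..1, g ((u : ℂ) * z) * z

/-- The function `z ↦ (1 - z)^(α + 1) f'(z)`, with the principal branch of the power. -/
def kaplanTransform (α : ℝ) (f : ℂ → ℂ) (z : ℂ) : ℂ :=
  (1 - z) ^ ((α : ℂ) + 1) * deriv f z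

end Concave

end

open Set Filter Topology MeasureTheory

noncomputable section

namespace Concave

open Complex ComplexConjugate

/-! Put `m = α - 1` and transplant `f` to the right half-plane: `F = f ∘ cayley`, so that the
boundary point `1` becomes `∞`. With `q = F''/F'` everything passes through the second order
inequality `Re z * |q|² ≤ m * Re q`. For `q ≠ 0` it says `Re (1/q) ≥ Re z / m`. A direct computation
gives `z + (1 - z²) q/m = 1 - (2/m) w s'(w)/s(w)` at `w = cayley z`. By `re_identity` the second
order inequality makes the real part of the left side nonnegative. Conversely, Schwarz–Pick for this
function, which fixes `1`, returns the inequality. So Kaplan's condition and the second order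
inequality are equivalent.

From geometry to the inequality. Let `K` be the complement of the image of `F`; it is closed, convex
and unbounded. Translations by `-t e` (`e` a recession direction of `K`) and dilations about points
of `K` preserve the image, so they induce self-maps of the half-plane with an orbit tending to `∞`.
By Julia–Wolff such maps do not decrease real parts, and differentiating in the parameter gives `Re
(-e/F') ≥ 0` and, when `K` contains no line, `Re ((F - k)/F') ≥ 0` for `k ∈ K`. The latter and a
boundary minimum principle for `w ↦ F'(z)/(F z - F w) - 1/(z - w)` yield `Re q ≥ 0`. The former,
over all recession directions, bounds the oscillation of `arg F'` by `m π`, because the opening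
angle determines the measure of these directions. Hence `|q| Re z ≤ m`, and Julia's inequality for
`1/q` finishes this direction. If `K` contains a line, then `F` is affine.

From the inequality to geometry. Kaplan's condition also bounds the oscillation of `Im L` by `m π ≤
π`, where `F' = exp L`. Noshiro–Warschawski gives injectivity. Since `Re L' ≥ 0`, vertical lines
have images that turn monotonically by at most `π`, so each lies on one side of its tangents.
Phragmén–Lindelöf propagates this to `Re (F'(z)/(F z - F w)) ≥ Re (1/(z - w))` for all `z ≠ w`.
Letting `w` leave the half-plane while `F w` runs along a segment from `F z` to `k ∈ K` gives `Re
(F'/(F - k)) > 0`, which forces `K` to be convex. The oscillation bound supplies enough recession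
directions to bound the opening angle. -/

/-- The open right half-plane. -/
def rightHalf : Set ℂ := {z | 0 < z.re}

lemma mem_rightHalf {z : ℂ} : z ∈ rightHalf ↔ 0 < z.re := Iff.rfl

lemma isOpen_rightHalf : IsOpen rightHalf := isOpen_lt continuous_const continuous_re

lemma convex_rightHalf : Convex ℝ rightHalf := convex_halfSpace_re_gt 0

lemma ofReal_mem_rightHalf {x : ℝ} : (x : ℂ) ∈ rightHalf ↔ 0 < x := by simp [mem_rightHalf]

lemma rightHalf_mem_nhds {z : ℂ} (hz : z ∈ rightHalf) : rightHalf ∈ 𝓝 z :=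
  isOpen_rightHalf.mem_nhds hz

/-! ### Schwarz–Pick and Julia–Wolff in the right half-plane. -/

lemma norm_add_conj_sq (a b : ℂ) :
    ‖a + conj b‖ ^ 2 = ‖a - b‖ ^ 2 + 4 * (a.re * b.re) := by
  simp only [← normSq_eq_norm_sq, normSq_apply, add_re, add_im, sub_re, sub_im, conj_re, conj_im]
  ring

/-- The Schwarz–Pick inequality for self-maps of the right half-plane. -/
lemma schwarz_pick_of_pos {P : ℂ → ℂ} (hP : DifferentiableOn ℂ P rightHalf)
    (hpos : ∀ z ∈ rightHalf, 0 < (P z).re) {z w : ℂ} (hz : z ∈ rightHalf) (hw : w ∈ rightHalf) :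
    ‖P z - P w‖ ^ 2 * (z.re * w.re) ≤ (P z).re * (P w).re * ‖z - w‖ ^ 2 := by
  have hden : ∀ a b : ℂ, 0 < a.re → 0 < b.re → a + conj b ≠ 0 := by
    intro a b ha hb h
    have := congrArg re h
    simp at this
    linarith
  -- `m` is the Möbius map of the unit disk onto the half-plane with `m 0 = w`. The analogous map at
  -- `P w` turns `P ∘ m` into `Φ`, to which the Schwarz lemma applies.
  set m : ℂ → ℂ := fun v => (w + conj w * v) / (1 - v) with hm
  have hm1 : ∀ v ∈ Metric.ball (0 : ℂ) 1, 1 - v ≠ 0 := by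
    intro v hv h
    have : v = 1 := by linear_combination -h
    simp [this] at hv
  have hmre : ∀ v ∈ Metric.ball (0 : ℂ) 1, m v ∈ rightHalf := by
    intro v hv
    have h1 := hm1 v hv
    have hv1 : normSq v < 1 := by
      rw [normSq_eq_norm_sq]
      have : ‖v‖ < 1 := by simpa using hv
      have := norm_nonneg v
      nlinarith
    have h2 : 0 < normSq (1 - v) := normSq_pos.2 h1
    rw [mem_rightHalf, hm]
    simp only [div_re]
    rw [← add_div]
    apply div_pos _ h2
    rw [normSq_apply] at hv1
    simp only [add_re, mul_re, conj_re, conj_im, add_im, mul_im, sub_re, sub_im, one_re, one_im]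
    have hw' : 0 < w.re := hw
    nlinarith
  have hmd : DifferentiableOn ℂ m (Metric.ball 0 1) := by
    intro v hv
    have := hm1 v hv
    exact (by fun_prop (disch := assumption) : DifferentiableAt ℂ m v).differentiableWithinAt
  set Φ : ℂ → ℂ := fun v => (P (m v) - P w) / (P (m v) + conj (P w)) with hΦ
  have hPm : DifferentiableOn ℂ (fun v => P (m v)) (Metric.ball 0 1) :=
    hP.comp hmd hmre
  have hΦd : DifferentiableOn ℂ Φ (Metric.ball 0 1) :=
    (hPm.sub_const _).div (hPm.add_const _) fun v hv =>
      hden _ _ (hpos _ (hmre v hv)) (hpos _ hw)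
  have hΦm : MapsTo Φ (Metric.ball 0 1) (Metric.closedBall 0 1) := by
    intro v hv
    have h1 := hpos _ (hmre v hv)
    have h2 := hpos _ hw
    have h3 := norm_add_conj_sq (P (m v)) (P w)
    have h4 : 0 < ‖P (m v) + conj (P w)‖ := norm_pos_iff.2 (hden _ _ h1 h2)
    simp only [mem_closedBall_zero_iff, hΦ, norm_div]
    rw [div_le_one h4]
    have : 0 < (P (m v)).re * (P w).re := mul_pos h1 h2
    nlinarith [norm_nonneg (P (m v) - P w)]
  have hm0 : m 0 = w := by simp [hm]
  have hΦ0 : Φ 0 = 0 := by simp [hΦ, hm0]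
  set v₀ : ℂ := (z - w) / (z + conj w) with hv₀
  have hzw := hden z w hz hw
  have hzw' : 0 < ‖z + conj w‖ := norm_pos_iff.2 hzw
  have hv₀n : ‖v₀‖ < 1 := by
    rw [hv₀, norm_div, div_lt_one hzw']
    have h3 := norm_add_conj_sq z w
    have : 0 < z.re * w.re := mul_pos hz hw
    nlinarith [norm_nonneg (z - w)]
  have hmv₀ : m v₀ = z := by
    have h1 : 1 - v₀ ≠ 0 := hm1 v₀ (by simpa using hv₀n)
    have h2 : 1 - v₀ = (w + conj w) / (z + conj w) := by
      rw [hv₀]; field_simp; ring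
    rw [h2] at h1
    have h3 : w + conj w ≠ 0 := fun h => h1 (by rw [h, zero_div])
    simp only [hm]
    rw [h2, hv₀]
    field_simp
    ring
  have key := norm_le_norm_of_mapsTo_ball hΦd hΦm hΦ0 hv₀n
  simp only [hΦ] at key
  rw [hmv₀, hv₀, norm_div, norm_div] at key
  have h4 : 0 < ‖P z + conj (P w)‖ := norm_pos_iff.2 (hden _ _ (hpos _ hz) (hpos _ hw))
  rw [div_le_div_iff₀ h4 hzw'] at key
  have key2 := pow_le_pow_left₀ (by positivity) key 2
  rw [mul_pow, mul_pow, norm_add_conj_sq, norm_add_conj_sq] at key2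
  nlinarith

/-- The Schwarz–Pick inequality for maps of the right half-plane into its closure. -/
lemma schwarz_pick {P : ℂ → ℂ} (hP : DifferentiableOn ℂ P rightHalf)
    (hpos : ∀ z ∈ rightHalf, 0 ≤ (P z).re) {z w : ℂ} (hz : z ∈ rightHalf) (hw : w ∈ rightHalf) :
    ‖P z - P w‖ ^ 2 * (z.re * w.re) ≤ (P z).re * (P w).re * ‖z - w‖ ^ 2 := by
  have hlim : Tendsto (fun ε : ℝ => ((P z).re + ε) * ((P w).re + ε) * ‖z - w‖ ^ 2) (𝓝[>] 0)
      (𝓝 ((P z).re * (P w).re * ‖z - w‖ ^ 2)) := by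
    have : Continuous (fun ε : ℝ => ((P z).re + ε) * ((P w).re + ε) * ‖z - w‖ ^ 2) := by fun_prop
    simpa using (this.tendsto 0).mono_left nhdsWithin_le_nhds
  refine ge_of_tendsto hlim ?_
  filter_upwards [self_mem_nhdsWithin] with ε (hε : 0 < ε)
  have := schwarz_pick_of_pos (P := fun v => P v + (ε : ℂ)) (hP.add_const _)
    (fun v hv => by simpa using add_pos_of_nonneg_of_pos (hpos v hv) hε) hz hw
  simpa using this

/-- By `norm_add_conj_sq` both squared norms grow by matching multiples of the real parts, so this
is Schwarz–Pick with one point reflected. This form survives when that point runs to the boundary or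
to `∞`. -/
lemma schwarz_pick_add {P : ℂ → ℂ} (hP : DifferentiableOn ℂ P rightHalf)
    (hpos : ∀ z ∈ rightHalf, 0 ≤ (P z).re) {z w : ℂ} (hz : z ∈ rightHalf) (hw : w ∈ rightHalf) :
    ‖P z + conj (P w)‖ ^ 2 * (z.re * w.re) ≤ (P z).re * (P w).re * ‖z + conj w‖ ^ 2 := by
  have := schwarz_pick hP hpos hz hw
  rw [norm_add_conj_sq, norm_add_conj_sq]
  nlinarith

lemma eq_of_re_eq_zero {P : ℂ → ℂ} (hP : DifferentiableOn ℂ P rightHalf)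
    (hpos : ∀ z ∈ rightHalf, 0 ≤ (P z).re) {z w : ℂ} (hz : z ∈ rightHalf) (hw : w ∈ rightHalf)
    (h0 : (P w).re = 0) : P z = P w := by
  have := schwarz_pick hP hpos hz hw
  rw [h0] at this
  have h1 : 0 < z.re * w.re := mul_pos hz hw
  have h2 : ‖P z - P w‖ ^ 2 ≤ 0 := by
    by_contra h
    push Not at h
    nlinarith [mul_pos h h1]
  have h3 : ‖P z - P w‖ = 0 := by nlinarith [norm_nonneg (P z - P w)]
  exact sub_eq_zero.1 (norm_eq_zero.1 h3)

/-- Divide Schwarz–Pick by `‖w - z‖ ^ 2` and let `w → z`. -/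
lemma norm_deriv_mul_re_le {P : ℂ → ℂ} (hP : DifferentiableOn ℂ P rightHalf)
    (hpos : ∀ z ∈ rightHalf, 0 ≤ (P z).re) {z : ℂ} (hz : z ∈ rightHalf) :
    ‖deriv P z‖ * z.re ≤ (P z).re := by
  have hd := (hP.differentiableAt (rightHalf_mem_nhds hz)).hasDerivAt
  have h1 := (hasDerivAt_iff_tendsto_slope.1 hd).norm.pow 2
  have hPc : Tendsto P (𝓝[≠] z) (𝓝 (P z)) := hd.continuousAt.tendsto.mono_left nhdsWithin_le_nhds
  have hidc : Tendsto (fun w : ℂ => w) (𝓝[≠] z) (𝓝 z) := tendsto_id.mono_left nhdsWithin_le_nhds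
  have h2 : Tendsto (fun w => (P w).re * (P z).re) (𝓝[≠] z) (𝓝 ((P z).re * (P z).re)) :=
    ((continuous_re.tendsto _).comp hPc).mul_const _
  have h3 : Tendsto (fun w => ‖slope P z w‖ ^ 2 * (w.re * z.re)) (𝓝[≠] z)
      (𝓝 (‖deriv P z‖ ^ 2 * (z.re * z.re))) :=
    h1.mul (((continuous_re.tendsto _).comp hidc).mul_const _)
  have h4 := le_of_tendsto_of_tendsto h3 h2 (by
    filter_upwards [self_mem_nhdsWithin, nhdsWithin_le_nhds (rightHalf_mem_nhds hz)] with w hwz hw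
    have hsp := schwarz_pick hP hpos hw hz
    have hne : 0 < ‖w - z‖ := norm_pos_iff.2 (sub_ne_zero.2 hwz)
    rw [slope_def_field, norm_div, div_pow, div_mul_eq_mul_div, div_le_iff₀ (by positivity)]
    exact hsp)
  have h5 := hpos z hz
  have h6 : 0 < z.re := hz
  nlinarith [mul_nonneg (norm_nonneg (deriv P z)) h6.le]

/-- The Julia–Wolff inequality at the boundary point `∞` of the right half-plane. -/
lemma julia {ι : Type*} {l : Filter ι} [l.NeBot] {P : ℂ → ℂ} (hP : DifferentiableOn ℂ P rightHalf)
    (hpos : ∀ z ∈ rightHalf, 0 ≤ (P z).re) {w : ι → ℂ} {C : ℝ}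
    (hw : ∀ᶠ i in l, w i ∈ rightHalf)
    (hwt : Tendsto (fun i => ‖w i‖) l atTop) (hPt : Tendsto (fun i => ‖P (w i)‖) l atTop)
    (hC : ∀ᶠ i in l, (P (w i)).re * ‖w i‖ ^ 2 ≤ C * (w i).re * ‖P (w i)‖ ^ 2)
    {z : ℂ} (hz : z ∈ rightHalf) : z.re ≤ C * (P z).re := by
  -- Reflected Schwarz–Pick between `z` and `w i` is divided by `‖w i‖ ^ 2 * ‖P (w i)‖ ^ 2`; the
  -- fixed quantities `z` and `P z` then drop out in the limit.
  have e1 : Tendsto (fun i => ‖P z‖ / ‖P (w i)‖) l (𝓝 0) := hPt.const_div_atTop _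
  have e2 : Tendsto (fun i => ‖z‖ / ‖w i‖) l (𝓝 0) := hwt.const_div_atTop _
  have t1 : Tendsto (fun i => (1 - ‖P z‖ / ‖P (w i)‖) ^ 2 * z.re) l (𝓝 ((1 - 0) ^ 2 * z.re)) :=
    ((e1.const_sub 1).pow 2).mul_const _
  have t2 : Tendsto (fun i => C * (P z).re * (‖z‖ / ‖w i‖ + 1) ^ 2) l
      (𝓝 (C * (P z).re * (0 + 1) ^ 2)) := ((e2.add_const 1).pow 2).const_mul _
  have := le_of_tendsto_of_tendsto t1 t2 (by
    filter_upwards [hw, hC, hwt.eventually_gt_atTop 0, hPt.eventually_gt_atTop ‖P z‖]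
      with i hi hCi hwi hPi
    have hx : 0 < (w i).re := hi
    have hPi0 : 0 < ‖P (w i)‖ := (norm_nonneg _).trans_lt hPi
    have hsp := schwarz_pick_add hP hpos hz hi
    have h1 : ‖P (w i)‖ - ‖P z‖ ≤ ‖P z + conj (P (w i))‖ := by
      have := norm_sub_norm_le (conj (P (w i))) (-P z)
      simpa [norm_neg, add_comm] using this
    have h2 : ‖z + conj (w i)‖ ≤ ‖z‖ + ‖w i‖ := by
      simpa using norm_add_le z (conj (w i))
    have h3 : (‖P (w i)‖ - ‖P z‖) ^ 2 * (z.re * (w i).re) ≤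
        (P z).re * (P (w i)).re * (‖z‖ + ‖w i‖) ^ 2 := by
      have ha : (‖P (w i)‖ - ‖P z‖) ^ 2 ≤ ‖P z + conj (P (w i))‖ ^ 2 :=
        pow_le_pow_left₀ (by linarith) h1 2
      have hb : ‖z + conj (w i)‖ ^ 2 ≤ (‖z‖ + ‖w i‖) ^ 2 :=
        pow_le_pow_left₀ (norm_nonneg _) h2 2
      calc _ ≤ ‖P z + conj (P (w i))‖ ^ 2 * (z.re * (w i).re) :=
            mul_le_mul_of_nonneg_right ha (mul_nonneg (le_of_lt hz) hx.le)
        _ ≤ _ := hsp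
        _ ≤ _ := mul_le_mul_of_nonneg_left hb (mul_nonneg (hpos _ hz) (hpos _ hi))
    have h4 : (‖P (w i)‖ - ‖P z‖) ^ 2 * (z.re * (w i).re) * ‖w i‖ ^ 2 ≤
        (P z).re * (‖z‖ + ‖w i‖) ^ 2 * (C * (w i).re * ‖P (w i)‖ ^ 2) := by
      calc _ ≤ (P z).re * (P (w i)).re * (‖z‖ + ‖w i‖) ^ 2 * ‖w i‖ ^ 2 :=
            mul_le_mul_of_nonneg_right h3 (by positivity)
        _ = (P z).re * (‖z‖ + ‖w i‖) ^ 2 * ((P (w i)).re * ‖w i‖ ^ 2) := by ring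
        _ ≤ _ := mul_le_mul_of_nonneg_left hCi (mul_nonneg (hpos _ hz) (by positivity))
    have h5 : (‖P (w i)‖ - ‖P z‖) ^ 2 * z.re * ‖w i‖ ^ 2 ≤
        C * (P z).re * (‖z‖ + ‖w i‖) ^ 2 * ‖P (w i)‖ ^ 2 := by
      refine le_of_mul_le_mul_right ?_ hx
      linarith
    have h6 : 1 - ‖P z‖ / ‖P (w i)‖ = (‖P (w i)‖ - ‖P z‖) / ‖P (w i)‖ := by
      field_simp
    have h7 : ‖z‖ / ‖w i‖ + 1 = (‖z‖ + ‖w i‖) / ‖w i‖ := by field_simp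
    rw [h6, h7, div_pow, div_pow, div_mul_eq_mul_div, mul_div_assoc',
      div_le_div_iff₀ (by positivity) (by positivity)]
    exact h5)
  simpa using this

/-- A self-map of the right half-plane with an orbit tending to `∞` does not decrease real
parts. -/
lemma re_le_re_of_orbit {ψ : ℂ → ℂ} (hψ : DifferentiableOn ℂ ψ rightHalf)
    (hm : MapsTo ψ rightHalf rightHalf) {w : ℕ → ℂ} (hw : ∀ n, w n ∈ rightHalf)
    (hs : ∀ n, w (n + 1) = ψ (w n)) (hwt : Tendsto (fun n => ‖w n‖) atTop atTop)
    {z : ℂ} (hz : z ∈ rightHalf) : z.re ≤ (ψ z).re := by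
  -- `J n` is `Re (1 / w n)`. It is positive and tends to `0`, so it cannot increase from some index
  -- on. Along the indices where it does not increase, Julia's hypothesis holds with constant `1`.
  set J : ℕ → ℝ := fun n => (w n).re / ‖w n‖ ^ 2 with hJ
  have hn : ∀ n, 0 < ‖w n‖ := fun n => by
    refine norm_pos_iff.2 fun h => ?_
    have := hw n
    simp [h, mem_rightHalf] at this
  have hJpos : ∀ n, 0 < J n := fun n => div_pos (hw n) (pow_pos (hn n) 2)
  have hJ0 : Tendsto J atTop (𝓝 0) := by
    have h1 : Tendsto (fun n => 1 / ‖w n‖) atTop (𝓝 0) := hwt.const_div_atTop _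
    refine squeeze_zero (fun n => (hJpos n).le) (fun n => ?_) h1
    rw [hJ]
    simp only
    rw [div_le_div_iff₀ (pow_pos (hn n) 2) (hn n)]
    have := re_le_norm (w n)
    nlinarith [hn n]
  have hfreq : ∃ᶠ n in atTop, J (n + 1) ≤ J n := by
    intro hcon
    obtain ⟨N, hN⟩ := eventually_atTop.1 hcon
    have hmono : ∀ k, J N ≤ J (N + k) := by
      intro k
      induction k with
      | zero => simp
      | succ k ih =>
        have := hN (N + k) (by omega)
        push Not at this
        exact ih.trans (by simpa [add_assoc] using this.le)
    have h2 : Tendsto (fun k => J (N + k)) atTop (𝓝 0) :=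
      hJ0.comp (tendsto_add_atTop_nat N |>.congr fun k => add_comm _ _)
    have := ge_of_tendsto h2 (Eventually.of_forall hmono)
    exact absurd (hJpos N) (not_lt.2 this)
  set l : Filter ℕ := atTop ⊓ 𝓟 {n | J (n + 1) ≤ J n} with hl
  have : l.NeBot := frequently_mem_iff_neBot.1 hfreq
  have hle : l ≤ atTop := inf_le_left
  have hmem : ∀ᶠ n in l, J (n + 1) ≤ J n := eventually_inf_principal.2 (Eventually.of_forall
    fun n h => h)
  have := julia (l := l) (P := ψ) (C := 1) (w := w) hψ (fun v hv => le_of_lt (hm hv))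
    (Eventually.of_forall hw) (hwt.mono_left hle) (by
      have h3 : Tendsto (fun n => ‖w (n + 1)‖) atTop atTop := hwt.comp (tendsto_add_atTop_nat 1)
      exact (h3.congr fun n => by rw [hs]).mono_left hle) (by
      filter_upwards [hmem] with n hJn
      rw [hJ] at hJn
      simp only at hJn
      rw [div_le_div_iff₀ (pow_pos (hn _) 2) (pow_pos (hn _) 2), hs] at hJn
      rw [one_mul]
      exact hJn) hz
  simpa using this

/-! ### Minimum principle and monotonicity along lines. -/

/-- A minimum principle on open sets. -/
lemma re_nonneg_of_eventually {U : Set ℂ} (hU : IsOpen U) {h : ℂ → ℂ}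
    (hd : DifferentiableOn ℂ h U)
    (hinf : ∀ ε > 0, ∃ R : ℝ, ∀ z ∈ U, R ≤ ‖z‖ → -ε ≤ (h z).re)
    (hbd : ∀ b ∈ frontier U, ∀ ε > 0, ∀ᶠ z in 𝓝[U] b, -ε ≤ (h z).re) {z : ℂ} (hz : z ∈ U) :
    0 ≤ (h z).re := by
  by_contra hneg
  push Not at hneg
  set ε := -(h z).re / 2 with hε
  have hεpos : 0 < ε := by rw [hε]; linarith
  -- The hypotheses make `V` bounded with closure inside `U`. On its frontier `-Re h ≤ ε`, while
  -- `-Re h = 2 ε` at `z`; this contradicts the maximum principle for `exp (-h)`.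
  set V : Set ℂ := U ∩ {v | (h v).re < -ε} with hV
  have hVsub : V ⊆ U := inter_subset_left
  have hre : ContinuousOn (fun v => (h v).re) U := continuous_re.comp_continuousOn hd.continuousOn
  have hVo : IsOpen V := hre.isOpen_inter_preimage hU isOpen_Iio
  have hcl : closure V ⊆ U := by
    intro b hb
    by_contra hbU
    have hbf : b ∈ frontier U := ⟨closure_mono hVsub hb, by rwa [hU.interior_eq]⟩
    have h1 := hbd b hbf ε hεpos
    have h2 : ∃ᶠ v in 𝓝 b, v ∈ V := mem_closure_iff_frequently.1 hb
    rw [eventually_nhdsWithin_iff] at h1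
    obtain ⟨v, hv, hv'⟩ := (h2.and_eventually h1).exists
    exact absurd (hv' hv.1) (not_le.2 hv.2)
  have hbdd : Bornology.IsBounded V := by
    obtain ⟨R, hR⟩ := hinf ε hεpos
    refine (Metric.isBounded_ball (x := (0 : ℂ)) (r := R)).subset fun v hv => ?_
    rw [mem_ball_zero_iff]
    by_contra hcon
    exact absurd (hR v hv.1 (not_lt.1 hcon)) (not_le.2 hv.2)
  have hdc : DiffContOnCl ℂ (fun v => exp (-h v)) V := by
    have : DifferentiableOn ℂ (fun v => exp (-h v)) (closure V) := (hd.mono hcl).neg.cexp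
    exact this.diffContOnCl
  have hle := norm_le_of_forall_mem_frontier_norm_le hbdd hdc (C := Real.exp ε) (by
    intro v hv
    rw [norm_exp, neg_re]
    apply Real.exp_le_exp.2
    have hvU := hcl (frontier_subset_closure hv)
    have hvV : v ∉ V := by
      have := hv.2
      rwa [hVo.interior_eq] at this
    have : ¬ (h v).re < -ε := fun hlt => hvV ⟨hvU, hlt⟩
    linarith) (z := z) (subset_closure ⟨hz, by simp only [mem_ofPred_eq]; rw [hε]; linarith⟩)
  rw [norm_exp, neg_re, Real.exp_le_exp] at hle
  rw [hε] at hle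
  linarith

lemma frontier_rightHalf_re {b : ℂ} (hb : b ∈ frontier rightHalf) : b.re = 0 := by
  have : frontier rightHalf = {z : ℂ | z.re = 0} := frontier_setOfPred_lt_re 0
  rw [this] at hb
  exact hb

lemma hasDerivAt_re_comp {g : ℝ → ℂ} {g' : ℂ} {x : ℝ} (h : HasDerivAt g g' x) :
    HasDerivAt (fun u => (g u).re) g'.re x :=
  reCLM.hasFDerivAt.comp_hasDerivAt x h

lemma hasDerivAt_im_comp {g : ℝ → ℂ} {g' : ℂ} {x : ℝ} (h : HasDerivAt g g' x) :
    HasDerivAt (fun u => (g u).im) g'.im x :=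
  imCLM.hasFDerivAt.comp_hasDerivAt x h

lemma hasDerivAt_comp_line {G : ℂ → ℂ} {G' z v : ℂ} {u : ℝ} (h : HasDerivAt G G' (z + u * v)) :
    HasDerivAt (fun u : ℝ => G (z + u * v)) (G' * v) u := by
  have h3 : HasDerivAt (fun w : ℂ => z + w * v) v (u : ℂ) := by
    simpa using ((hasDerivAt_id (u : ℂ)).mul_const v).const_add z
  exact (h.comp (u : ℂ) h3).comp_ofReal

/-- Monotonicity of the modulus along horizontal lines. -/
lemma norm_le_norm_add {G : ℂ → ℂ} (hG : DifferentiableOn ℂ G rightHalf) {a : ℝ} (ha : 0 < a)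
    (h : ∀ z : ℂ, a ≤ z.re → 0 ≤ (deriv G z * conj (G z)).re) {z : ℂ} (hz : a ≤ z.re) {t : ℝ}
    (ht : 0 ≤ t) : ‖G z‖ ≤ ‖G (z + t)‖ := by
  have hmem : ∀ u : ℝ, 0 ≤ u → z + u ∈ rightHalf := fun u hu => by
    simp only [mem_rightHalf, add_re, ofReal_re]; linarith
  have hder : ∀ u : ℝ, 0 ≤ u → HasDerivAt (fun u : ℝ => normSq (G (z + u)))
      (2 * (deriv G (z + u) * conj (G (z + u))).re) u := by
    intro u hu
    have h1 : HasDerivAt G (deriv G (z + u)) (z + u) :=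
      (hG.differentiableAt (rightHalf_mem_nhds (hmem u hu))).hasDerivAt
    have h2 : HasDerivAt (fun u : ℝ => G (z + u)) (deriv G (z + u)) u := by
      simpa using hasDerivAt_comp_line (v := 1) (u := u) (by simpa using h1)
    have hre := hasDerivAt_re_comp h2
    have him := hasDerivAt_im_comp h2
    have e : (fun u : ℝ => normSq (G (z + u))) = (fun u : ℝ => (G (z + u)).re * (G (z + u)).re +
        (G (z + u)).im * (G (z + u)).im) := by
      funext u
      rw [normSq_apply]
    rw [e]
    refine ((hre.mul hre).add (him.mul him)).congr_deriv ?_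
    simp only [mul_re, conj_re, conj_im]
    ring
  have hmono : MonotoneOn (fun u : ℝ => normSq (G (z + u))) (Ici 0) := by
    apply monotoneOn_of_deriv_nonneg (convex_Ici 0)
    · exact fun u hu => (hder u hu).continuousAt.continuousWithinAt
    · intro u hu
      rw [interior_Ici] at hu
      exact (hder u (le_of_lt hu)).differentiableAt.differentiableWithinAt
    · intro u hu
      rw [interior_Ici] at hu
      have hu' : 0 < u := hu
      rw [(hder u hu'.le).deriv]
      have := h (z + u) (by simp only [add_re, ofReal_re]; linarith)
      linarith
  have := hmono self_mem_Ici (mem_Ici.2 ht) ht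
  simp only [ofReal_zero, add_zero, normSq_eq_norm_sq] at this
  exact (pow_le_pow_iff_left₀ (norm_nonneg _) (norm_nonneg _) two_ne_zero).1 this

/-! ### Closed convex sets: support, recession cone and opening angle. -/

lemma inner_eq_re (a b : ℂ) : inner ℝ a b = (b * conj a).re := by
  simp only [Complex.inner, mul_re, conj_re, conj_im]

/-- The half-plane supporting a closed convex set at the point nearest to a point outside. -/
lemma exists_support {K : Set ℂ} (hc : IsClosed K) (hK : Convex ℝ K) (hne : K.Nonempty) {w : ℂ}
    (hw : w ∉ K) : ∃ k ∈ K, ∃ ν : ℂ, ∃ δ : ℝ, ‖ν‖ = 1 ∧ 0 < δ ∧ w = k + δ * ν ∧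
      δ = Metric.infDist w K ∧ (∀ v ∈ K, ((v - k) * conj ν).re ≤ 0) ∧
      ∀ p ∈ rightHalf, k + p * ν ∉ K := by
  obtain ⟨k, hk, hmin⟩ := exists_norm_eq_iInf_of_complete_convex hne hc.isComplete hK w
  have hin := (norm_eq_iInf_iff_real_inner_le_zero hK hk).1 hmin
  have hδ : 0 < ‖w - k‖ := norm_pos_iff.2 (sub_ne_zero.2 fun h => hw (h ▸ hk))
  have hδ' : (‖w - k‖ : ℂ) ≠ 0 := by exact_mod_cast hδ.ne'
  refine ⟨k, hk, (w - k) / ‖w - k‖, ‖w - k‖, ?_, hδ, ?_, ?_, ?_⟩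
  · rw [norm_div, norm_real, norm_norm, div_self hδ.ne']
  · field_simp; ring
  · rw [Metric.infDist_eq_iInf, hmin]
    simp only [dist_eq_norm]
  have h1 : ∀ v ∈ K, ((v - k) * conj ((w - k) / ‖w - k‖)).re ≤ 0 := by
    intro v hv
    have := hin v hv
    rw [inner_eq_re] at this
    rw [map_div₀, conj_ofReal, ← mul_div_assoc, div_ofReal_re]
    exact div_nonpos_of_nonpos_of_nonneg this hδ.le
  refine ⟨h1, fun p hp hmem => ?_⟩
  have h2 := h1 _ hmem
  have h3 : (k + p * ((w - k) / ‖w - k‖) - k) * conj ((w - k) / ‖w - k‖) = p := by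
    rw [add_sub_cancel_left, mul_assoc, mul_conj, normSq_eq_norm_sq, norm_div, norm_real,
      norm_norm, div_self hδ.ne']
    simp
  rw [h3] at h2
  exact absurd hp (not_lt.2 h2)

/-- The recession cone of a set. -/
def recCone (K : Set ℂ) : Set ℂ := {e | ∀ k ∈ K, ∀ t : ℝ, 0 ≤ t → k + t * e ∈ K}

/-- The convex combinations `(1 - s t) k + s t x` of `k` and the far points `x` lie in `K` once `s t
< 1`, and they tend to `k + s e`. -/
lemma mem_recCone_of_tendsto {K : Set ℂ} (hc : IsClosed K) (hK : Convex ℝ K) {ι : Type*}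
    {l : Filter ι} [l.NeBot] {x : ι → ℂ} {t : ι → ℝ} {e : ℂ} (hx : ∀ᶠ i in l, x i ∈ K)
    (ht : Tendsto t l (𝓝 0)) (ht0 : ∀ᶠ i in l, 0 ≤ t i)
    (he : Tendsto (fun i => (t i : ℂ) * x i) l (𝓝 e)) : e ∈ recCone K := by
  intro k hk s hs
  have htc : Tendsto (fun i => (t i : ℂ)) l (𝓝 ((0 : ℝ) : ℂ)) :=
    (continuous_ofReal.tendsto _).comp ht
  have h1 : Tendsto (fun i => (1 - s * (t i : ℂ)) * k + s * ((t i : ℂ) * x i)) l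
      (𝓝 ((1 - s * ((0 : ℝ) : ℂ)) * k + s * e)) :=
    (((htc.const_mul _).const_sub 1).mul_const k).add (he.const_mul _)
  have h2 : (1 - (s : ℂ) * ((0 : ℝ) : ℂ)) * k + s * e = k + s * e := by simp
  rw [h2] at h1
  refine hc.mem_of_tendsto h1 ?_
  have h3 : Tendsto (fun i => s * t i) l (𝓝 (s * 0)) := ht.const_mul s
  rw [mul_zero] at h3
  filter_upwards [hx, ht0, h3.eventually_lt_const (zero_lt_one)] with i hi hti hsi
  have := hK hk hi (a := 1 - s * t i) (b := s * t i) (by linarith) (mul_nonneg hs hti) (by ring)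
  simp only [real_smul, ofReal_sub, ofReal_mul, ofReal_one] at this
  rwa [mul_assoc (s : ℂ)] at this

lemma isClosed_recCone {K : Set ℂ} (hc : IsClosed K) : IsClosed (recCone K) := by
  have : recCone K = ⋂ k ∈ K, ⋂ t : ℝ, ⋂ _ : 0 ≤ t, (fun e : ℂ => k + t * e) ⁻¹' K := by
    ext e
    simp [recCone]
  rw [this]
  exact isClosed_biInter fun k _ => isClosed_iInter fun t => isClosed_iInter fun _ =>
    hc.preimage (by fun_prop)

lemma combination_mem {K : Set ℂ} {e₁ e₂ k : ℂ} (h₁ : e₁ ∈ recCone K) (h₂ : e₂ ∈ recCone K)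
    (hk : k ∈ K) {a b : ℝ} (ha : 0 ≤ a) (hb : 0 ≤ b) : k + (a * e₁ + b * e₂) ∈ K := by
  rw [← add_assoc]
  exact h₂ _ (h₁ k hk a ha) b hb

lemma mem_recCone_of_ray {K : Set ℂ} (hc : IsClosed K) (hK : Convex ℝ K) {k e : ℂ}
    (h : ∀ t : ℝ, 0 < t → k + t * e ∈ K) : e ∈ recCone K := by
  have hinv : Tendsto (fun n : ℕ => ((n : ℝ) + 1)⁻¹) atTop (𝓝 0) :=
    tendsto_inv_atTop_zero.comp (tendsto_atTop_add_const_right _ _ tendsto_natCast_atTop_atTop)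
  refine mem_recCone_of_tendsto hc hK (l := atTop) (x := fun n : ℕ => k + ((n + 1 : ℝ) : ℂ) * e)
    (t := fun n => ((n : ℝ) + 1)⁻¹) (Eventually.of_forall fun n => h _ (by positivity)) hinv
    (Eventually.of_forall fun n => by positivity) ?_
  have h1 : Tendsto (fun n : ℕ => ((((n : ℝ) + 1)⁻¹ : ℝ) : ℂ) * k + e) atTop
      (𝓝 (((0 : ℝ) : ℂ) * k + e)) :=
    (((continuous_ofReal.tendsto _).comp hinv).mul_const k).add_const e
  simp only [ofReal_zero, zero_mul, zero_add] at h1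
  refine h1.congr fun n => ?_
  have : ((n : ℂ) + 1) ≠ 0 := by exact_mod_cast n.succ_ne_zero
  push_cast
  field_simp

/-- An unbounded closed convex set recedes in some direction. -/
lemma exists_unit_mem_recCone {K : Set ℂ} (hc : IsClosed K) (hK : Convex ℝ K)
    (hb : ¬ Bornology.IsBounded K) : ∃ e ∈ recCone K, ‖e‖ = 1 := by
  have h1 : ∀ n : ℕ, ∃ x ∈ K, (n : ℝ) + 1 ≤ ‖x‖ := by
    intro n
    by_contra hcon
    push Not at hcon
    refine hb ((Metric.isBounded_ball (x := (0 : ℂ)) (r := (n : ℝ) + 1)).subset fun x hx => ?_)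
    simpa using hcon x hx
  choose x hxK hxn using h1
  have hpos : ∀ n, 0 < ‖x n‖ := fun n => lt_of_lt_of_le (by positivity) (hxn n)
  obtain ⟨e, he, φ, hφ, hlim⟩ := (isCompact_sphere (0 : ℂ) 1).tendsto_subseq
    (x := fun n => ((‖x n‖⁻¹ : ℝ) : ℂ) * x n) (fun n => by
      rw [mem_sphere_zero_iff_norm, norm_mul, norm_real, norm_inv, norm_norm,
        inv_mul_cancel₀ (hpos n).ne'])
  have hinf : Tendsto (fun n => ‖x n‖) atTop atTop :=
    tendsto_atTop_mono hxn (tendsto_atTop_add_const_right _ _ tendsto_natCast_atTop_atTop)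
  refine ⟨e, mem_recCone_of_tendsto hc hK (l := atTop) (x := x ∘ φ) (t := fun n => ‖x (φ n)‖⁻¹)
    (Eventually.of_forall fun n => hxK _) (tendsto_inv_atTop_zero.comp
      (hinf.comp hφ.tendsto_atTop)) (Eventually.of_forall fun n => by positivity) hlim,
    by simpa using he⟩

/-- Cramer's rule in the basis `exp (θ₁ I)`, `exp (θ₂ I)`, whose determinant is `sin (θ₂ - θ₁)`. The
signs of the coefficients decide whether `v` is in the cone they span. -/
lemma sin_mul_eq (θ₁ θ₂ : ℝ) (v : ℂ) : (Real.sin (θ₂ - θ₁) : ℂ) * v =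
    ((v.re * Real.sin θ₂ - v.im * Real.cos θ₂ : ℝ) : ℂ) * exp (θ₁ * I) +
      ((Real.cos θ₁ * v.im - Real.sin θ₁ * v.re : ℝ) : ℂ) * exp (θ₂ * I) := by
  rw [Real.sin_sub]
  apply Complex.ext
  · simp only [mul_re, add_re, ofReal_re, ofReal_im, exp_ofReal_mul_I_re, exp_ofReal_mul_I_im]
    ring
  · simp only [mul_im, add_im, ofReal_re, ofReal_im, exp_ofReal_mul_I_re, exp_ofReal_mul_I_im]
    ring

/-- The arguments of the directions in the recession cone. -/
def recAngles (K : Set ℂ) : Set ℝ := {θ | exp (θ * I) ∈ recCone K}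

lemma isClosed_recAngles {K : Set ℂ} (hc : IsClosed K) : IsClosed (recAngles K) :=
  (isClosed_recCone hc).preimage (by fun_prop)

lemma recAngles_mem_of_between {K : Set ℂ} {θ₁ θ₂ θ : ℝ}
    (h₁ : θ₁ ∈ recAngles K) (h₂ : θ₂ ∈ recAngles K) (h1 : θ₁ < θ) (h2 : θ < θ₂)
    (hπ : θ₂ < θ₁ + Real.pi) : θ ∈ recAngles K := by
  have hs : 0 < Real.sin (θ₂ - θ₁) := Real.sin_pos_of_pos_of_lt_pi (by linarith) (by linarith)
  have hs1 : 0 < Real.sin (θ₂ - θ) := Real.sin_pos_of_pos_of_lt_pi (by linarith) (by linarith)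
  have hs2 : 0 < Real.sin (θ - θ₁) := Real.sin_pos_of_pos_of_lt_pi (by linarith) (by linarith)
  intro k hk t ht
  have key := sin_mul_eq θ₁ θ₂ (exp (θ * I))
  simp only [exp_ofReal_mul_I_re, exp_ofReal_mul_I_im] at key
  have e1 : Real.cos θ * Real.sin θ₂ - Real.sin θ * Real.cos θ₂ = Real.sin (θ₂ - θ) := by
    rw [Real.sin_sub]; ring
  have e2 : Real.cos θ₁ * Real.sin θ - Real.sin θ₁ * Real.cos θ = Real.sin (θ - θ₁) := by
    rw [Real.sin_sub]; ring
  rw [e1, e2] at key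
  have hsc : (Real.sin (θ₂ - θ₁) : ℂ) ≠ 0 := by exact_mod_cast hs.ne'
  have := combination_mem h₁ h₂ hk (a := t * Real.sin (θ₂ - θ) / Real.sin (θ₂ - θ₁))
    (b := t * Real.sin (θ - θ₁) / Real.sin (θ₂ - θ₁)) (by positivity) (by positivity)
  convert this using 2
  rw [ofReal_div, ofReal_div, ofReal_mul, ofReal_mul]
  generalize exp (θ₁ * I) = E₁ at key ⊢
  generalize exp (θ₂ * I) = E₂ at key ⊢
  generalize exp (θ * I) = E at key ⊢
  field_simp
  linear_combination (t : ℂ) * key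

/-- The set of angles is periodic, so it is not convex in general; inside an open window of length
`π` it is, and convex sets have null frontier. Windows starting at the multiples of `π / 2` overlap
and cover the line. -/
lemma ae_notMem_frontier_recAngles (K : Set ℂ) : ∀ᵐ θ : ℝ, θ ∉ frontier (recAngles K) := by
  have hconv : ∀ a : ℝ, Convex ℝ (recAngles K ∩ Ioo a (a + Real.pi)) := by
    intro a
    apply OrdConnected.convex
    refine ordConnected_of_Ioo fun x hx y hy _ z hz => ⟨?_, ?_⟩
    · exact recAngles_mem_of_between hx.1 hy.1 hz.1 hz.2 (by linarith [hx.2.1, hy.2.2])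
    · exact ⟨hx.2.1.trans hz.1, hz.2.trans hy.2.2⟩
  have hnull : ∀ n : ℤ, ∀ᵐ θ : ℝ,
      θ ∉ frontier (recAngles K ∩ Ioo (n * (Real.pi / 2)) (n * (Real.pi / 2) + Real.pi)) :=
    fun n => measure_eq_zero_iff_ae_notMem.1 ((hconv _).addHaar_frontier volume)
  filter_upwards [ae_all_iff.2 hnull] with θ hθ hmem
  have hπ := Real.pi_pos
  set n : ℤ := ⌈θ / (Real.pi / 2)⌉ - 1 with hn
  have h1 : (n : ℝ) * (Real.pi / 2) < θ := by
    have := Int.ceil_lt_add_one (θ / (Real.pi / 2))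
    rw [← lt_div_iff₀ (by positivity)]
    push_cast [hn]
    linarith
  have h2 : θ < (n : ℝ) * (Real.pi / 2) + Real.pi := by
    have := Int.le_ceil (θ / (Real.pi / 2))
    rw [div_le_iff₀ (by positivity)] at this
    push_cast [hn]
    linarith
  have hmI : θ ∈ Ioo ((n : ℝ) * (Real.pi / 2)) (n * (Real.pi / 2) + Real.pi) := ⟨h1, h2⟩
  refine hθ n ⟨?_, ?_⟩
  · exact isOpen_Ioo.closure_inter ⟨hmem.1, hmI⟩
  · intro h
    rw [interior_inter] at h
    exact hmem.2 h.1

lemma eventually_notMem_of_notMem_recAngles {K : Set ℂ} (hc : IsClosed K) (hK : Convex ℝ K) {θ : ℝ}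
    (hθ : θ ∉ recAngles K) : ∀ᶠ R : ℝ in atTop, (R : ℂ) * exp (θ * I) ∉ K := by
  by_contra hcon
  rw [not_eventually] at hcon
  simp only [not_not] at hcon
  set l : Filter ℝ := atTop ⊓ 𝓟 {R : ℝ | (R : ℂ) * exp (θ * I) ∈ K}
  have : l.NeBot := frequently_mem_iff_neBot.1 hcon
  have hle : l ≤ atTop := inf_le_left
  refine hθ (mem_recCone_of_tendsto hc hK (l := l) (x := fun R : ℝ => (R : ℂ) * exp (θ * I))
    (t := fun R => R⁻¹) (eventually_inf_principal.2 (Eventually.of_forall fun _ h => h))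
    (tendsto_inv_atTop_zero.mono_left hle) ?_ ?_)
  · filter_upwards [hle (eventually_ge_atTop 0)] with R hR using inv_nonneg.2 hR
  · refine tendsto_const_nhds.congr' ?_
    filter_upwards [hle (eventually_gt_atTop 0)] with R hR
    have : (R : ℂ) ≠ 0 := by exact_mod_cast (ne_of_gt hR)
    push_cast
    field_simp

/-- For `R` large, `R exp (θ I) - k` enters the cone spanned by the two recession directions at `θ ±
η`. At an end of the angle interval this can fail, hence the interior. -/
lemma eventually_mem_of_mem_interior {K : Set ℂ} (hne : K.Nonempty) {θ : ℝ}
    (hθ : θ ∈ interior (recAngles K)) : ∀ᶠ R : ℝ in atTop, (R : ℂ) * exp (θ * I) ∈ K := by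
  obtain ⟨k, hk⟩ := hne
  obtain ⟨ε, hε, hball⟩ := Metric.mem_nhds_iff.1 (mem_interior_iff_mem_nhds.1 hθ)
  set η := min (ε / 2) 1 with hη
  have hη0 : 0 < η := by positivity
  have hη1 : η ≤ 1 := min_le_right _ _
  have hηε : η < ε := (min_le_left _ _).trans_lt (by linarith)
  have hπ := Real.pi_gt_three
  have h₁ : θ - η ∈ recAngles K := hball (by
    rw [Metric.mem_ball, Real.dist_eq, sub_sub_cancel_left, abs_neg, abs_of_pos hη0]; exact hηε)
  have h₂ : θ + η ∈ recAngles K := hball (by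
    rw [Metric.mem_ball, Real.dist_eq, add_sub_cancel_left, abs_of_pos hη0]; exact hηε)
  have hs : 0 < Real.sin ((θ + η) - (θ - η)) :=
    Real.sin_pos_of_pos_of_lt_pi (by linarith) (by linarith)
  have hs1 : 0 < Real.sin η := Real.sin_pos_of_pos_of_lt_pi hη0 (by linarith)
  have hA := (tendsto_id (α := ℝ) (x := atTop)).atTop_mul_const hs1
  filter_upwards [hA.eventually_ge_atTop (k.re * Real.sin (θ + η) - k.im * Real.cos (θ + η)),
    hA.eventually_ge_atTop (Real.cos (θ - η) * k.im - Real.sin (θ - η) * k.re)] with R hR1 hR2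
  simp only [id] at hR1 hR2
  have key := sin_mul_eq (θ - η) (θ + η) (R * exp (θ * I) - k)
  set a := (R * exp (θ * I) - k).re * Real.sin (θ + η) -
    (R * exp (θ * I) - k).im * Real.cos (θ + η) with ha
  set b := Real.cos (θ - η) * (R * exp (θ * I) - k).im -
    Real.sin (θ - η) * (R * exp (θ * I) - k).re with hb
  have e1 : Real.sin η = Real.cos θ * Real.sin (θ + η) - Real.sin θ * Real.cos (θ + η) := by
    have := Real.sin_sub (θ + η) θ
    rw [add_sub_cancel_left] at this
    linarith
  have e2 : Real.sin η = Real.cos (θ - η) * Real.sin θ - Real.sin (θ - η) * Real.cos θ := by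
    have := Real.sin_sub θ (θ - η)
    rw [sub_sub_cancel] at this
    linarith
  have ha0 : 0 ≤ a := by
    rw [ha]
    simp only [sub_re, sub_im, re_ofReal_mul, im_ofReal_mul, exp_ofReal_mul_I_re,
      exp_ofReal_mul_I_im]
    rw [e1] at hR1
    linarith
  have hb0 : 0 ≤ b := by
    rw [hb]
    simp only [sub_re, sub_im, re_ofReal_mul, im_ofReal_mul, exp_ofReal_mul_I_re,
      exp_ofReal_mul_I_im]
    rw [e2] at hR2
    linarith
  have hsc : (Real.sin ((θ + η) - (θ - η)) : ℂ) ≠ 0 := by exact_mod_cast hs.ne'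
  have := combination_mem h₁ h₂ hk (a := a / Real.sin ((θ + η) - (θ - η)))
    (b := b / Real.sin ((θ + η) - (θ - η))) (by positivity) (by positivity)
  convert this using 1
  rw [ofReal_div, ofReal_div]
  clear_value a b
  generalize exp (((θ - η : ℝ) : ℂ) * I) = E₁ at key ⊢
  generalize exp (((θ + η : ℝ) : ℂ) * I) = E₂ at key ⊢
  generalize exp ((θ : ℂ) * I) = E at key ⊢
  field_simp
  linear_combination key

/-- The opening angle at infinity of the complement of a closed convex set. -/
lemma tendsto_angularMeasure_compl {K : Set ℂ} (hc : IsClosed K) (hK : Convex ℝ K)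
    (hne : K.Nonempty) : Tendsto (angularMeasure Kᶜ) atTop
      (𝓝 (2 * Real.pi - (volume (recAngles K ∩ Ioc (-Real.pi) Real.pi)).toReal)) := by
  have hfin : volume (Ioc (-Real.pi) Real.pi) ≠ ⊤ := by simp
  have hmE : MeasurableSet (recAngles K) := (isClosed_recAngles hc).measurableSet
  have hA : ∀ R : ℝ, {θ : ℝ | θ ∈ Ioc (-Real.pi) Real.pi ∧
      (R : ℂ) * exp (θ * I) ∈ Kᶜ} = Ioc (-Real.pi) Real.pi ∩
        ((fun θ : ℝ => (R : ℂ) * exp (θ * I)) ⁻¹' Kᶜ) := fun R => rfl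
  -- Off the null frontier every ray is eventually inside `K` or eventually outside it, so the
  -- indicators converge almost everywhere on a window of finite measure.
  have hlim := tendsto_measure_of_ae_tendsto_indicator (μ := volume) (L := (atTop : Filter ℝ))
    (A := Ioc (-Real.pi) Real.pi \ recAngles K)
    (As := fun R : ℝ => Ioc (-Real.pi) Real.pi ∩
        ((fun θ : ℝ => (R : ℂ) * exp (θ * I)) ⁻¹' Kᶜ))
    (measurableSet_Ioc.diff hmE)
    (fun R => measurableSet_Ioc.inter (hc.isOpen_compl.preimage (by fun_prop)).measurableSet)
    (B := Ioc (-Real.pi) Real.pi) measurableSet_Ioc hfin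
    (Eventually.of_forall fun R => inter_subset_left) (by
      filter_upwards [ae_notMem_frontier_recAngles K] with θ hθ
      by_cases hmem : θ ∈ recAngles K
      · have hint : θ ∈ interior (recAngles K) := by
          by_contra hni
          exact hθ ⟨subset_closure hmem, hni⟩
        filter_upwards [eventually_mem_of_mem_interior hne hint] with R hR
        simp [hmem, hR]
      · filter_upwards [eventually_notMem_of_notMem_recAngles hc hK hmem] with R hR
        simp [hmem, hR])
  have hval : (volume (Ioc (-Real.pi) Real.pi \ recAngles K)).toReal =
      2 * Real.pi - (volume (recAngles K ∩ Ioc (-Real.pi) Real.pi)).toReal := by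
    have h1 := measure_sdiff_add_inter (μ := volume) (Ioc (-Real.pi) Real.pi) hmE
    have hf1 : volume (Ioc (-Real.pi) Real.pi \ recAngles K) ≠ ⊤ :=
      measure_ne_top_of_subset sdiff_subset hfin
    have hf2 : volume (Ioc (-Real.pi) Real.pi ∩ recAngles K) ≠ ⊤ :=
      measure_ne_top_of_subset inter_subset_left hfin
    have h2 := congrArg ENNReal.toReal h1
    rw [ENNReal.toReal_add hf1 hf2, Real.volume_Ioc,
      ENNReal.toReal_ofReal (by linarith [Real.pi_pos])] at h2
    rw [inter_comm (recAngles K)]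
    linarith
  rw [← hval]
  refine ((ENNReal.tendsto_toReal (measure_ne_top_of_subset sdiff_subset hfin)).comp hlim).congr
    fun R => ?_
  simp only [Function.comp, angularMeasure, hA]

lemma volume_recAngles_inter_Ioc {K : Set ℂ} (hc : IsClosed K) (c : ℝ) :
    volume (recAngles K ∩ Ioc (-Real.pi) Real.pi) =
      volume (recAngles K ∩ Ioc c (c + 2 * Real.pi)) := by
  have hT := Real.two_pi_pos
  have h1 := isAddFundamentalDomain_Ioc hT (-Real.pi) volume
  have h2 := isAddFundamentalDomain_Ioc hT c volume
  have h3 : -Real.pi + 2 * Real.pi = Real.pi := by ring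
  rw [h3] at h1
  refine h1.measure_set_eq h2 (isClosed_recAngles hc).measurableSet fun g => ?_
  obtain ⟨g, n, hn⟩ := g
  ext θ
  simp only at hn
  subst hn
  simp only [recAngles, mem_preimage, mem_ofPred_eq, AddSubgroup.vadd_def, vadd_eq_add, zsmul_eq_mul]
  have : ((((n : ℝ) * (2 * Real.pi) + θ : ℝ)) : ℂ) * I = θ * I + n * (2 * Real.pi * I) := by
    push_cast; ring
  rw [this, exp_periodic.int_mul]

/-! ### Inverses of injective holomorphic functions. -/

section Inverse

variable {U : Set ℂ} {F : ℂ → ℂ}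

lemma not_eventually_const_of_injOn (hU : IsOpen U) (hinj : InjOn F U) {z : ℂ} (hz : z ∈ U) :
    ¬ ∀ᶠ w in 𝓝 z, F w = F z := by
  intro h
  have h1 : ∀ᶠ w in 𝓝[≠] z, F w = F z ∧ w ∈ U :=
    (h.and (hU.mem_nhds hz)).filter_mono nhdsWithin_le_nhds
  obtain ⟨w, ⟨hw, hwU⟩, hne⟩ := (h1.and self_mem_nhdsWithin).exists
  exact hne (hinj hwU hz hw)

lemma map_nhds_of_injOn (hU : IsOpen U) (hF : DifferentiableOn ℂ F U) (hinj : InjOn F U) {z : ℂ}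
    (hz : z ∈ U) : 𝓝 (F z) ≤ map F (𝓝 z) :=
  (hF.analyticAt (hU.mem_nhds hz)).eventually_constant_or_nhds_le_map_nhds.resolve_left
    (not_eventually_const_of_injOn hU hinj hz)

lemma isOpen_image_of_injOn (hU : IsOpen U) (hF : DifferentiableOn ℂ F U) (hinj : InjOn F U) :
    IsOpen (F '' U) := by
  rw [isOpen_iff_mem_nhds]
  rintro _ ⟨z, hz, rfl⟩
  exact map_nhds_of_injOn hU hF hinj hz (image_mem_map (hU.mem_nhds hz))

lemma continuousAt_invFunOn (hU : IsOpen U) (hF : DifferentiableOn ℂ F U) (hinj : InjOn F U)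
    {z : ℂ} (hz : z ∈ U) : ContinuousAt (Function.invFunOn F U) (F z) := by
  have hl : Function.invFunOn F U (F z) = z := hinj.leftInvOn_invFunOn hz
  rw [ContinuousAt, hl]
  intro V hV
  refine mem_map.2 (map_nhds_of_injOn hU hF hinj hz (mem_map.2 ?_))
  filter_upwards [hV, hU.mem_nhds hz] with w hw hwU
  simp only [mem_preimage]
  rwa [hinj.leftInvOn_invFunOn hwU]

lemma hasDerivAt_invFunOn_of_ne (hU : IsOpen U) (hF : DifferentiableOn ℂ F U) (hinj : InjOn F U)
    {z : ℂ} (hz : z ∈ U) (h : deriv F z ≠ 0) :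
    HasDerivAt (Function.invFunOn F U) (deriv F z)⁻¹ (F z) := by
  have hl : Function.invFunOn F U (F z) = z := hinj.leftInvOn_invFunOn hz
  refine HasDerivAt.of_local_left_inverse (continuousAt_invFunOn hU hF hinj hz)
    (by rw [hl]; exact (hF.differentiableAt (hU.mem_nhds hz)).hasDerivAt) h ?_
  filter_upwards [(isOpen_image_of_injOn hU hF hinj).mem_nhds (mem_image_of_mem F hz)] with w hw
  exact Function.invFunOn_eq hw

/-- The derivative of an injective holomorphic function has no zero. -/
lemma deriv_ne_zero_of_injOn (hU : IsOpen U) (hF : DifferentiableOn ℂ F U) (hinj : InjOn F U)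
    {z : ℂ} (hz : z ∈ U) : deriv F z ≠ 0 := by
  have han : AnalyticAt ℂ (deriv F) z := (hF.analyticAt (hU.mem_nhds hz)).deriv
  rcases han.eventually_eq_zero_or_eventually_ne_zero with h0 | h0
  · exfalso
    obtain ⟨r, hr, hball⟩ := Metric.mem_nhds_iff.1 (h0.and (hU.mem_nhds hz))
    refine not_eventually_const_of_injOn hU hinj hz ?_
    filter_upwards [Metric.ball_mem_nhds z hr] with w hw
    refine (convex_ball z r).is_const_of_fderivWithin_eq_zero (𝕜 := ℂ)
      (fun v hv => (hF.differentiableAt (hU.mem_nhds (hball hv).2)).differentiableWithinAt)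
      (fun v hv => ?_) hw (Metric.mem_ball_self hr)
    have hd : HasDerivAt F 0 v := by
      have := (hF.differentiableAt (hU.mem_nhds (hball hv).2)).hasDerivAt
      rwa [(hball hv).1] at this
    rw [fderivWithin_of_isOpen Metric.isOpen_ball hv, hd.hasFDerivAt.fderiv]
    ext
    simp
  -- If zeros of `F'` are isolated, the inverse `g` is holomorphic near `F z` off that point and
  -- continuous there, so the singularity is removable; the chain rule for `g ∘ F = id` then
  -- excludes `F' z = 0`.
  · set g := Function.invFunOn F U with hg
    have h1 : ∀ᶠ w in 𝓝 z, (w ≠ z → deriv F w ≠ 0) ∧ w ∈ U :=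
      (eventually_nhdsWithin_iff.1 h0).and (hU.mem_nhds hz)
    have h2 : ∀ᶠ v in 𝓝[≠] F z, DifferentiableAt ℂ g v := by
      rw [eventually_nhdsWithin_iff]
      have h3 := map_nhds_of_injOn hU hF hinj hz (image_mem_map h1)
      filter_upwards [h3] with v hv hne
      obtain ⟨w, ⟨hw, hwU⟩, rfl⟩ := hv
      exact (hasDerivAt_invFunOn_of_ne hU hF hinj hwU
        (hw fun h => hne (by rw [h]; rfl))).differentiableAt
    have h4 : AnalyticAt ℂ g (F z) :=
      analyticAt_of_differentiable_on_punctured_nhds_of_continuousAt h2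
        (continuousAt_invFunOn hU hF hinj hz)
    have h5 : HasDerivAt (g ∘ F) (deriv g (F z) * deriv F z) z :=
      h4.differentiableAt.hasDerivAt.comp z (hF.differentiableAt (hU.mem_nhds hz)).hasDerivAt
    have h6 : HasDerivAt (g ∘ F) 1 z := by
      refine (hasDerivAt_id z).congr_of_eventuallyEq ?_
      filter_upwards [hU.mem_nhds hz] with w hw
      exact hinj.leftInvOn_invFunOn hw
    intro h7
    have := h5.unique h6
    rw [h7, mul_zero] at this
    exact zero_ne_one this

lemma hasDerivAt_invFunOn (hU : IsOpen U) (hF : DifferentiableOn ℂ F U) (hinj : InjOn F U)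
    {z : ℂ} (hz : z ∈ U) : HasDerivAt (Function.invFunOn F U) (deriv F z)⁻¹ (F z) :=
  hasDerivAt_invFunOn_of_ne hU hF hinj hz (deriv_ne_zero_of_injOn hU hF hinj hz)

end Inverse

/-! ### Concave maps of the half-plane have unbounded complement. -/

/-- A univalent function of the right half-plane with convex complement of the image that tends
to `∞` at `∞`. -/
structure IsConcaveMap (F : ℂ → ℂ) : Prop where
  diff : DifferentiableOn ℂ F rightHalf
  inj : InjOn F rightHalf
  convex_compl : Convex ℝ (F '' rightHalf)ᶜ
  tendsto : ∀ M : ℝ, ∃ R : ℝ, ∀ z ∈ rightHalf, R ≤ ‖z‖ → M ≤ ‖F z‖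

/-- The inverse of a univalent function on the right half-plane. -/
def invMap (F : ℂ → ℂ) : ℂ → ℂ := Function.invFunOn F rightHalf

/-- The complement of the image of the right half-plane. -/
def complImage (F : ℂ → ℂ) : Set ℂ := (F '' rightHalf)ᶜ

namespace IsConcaveMap

variable {F : ℂ → ℂ} (hF : IsConcaveMap F)

include hF

lemma deriv_ne_zero {z : ℂ} (hz : z ∈ rightHalf) : deriv F z ≠ 0 :=
  deriv_ne_zero_of_injOn isOpen_rightHalf hF.diff hF.inj hz

lemma hasDerivAt {z : ℂ} (hz : z ∈ rightHalf) : HasDerivAt F (deriv F z) z :=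
  (hF.diff.differentiableAt (rightHalf_mem_nhds hz)).hasDerivAt

lemma isClosed_complImage : IsClosed (complImage F) :=
  (isOpen_image_of_injOn isOpen_rightHalf hF.diff hF.inj).isClosed_compl

omit hF in
lemma invMap_mem {w : ℂ} (hw : w ∉ complImage F) : invMap F w ∈ rightHalf :=
  Function.invFunOn_mem (not_not.1 hw)

omit hF in
lemma apply_invMap {w : ℂ} (hw : w ∉ complImage F) : F (invMap F w) = w :=
  Function.invFunOn_eq (not_not.1 hw)

lemma invMap_apply {z : ℂ} (hz : z ∈ rightHalf) : invMap F (F z) = z :=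
  hF.inj.leftInvOn_invFunOn hz

omit hF in
lemma apply_notMem {z : ℂ} (hz : z ∈ rightHalf) : F z ∉ complImage F :=
  not_not.2 (mem_image_of_mem F hz)

lemma hasDerivAt_invMap {z : ℂ} (hz : z ∈ rightHalf) :
    HasDerivAt (invMap F) (deriv F z)⁻¹ (F z) :=
  hasDerivAt_invFunOn isOpen_rightHalf hF.diff hF.inj hz

lemma differentiableAt_invMap {w : ℂ} (hw : w ∉ complImage F) : DifferentiableAt ℂ (invMap F) w := by
  have := hF.hasDerivAt_invMap (invMap_mem hw)
  rw [apply_invMap hw] at this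
  exact this.differentiableAt

lemma differentiableOn_comp_invMap {A : ℂ → ℂ} (hA : DifferentiableOn ℂ A rightHalf)
    (hm : ∀ z ∈ rightHalf, A z ∉ complImage F) :
    DifferentiableOn ℂ (fun z => invMap F (A z)) rightHalf := fun z hz =>
  (DifferentiableAt.comp (g := invMap F) z (hF.differentiableAt_invMap (hm z hz))
    (hA.differentiableAt (rightHalf_mem_nhds hz))).differentiableWithinAt

/-- If `K` were bounded, `invMap F v⁻¹` would be defined for all small `v ≠ 0`, and its Cayley
transform `B` would be bounded by `1`, hence extend over `0`. Since `F` tends to `∞` at `∞`, the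
extended value is `1`. The maximum principle then makes `‖B‖` constantly `1`, whereas `‖B‖ < 1` off
`0`. -/
lemma not_isBounded_complImage : ¬ Bornology.IsBounded (complImage F) := by
  intro hb
  obtain ⟨r, hr0, hr⟩ := hb.subset_closedBall_lt 0 0
  have hout : ∀ w : ℂ, r < ‖w‖ → w ∉ complImage F := fun w hw hmem => by
    have := hr hmem
    rw [mem_closedBall_zero_iff] at this
    linarith
  have hinv : ∀ v ∈ Metric.ball (0 : ℂ) r⁻¹, v ≠ 0 → v⁻¹ ∉ complImage F := fun v hv hv0 => by
    refine hout _ ?_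
    rw [mem_ball_zero_iff] at hv
    rw [norm_inv]
    exact (lt_inv_comm₀ (norm_pos_iff.2 hv0) hr0).1 hv
  set B : ℂ → ℂ := fun v => (invMap F v⁻¹ - 1) / (invMap F v⁻¹ + 1) with hB
  have hden : ∀ a ∈ rightHalf, a + 1 ≠ 0 := fun a ha h => by
    have h1 := congrArg re h
    have h2 : 0 < a.re := ha
    simp at h1
    linarith
  have hBlt : ∀ v ∈ Metric.ball (0 : ℂ) r⁻¹, v ≠ 0 → ‖B v‖ < 1 := by
    intro v hv hv0
    have ha := invMap_mem (hinv v hv hv0)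
    have h4 : 0 < ‖invMap F v⁻¹ + 1‖ := norm_pos_iff.2 (hden _ ha)
    rw [hB]
    simp only
    rw [norm_div, div_lt_one h4]
    have h3 := norm_add_conj_sq (invMap F v⁻¹) 1
    simp only [map_one, one_re, mul_one] at h3
    have h5 : 0 < (invMap F v⁻¹).re := ha
    nlinarith [norm_nonneg (invMap F v⁻¹ - 1)]
  have hball : Metric.ball (0 : ℂ) r⁻¹ ∈ 𝓝 (0 : ℂ) := Metric.ball_mem_nhds _ (by positivity)
  have hBd : DifferentiableOn ℂ B (Metric.ball 0 r⁻¹ \ {0}) := by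
    intro v hv
    have hv0 : v ≠ 0 := hv.2
    have h1 : DifferentiableAt ℂ (fun v : ℂ => invMap F v⁻¹) v :=
      DifferentiableAt.comp (g := invMap F) v (hF.differentiableAt_invMap (hinv v hv.1 hv0))
        (differentiableAt_inv hv0)
    exact ((h1.sub_const 1).div (h1.add_const 1)
      (hden _ (invMap_mem (hinv v hv.1 hv0)))).differentiableWithinAt
  have hbd : BddAbove (norm ∘ B '' (Metric.ball 0 r⁻¹ \ {0})) := by
    refine ⟨1, ?_⟩
    rintro _ ⟨v, hv, rfl⟩
    exact (hBlt v hv.1 hv.2).le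
  have hrem := differentiableOn_update_limUnder_of_bddAbove hball hBd hbd
  set L := limUnder (𝓝[≠] (0 : ℂ)) B with hL
  set B' := Function.update B 0 L with hB'
  have hB'eq : ∀ v, v ≠ 0 → B' v = B v := fun v hv => Function.update_of_ne hv _ _
  have hB'0 : B' 0 = L := Function.update_self _ _ _
  -- the sequence `1 / F n` tends to `0` and `B` tends to `1` along it
  have hnF : Tendsto (fun n : ℕ => ‖F ((n : ℂ) + 1)‖) atTop atTop := by
    rw [tendsto_atTop]
    intro M
    obtain ⟨R, hR⟩ := hF.tendsto M
    filter_upwards [tendsto_natCast_atTop_atTop.eventually_ge_atTop R] with n hn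
    refine hR _ (by simp only [mem_rightHalf, add_re, natCast_re, one_re]; positivity) ?_
    have : ((n : ℂ) + 1) = ((n + 1 : ℝ) : ℂ) := by push_cast; rfl
    rw [this, norm_real, Real.norm_eq_abs, abs_of_pos (by positivity)]
    linarith
  have hseq : Tendsto (fun n : ℕ => (F ((n : ℂ) + 1))⁻¹) atTop (𝓝 0) := by
    rw [tendsto_zero_iff_norm_tendsto_zero]
    simp only [norm_inv]
    exact tendsto_inv_atTop_zero.comp hnF
  have hcont : ContinuousAt B' 0 := (hrem.differentiableAt hball).continuousAt
  have hlim1 : Tendsto (fun n : ℕ => B' (F ((n : ℂ) + 1))⁻¹) atTop (𝓝 L) := by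
    have := hcont.tendsto.comp hseq
    rwa [hB'0] at this
  have hlim2 : Tendsto (fun n : ℕ => B' (F ((n : ℂ) + 1))⁻¹) atTop (𝓝 1) := by
    have h1 : Tendsto (fun n : ℕ => 1 - 2 / ((n : ℂ) + 2)) atTop (𝓝 (1 - 0)) := by
      refine Tendsto.const_sub 1 ?_
      rw [tendsto_zero_iff_norm_tendsto_zero]
      have h2 : Tendsto (fun n : ℕ => 2 / ((n : ℝ) + 2)) atTop (𝓝 0) :=
        (tendsto_atTop_add_const_right _ _ tendsto_natCast_atTop_atTop).const_div_atTop _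
      refine h2.congr fun n => ?_
      have : ((n : ℂ) + 2) = ((n + 2 : ℝ) : ℂ) := by push_cast; rfl
      rw [norm_div, this, norm_real, Real.norm_eq_abs, abs_of_pos (by positivity), norm_ofNat]
    rw [sub_zero] at h1
    refine h1.congr' ?_
    filter_upwards [hnF.eventually_gt_atTop 0] with n hn
    have hne : (F ((n : ℂ) + 1))⁻¹ ≠ 0 := inv_ne_zero (norm_pos_iff.1 hn)
    rw [hB'eq _ hne, hB]
    simp only [inv_inv]
    rw [hF.invMap_apply (by simp only [mem_rightHalf, add_re, natCast_re, one_re]; positivity)]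
    have h2 : ((n : ℂ) + 2) ≠ 0 := by exact_mod_cast (Nat.succ_ne_zero (n + 1))
    have h3 : (n : ℂ) + 1 + 1 = n + 2 := by ring
    rw [h3]
    field_simp
    ring
  have hL1 : L = 1 := tendsto_nhds_unique hlim1 hlim2
  have hmax : IsMaxOn (norm ∘ B') (Metric.ball 0 r⁻¹) 0 := by
    intro v hv
    simp only [mem_ofPred_eq, Function.comp, hB'0, hL1, norm_one]
    rcases eq_or_ne v 0 with rfl | hv0
    · rw [hB'0, hL1, norm_one]
    · rw [hB'eq v hv0]
      exact (hBlt v hv hv0).le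
  have hEq := norm_eqOn_of_isPreconnected_of_isMaxOn (convex_ball (0 : ℂ) r⁻¹).isPreconnected
    Metric.isOpen_ball hrem (Metric.mem_ball_self (by positivity)) hmax
  have hr' : 0 < r⁻¹ := by positivity
  have hv : ((r⁻¹ / 2 : ℝ) : ℂ) ∈ Metric.ball (0 : ℂ) r⁻¹ := by
    rw [mem_ball_zero_iff, norm_real, Real.norm_eq_abs, abs_of_pos (by positivity)]
    linarith
  have hv0 : ((r⁻¹ / 2 : ℝ) : ℂ) ≠ 0 := by
    rw [Ne, ofReal_eq_zero]
    positivity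
  have h1 := hEq hv
  simp only [Function.comp, Function.const_apply, hB'0, hL1, norm_one] at h1
  rw [hB'eq _ hv0] at h1
  exact absurd (hBlt _ hv hv0) (by rw [h1]; exact lt_irrefl 1)

lemma complImage_nonempty : (complImage F).Nonempty := by
  by_contra h
  rw [not_nonempty_iff_eq_empty] at h
  exact hF.not_isBounded_complImage (by rw [h]; exact Bornology.isBounded_empty)

lemma exists_direction : ∃ e ∈ recCone (complImage F), ‖e‖ = 1 :=
  exists_unit_mem_recCone hF.isClosed_complImage hF.convex_compl hF.not_isBounded_complImage

end IsConcaveMap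

/-! ### Translations and dilations of the image of a concave map. -/

/-- Converts hyperbolic closeness of a point and its image into the hypothesis of Julia's
inequality, with constant `8`. -/
lemma comparison_of_close {a b : ℂ} (ha : a ∈ rightHalf) (hb : b ∈ rightHalf)
    (h : 4 * ‖b - a‖ ^ 2 ≤ a.re * b.re) :
    b.re * ‖a‖ ^ 2 ≤ 8 * a.re * ‖b‖ ^ 2 ∧ ‖a‖ ≤ 2 * ‖b‖ := by
  have ha' : 0 < a.re := ha
  have hb' : 0 < b.re := hb
  have h1 : (b.re - a.re) ^ 2 ≤ ‖b - a‖ ^ 2 := by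
    have := abs_re_le_norm (b - a)
    rw [sub_re] at this
    rw [← sq_abs]
    exact pow_le_pow_left₀ (abs_nonneg _) this 2
  have h2 : b.re ≤ 2 * a.re := by
    by_contra hcon
    push Not at hcon
    nlinarith
  have hna := re_le_norm a
  have hnb := re_le_norm b
  have h3 : ‖a‖ ≤ 2 * ‖b‖ := by
    by_contra hcon
    push Not at hcon
    have h4 : ‖a‖ - ‖b‖ ≤ ‖b - a‖ := by
      rw [norm_sub_rev]; exact norm_sub_norm_le a b
    have h5 : a.re * b.re ≤ ‖a‖ * ‖b‖ := by
      apply mul_le_mul hna hnb hb'.le (norm_nonneg _)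
    have h6 : (‖a‖ - ‖b‖) ^ 2 ≤ ‖b - a‖ ^ 2 :=
      pow_le_pow_left₀ (by linarith [norm_nonneg b]) h4 2
    nlinarith [norm_nonneg b]
  refine ⟨?_, h3⟩
  have h7 : ‖a‖ ^ 2 ≤ (2 * ‖b‖) ^ 2 := pow_le_pow_left₀ (norm_nonneg _) h3 2
  calc b.re * ‖a‖ ^ 2 ≤ (2 * a.re) * (2 * ‖b‖) ^ 2 :=
        mul_le_mul h2 h7 (by positivity) (by positivity)
    _ = _ := by ring

namespace IsConcaveMap

variable {F : ℂ → ℂ} (hF : IsConcaveMap F)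

include hF

/-- A distortion estimate of Koebe type for maps omitting a ray. -/
lemma norm_deriv_mul_re_le_two_mul {e k : ℂ} (he : e ∈ recCone (complImage F)) (he1 : ‖e‖ = 1)
    (hk : k ∈ complImage F) {z : ℂ} (hz : z ∈ rightHalf) :
    ‖deriv F z‖ * z.re ≤ 2 * ‖F z - k‖ := by
  have he0 : e ≠ 0 := norm_ne_zero_iff.1 (by rw [he1]; exact one_ne_zero)
  -- `F` omits the ray `k + t e`, so `v` omits the nonpositive reals and its square root `T` maps
  -- into the right half-plane. The derivative bound for `T` is one for `T'/T = F' / (2 (F - k))`.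
  set v : ℂ → ℂ := fun z => (F z - k) / (-e) with hv
  have hslit : ∀ z ∈ rightHalf, v z ∈ slitPlane := by
    intro z hz
    by_contra hcon
    rw [mem_slitPlane_iff, not_or, not_lt, not_not] at hcon
    obtain ⟨h1, h2⟩ := hcon
    have h3 : v z = ((v z).re : ℂ) := Complex.ext (by simp) (by simp [h2])
    have h4 : F z = k + ((-(v z).re : ℝ) : ℂ) * e := by
      have : F z - k = v z * (-e) := by rw [hv]; field_simp
      rw [ofReal_neg, ← h3]
      linear_combination this
    exact apply_notMem hz (h4 ▸ he k hk _ (by linarith))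
  have hvd : ∀ z ∈ rightHalf, HasDerivAt v (deriv F z / (-e)) z := fun z hz =>
    ((hF.hasDerivAt hz).sub_const k).div_const (-e)
  set T : ℂ → ℂ := fun z => exp (log (v z) / 2) with hT
  have hTd : ∀ z ∈ rightHalf, HasDerivAt T (T z * ((deriv F z / (-e)) / v z / 2)) z := fun z hz =>
    (((hvd z hz).clog (hslit z hz)).div_const 2).cexp
  have hTre : ∀ z ∈ rightHalf, 0 ≤ (T z).re := by
    intro z hz
    rw [hT]
    simp only [exp_re]
    refine mul_nonneg (Real.exp_pos _).le (Real.cos_nonneg_of_mem_Icc ?_)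
    have : (log (v z) / 2).im = arg (v z) / 2 := by
      rw [← log_im, ← Nat.cast_ofNat, div_natCast_im, Nat.cast_ofNat]
    rw [this]
    have h1 := neg_pi_lt_arg (v z)
    have h2 := arg_le_pi (v z)
    constructor <;> linarith
  have key := norm_deriv_mul_re_le (P := T)
    (fun z hz => (hTd z hz).differentiableAt.differentiableWithinAt) hTre hz
  rw [(hTd z hz).deriv] at key
  have hTpos : 0 < ‖T z‖ := norm_pos_iff.2 (exp_ne_zero _)
  have h1 : ‖(deriv F z / (-e)) / v z / 2‖ * z.re ≤ 1 := by
    have := key.trans (re_le_norm _)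
    rw [norm_mul, mul_assoc] at this
    exact le_of_mul_le_mul_left (by linarith) hTpos
  have hFk : F z - k ≠ 0 := sub_ne_zero.2 fun h => apply_notMem hz (h ▸ hk)
  have hFk' : 0 < ‖F z - k‖ := norm_pos_iff.2 hFk
  have h2 : (deriv F z / (-e)) / v z / 2 = deriv F z / (F z - k) / 2 := by
    rw [hv]; field_simp
  rw [h2, norm_div, norm_div, norm_ofNat] at h1
  have h3 : ‖deriv F z‖ * z.re = (‖deriv F z‖ / ‖F z - k‖ / 2 * z.re) * (2 * ‖F z - k‖) := by
    field_simp
  rw [h3]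
  exact mul_le_of_le_one_left (by positivity) h1

lemma exists_support_apply {w : ℂ} (hw : w ∉ complImage F) : ∃ k ∈ complImage F,
    ∃ ν : ℂ, ∃ δ : ℝ, ‖ν‖ = 1 ∧ 0 < δ ∧ w = k + δ * ν ∧ δ = Metric.infDist w (complImage F) ∧
      (∀ v ∈ complImage F, ((v - k) * conj ν).re ≤ 0) ∧
      ∀ p ∈ rightHalf, k + p * ν ∉ complImage F :=
  exists_support hF.isClosed_complImage hF.convex_compl hF.complImage_nonempty hw

lemma norm_deriv_mul_re_le_infDist {z : ℂ} (hz : z ∈ rightHalf) :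
    ‖deriv F z‖ * z.re ≤ 2 * Metric.infDist (F z) (complImage F) := by
  obtain ⟨e, he, he1⟩ := hF.exists_direction
  obtain ⟨k, hk, ν, δ, hν, hδ, hw, hδ', -, -⟩ := hF.exists_support_apply (apply_notMem hz)
  have := hF.norm_deriv_mul_re_le_two_mul he he1 hk hz
  have h1 : ‖F z - k‖ = δ := by
    rw [hw, add_sub_cancel_left, norm_mul, hν, norm_real, Real.norm_eq_abs, abs_of_pos hδ, mul_one]
  rwa [h1, hδ'] at this

/-- Otherwise the distance from `F (s²)` to `K` is below `t / s` for all large `s`. The distortion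
estimate then bounds the `s`-derivative of `F (s²)` by `4 t / s²`, which is integrable, so `F` would
be bounded on the positive axis. -/
lemma exists_far (S : ℝ) {t : ℝ} (ht : 0 < t) :
    ∃ s, S ≤ s ∧ t ≤ s * Metric.infDist (F ((s ^ 2 : ℝ) : ℂ)) (complImage F) := by
  by_contra hcon
  push Not at hcon
  set S' := max S 1 with hS'
  have hS1 : 1 ≤ S' := le_max_right _ _
  have hb : ∀ s, S' ≤ s → ‖F ((s ^ 2 : ℝ) : ℂ) - F ((S' ^ 2 : ℝ) : ℂ)‖ ≤ 4 * t := by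
    intro s hs
    have hd : ∀ x, S' ≤ x → HasDerivAt (fun s : ℝ => F ((s ^ 2 : ℝ) : ℂ) - F ((S' ^ 2 : ℝ) : ℂ))
        (deriv F ((x ^ 2 : ℝ) : ℂ) * ((2 * x : ℝ) : ℂ)) x := by
      intro x hx
      have h1 : HasDerivAt F (deriv F ((x ^ 2 : ℝ) : ℂ)) ((x ^ 2 : ℝ) : ℂ) :=
        hF.hasDerivAt (ofReal_mem_rightHalf.2 (by nlinarith))
      have h2 : HasDerivAt (fun x : ℝ => ((x ^ 2 : ℝ) : ℂ)) ((2 * x : ℝ) : ℂ) x := by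
        have : HasDerivAt (fun x : ℝ => x ^ 2) (2 * x) x := by simpa using hasDerivAt_pow 2 x
        exact this.ofReal_comp
      exact (h1.comp x h2).sub_const _
    have hB : ∀ x, S' ≤ x → HasDerivAt (fun x : ℝ => 4 * t / S' - 4 * t * x⁻¹)
        (4 * t / x ^ 2) x := by
      intro x hx
      have := ((hasDerivAt_inv (show x ≠ 0 by linarith)).const_mul (4 * t)).const_sub (4 * t / S')
      refine this.congr_deriv ?_
      ring
    have := image_norm_le_of_norm_deriv_right_le_deriv_boundary' (a := S') (b := s)
      (f := fun s : ℝ => F ((s ^ 2 : ℝ) : ℂ) - F ((S' ^ 2 : ℝ) : ℂ))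
      (f' := fun x => deriv F ((x ^ 2 : ℝ) : ℂ) * ((2 * x : ℝ) : ℂ))
      (B := fun x => 4 * t / S' - 4 * t * x⁻¹) (B' := fun x => 4 * t / x ^ 2)
      (fun x hx => (hd x hx.1).continuousAt.continuousWithinAt)
      (fun x hx => (hd x hx.1).hasDerivWithinAt) (by simp [div_eq_mul_inv])
      (fun x hx => (hB x hx.1).continuousAt.continuousWithinAt)
      (fun x hx => (hB x hx.1).hasDerivWithinAt) (by
        intro x hx
        have hx0 : 0 < x := by linarith [hx.1]
        have h1 := hF.norm_deriv_mul_re_le_infDist (z := ((x ^ 2 : ℝ) : ℂ))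
          (ofReal_mem_rightHalf.2 (by positivity))
        have h2 := hcon x ((le_max_left _ _).trans hx.1)
        rw [ofReal_re] at h1
        rw [norm_mul, norm_real, Real.norm_eq_abs, abs_of_pos (by positivity),
          le_div_iff₀ (by positivity)]
        nlinarith) (right_mem_Icc.2 hs)
    refine this.trans ?_
    have h3 : 4 * t / S' ≤ 4 * t := div_le_self (by positivity) hS1
    have h4 : 0 ≤ 4 * t * s⁻¹ := mul_nonneg (by positivity) (inv_nonneg.2 (by linarith))
    linarith
  obtain ⟨R, hR⟩ := hF.tendsto (‖F ((S' ^ 2 : ℝ) : ℂ)‖ + 4 * t + 1)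
  set s := max S' R with hs
  have hs1 : S' ≤ s := le_max_left _ _
  have h1 := hb s hs1
  have h2 := hR ((s ^ 2 : ℝ) : ℂ) (ofReal_mem_rightHalf.2 (by nlinarith)) (by
    rw [norm_real, Real.norm_eq_abs, abs_of_pos (by nlinarith)]
    have := le_max_right S' R
    nlinarith)
  have h3 := norm_sub_norm_le (F ((s ^ 2 : ℝ) : ℂ)) (F ((S' ^ 2 : ℝ) : ℂ))
  linarith

omit hF in
lemma sub_notMem {e w : ℂ} (he : e ∈ recCone (complImage F)) (hw : w ∉ complImage F) {t : ℝ}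
    (ht : 0 ≤ t) : w - t * e ∉ complImage F := fun h => hw (by
  have := he _ h t ht
  rwa [sub_add_cancel] at this)

omit hF in
lemma add_smul_sub_notMem (hconv : Convex ℝ (complImage F)) {k w : ℂ} (hk : k ∈ complImage F)
    (hw : w ∉ complImage F) {u : ℝ} (hu : 0 ≤ u) : w + u * (w - k) ∉ complImage F := fun h => hw (by
  have h1 : 0 < 1 + u := by linarith
  have := hconv hk h (a := u / (1 + u)) (b := 1 / (1 + u)) (by positivity) (by positivity)
    (by field_simp; ring)
  convert this using 1
  rw [real_smul, real_smul]
  have h2 : (1 + u : ℂ) ≠ 0 := by exact_mod_cast h1.ne'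
  push_cast
  field_simp
  ring)

/-- A lossy form of `re_le_re_translate`, needed first to show that orbits of the translation tend
to `∞`. Far out, the nearest point `k` of `K` gives a supporting half-plane `k + p ν` avoiding `K`.
At depth `s δ ≥ 2 t` in it a translation of length `t` is a bounded hyperbolic step, and
Schwarz–Pick carries this to the preimages, which therefore satisfy Julia's hypothesis. -/
lemma re_le_eight_mul_re_translate {e : ℂ} (he : e ∈ recCone (complImage F)) (he1 : ‖e‖ = 1) {t : ℝ}
    (ht : 0 < t) {z : ℂ} (hz : z ∈ rightHalf) : z.re ≤ 8 * (invMap F (F z - t * e)).re := by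
  have hψd : DifferentiableOn ℂ (fun z => invMap F (F z - t * e)) rightHalf :=
    hF.differentiableOn_comp_invMap (A := fun z => F z - t * e) (hF.diff.sub_const _)
      fun z hz => sub_notMem he (apply_notMem hz) ht.le
  have hψm : ∀ z ∈ rightHalf, invMap F (F z - t * e) ∈ rightHalf := fun z hz =>
    invMap_mem (sub_notMem he (apply_notMem hz) ht.le)
  have hpt : ∀ n : ℕ, ∃ a ∈ rightHalf, ((n : ℝ) + 1) / 4 ≤ ‖a‖ ∧
      4 * ‖invMap F (F a - t * e) - a‖ ^ 2 ≤ a.re * (invMap F (F a - t * e)).re := by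
    intro n
    obtain ⟨s, hsn, hs⟩ := hF.exists_far (n + 1) (t := 2 * t) (by positivity)
    have hs1 : 1 ≤ s := by
      have : (0 : ℝ) ≤ n := n.cast_nonneg
      linarith
    have hsz : ((s ^ 2 : ℝ) : ℂ) ∈ rightHalf := ofReal_mem_rightHalf.2 (by positivity)
    obtain ⟨k, hk, ν, δ, hν, hδ, hw, hδ', hsup, hA⟩ := hF.exists_support_apply (apply_notMem hsz)
    rw [← hδ'] at hs
    have hνν : ν * conj ν = 1 := by rw [mul_conj, normSq_eq_norm_sq, hν]; simp
    have hPd : DifferentiableOn ℂ (fun p => invMap F (k + p * ν)) rightHalf :=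
      hF.differentiableOn_comp_invMap (A := fun p => k + p * ν) (by fun_prop) hA
    have hPm : ∀ p ∈ rightHalf, 0 ≤ (invMap F (k + p * ν)).re := fun p hp =>
      le_of_lt (invMap_mem (hA p hp))
    -- `F (s²)` has depth `δ`; the test point is moved out to depth `s δ`. Schwarz–Pick between the
    -- two depths shows that the preimage `a` still satisfies `‖a‖ ≥ s / 4`.
    set p₁ : ℂ := ((s * δ : ℝ) : ℂ) with hp₁
    have hp₁m : p₁ ∈ rightHalf := ofReal_mem_rightHalf.2 (by positivity)
    set a := invMap F (k + p₁ * ν) with ha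
    have haH : a ∈ rightHalf := invMap_mem (hA _ hp₁m)
    have hFa : F a = k + p₁ * ν := apply_invMap (hA _ hp₁m)
    have h1 := schwarz_pick hPd hPm (z := (δ : ℂ)) (w := p₁) (ofReal_mem_rightHalf.2 hδ) hp₁m
    rw [← hw, hF.invMap_apply hsz, ← ha, hp₁, ofReal_re, ofReal_re, ofReal_re, ← ofReal_sub,
      norm_real, Real.norm_eq_abs, sq_abs] at h1
    have hare : 0 < a.re := haH
    have h2 : ‖((s ^ 2 : ℝ) : ℂ) - a‖ ^ 2 ≤ s * a.re * (s - 1) ^ 2 := by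
      have h3 : ‖((s ^ 2 : ℝ) : ℂ) - a‖ ^ 2 * (s * δ ^ 2) ≤ s * a.re * (s - 1) ^ 2 * (s * δ ^ 2) := by
        linarith
      exact le_of_mul_le_mul_right h3 (by positivity)
    have h4 : s / 4 ≤ ‖a‖ := by
      by_contra hcon
      push Not at hcon
      have h5 := norm_sub_norm_le ((s ^ 2 : ℝ) : ℂ) a
      rw [norm_real, Real.norm_eq_abs, abs_of_pos (by positivity)] at h5
      have h6 : 3 / 4 * s ^ 2 ≤ ‖((s ^ 2 : ℝ) : ℂ) - a‖ := by nlinarith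
      have h7 : (3 / 4 * s ^ 2) ^ 2 ≤ ‖((s ^ 2 : ℝ) : ℂ) - a‖ ^ 2 :=
        pow_le_pow_left₀ (by positivity) h6 2
      have h8 : a.re ≤ s / 4 := (re_le_norm a).trans hcon.le
      have h9 : s * a.re * (s - 1) ^ 2 ≤ s * (s / 4) * s ^ 2 := by
        apply mul_le_mul _ _ (by positivity) (by positivity)
        · exact mul_le_mul_of_nonneg_left h8 (by linarith)
        · exact pow_le_pow_left₀ (by linarith) (by linarith) 2
      have h10 : 0 < s ^ 4 := by positivity
      nlinarith
    set p₂ : ℂ := p₁ - t * (e * conj ν) with hp₂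
    have hν' : (e * conj ν).re ≤ 0 := by
      have := hsup _ (he k hk 1 zero_le_one)
      simpa using this
    have hp₂re : s * δ ≤ p₂.re := by
      rw [hp₂, sub_re, re_ofReal_mul, hp₁, ofReal_re]
      nlinarith
    have hp₂m : p₂ ∈ rightHalf := lt_of_lt_of_le (by positivity) hp₂re
    have hψa : F a - t * e = k + p₂ * ν := by
      rw [hFa, hp₂]
      linear_combination ((t : ℂ) * e) * hνν
    have h5 := schwarz_pick hPd hPm hp₂m hp₁m
    rw [← hψa, ← ha] at h5
    have h6 : ‖p₂ - p₁‖ ^ 2 = t ^ 2 := by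
      rw [hp₂, sub_sub_cancel_left, norm_neg, norm_mul, norm_mul, he1, norm_conj, hν, norm_real,
        Real.norm_eq_abs, mul_one, mul_one, sq_abs]
    have h7 : p₁.re = s * δ := by rw [hp₁, ofReal_re]
    rw [h6, h7] at h5
    refine ⟨a, haH, by linarith, ?_⟩
    have h8 : (2 * t) * (2 * t) ≤ p₂.re * (s * δ) :=
      mul_le_mul (hs.trans hp₂re) hs (by positivity) (by linarith)
    have h9 : ‖invMap F (F a - t * e) - a‖ ^ 2 * (2 * t * (2 * t)) ≤
        (invMap F (F a - t * e)).re * a.re * t ^ 2 :=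
      (mul_le_mul_of_nonneg_left h8 (by positivity)).trans h5
    have h10 : (4 * ‖invMap F (F a - t * e) - a‖ ^ 2) * t ^ 2 ≤
        (a.re * (invMap F (F a - t * e)).re) * t ^ 2 := by linarith
    exact le_of_mul_le_mul_right h10 (by positivity)
  choose a haH han hclose using hpt
  have hcmp := fun n => comparison_of_close (haH n) (hψm _ (haH n)) (hclose n)
  have hat : Tendsto (fun n => ‖a n‖) atTop atTop :=
    tendsto_atTop_mono han ((tendsto_atTop_add_const_right _ _
      tendsto_natCast_atTop_atTop).atTop_div_const (by norm_num))
  refine julia (l := atTop) (w := a) hψd (fun z hz => le_of_lt (hψm z hz))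
    (Eventually.of_forall haH) hat ?_ (Eventually.of_forall fun n => (hcmp n).1) hz
  refine tendsto_atTop_mono (fun n => ?_) (hat.atTop_div_const (r := 2) (by norm_num))
  have := (hcmp n).2
  linarith

/-- The factor `8` bound keeps the real parts of these preimages away from `0`. If they stayed
bounded for arbitrarily large `t`, they would lie in a compact subset of the half-plane, on which
`F` is bounded, while `w - t e` is not. -/
lemma tendsto_norm_invMap {e : ℂ} (he : e ∈ recCone (complImage F)) (he1 : ‖e‖ = 1) {w : ℂ}
    (hw : w ∉ complImage F) : Tendsto (fun t : ℝ => ‖invMap F (w - t * e)‖) atTop atTop := by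
  rw [tendsto_atTop]
  intro M
  by_contra hcon
  rw [not_eventually] at hcon
  have hcpt : IsCompact (Metric.closedBall (0 : ℂ) M ∩ {z | (invMap F w).re / 8 ≤ z.re}) :=
    (isCompact_closedBall 0 M).inter_right (isClosed_le continuous_const continuous_re)
  have hpos : 0 < (invMap F w).re := invMap_mem hw
  have hsub : Metric.closedBall (0 : ℂ) M ∩ {z | (invMap F w).re / 8 ≤ z.re} ⊆ rightHalf :=
    fun z hz => lt_of_lt_of_le (by positivity : 0 < (invMap F w).re / 8) hz.2
  obtain ⟨B, hB⟩ := (hcpt.image_of_continuousOn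
    (hF.diff.continuousOn.mono hsub)).isBounded.exists_norm_le
  obtain ⟨t, ht1, ht2⟩ := (hcon.and_eventually (eventually_gt_atTop (max 0 (B + ‖w‖)))).exists
  have ht0 : 0 < t := (le_max_left _ _).trans_lt ht2
  have h1 := hF.re_le_eight_mul_re_translate he he1 ht0 (invMap_mem hw)
  rw [apply_invMap hw] at h1
  have h2 := hB _ ⟨invMap F (w - t * e), ⟨by
    rw [mem_closedBall_zero_iff]; exact (not_le.1 ht1).le, by
    simp only [mem_ofPred_eq]; linarith⟩, rfl⟩
  rw [apply_invMap (sub_notMem he hw ht0.le)] at h2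
  have h3 := norm_sub_norm_le ((t : ℂ) * e) w
  rw [norm_sub_rev, norm_mul, he1, mul_one, norm_real, Real.norm_eq_abs, abs_of_pos ht0] at h3
  have := le_max_right 0 (B + ‖w‖)
  linarith

/-- The iterates of translation by `t` are the translations by `n t`, so the orbit tends to `∞` and
the constant `8` improves to `1`. -/
lemma re_le_re_translate {e : ℂ} (he : e ∈ recCone (complImage F)) (he1 : ‖e‖ = 1) {t : ℝ}
    (ht : 0 < t) {z : ℂ} (hz : z ∈ rightHalf) : z.re ≤ (invMap F (F z - t * e)).re := by
  refine re_le_re_of_orbit (ψ := fun z => invMap F (F z - t * e))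
    (w := fun n : ℕ => invMap F (F z - (n * t : ℝ) * e))
    (hF.differentiableOn_comp_invMap (A := fun z => F z - t * e) (hF.diff.sub_const _)
      fun z hz => sub_notMem he (apply_notMem hz) ht.le)
    (fun z hz => invMap_mem (sub_notMem he (apply_notMem hz) ht.le))
    (fun n => invMap_mem (sub_notMem he (apply_notMem hz) (by positivity))) (fun n => ?_) ?_ hz
  · rw [apply_invMap (sub_notMem he (apply_notMem hz) (by positivity))]
    congr 1
    push_cast
    ring
  · exact (hF.tendsto_norm_invMap he he1 (apply_notMem hz)).comp
      (tendsto_natCast_atTop_atTop.atTop_mul_const ht)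

/-- The quantity `Re (v / F' z)` is the derivative at `u = 0` of the real part of `invMap F (F z + u
v)`. -/
lemma re_div_deriv_nonneg {z v : ℂ} (hz : z ∈ rightHalf)
    (h : ∀ u : ℝ, 0 < u → z.re ≤ (invMap F (F z + u * v)).re) : 0 ≤ (v / deriv F z).re := by
  have h1 : HasDerivAt (fun u : ℝ => invMap F (F z + u * v)) ((deriv F z)⁻¹ * v) 0 :=
    hasDerivAt_comp_line (by simpa using hF.hasDerivAt_invMap hz)
  have h2 := (hasDerivAt_iff_tendsto_slope.1 (hasDerivAt_re_comp h1)).mono_left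
    (nhdsWithin_mono (0 : ℝ) (s := Ioi 0) fun x hx => ne_of_gt hx)
  have h3 : ((deriv F z)⁻¹ * v) = v / deriv F z := by rw [mul_comm, div_eq_mul_inv]
  rw [h3] at h2
  refine ge_of_tendsto h2 ?_
  filter_upwards [self_mem_nhdsWithin] with u (hu : 0 < u)
  rw [slope_def_field]
  simp only [ofReal_zero, zero_mul, add_zero]
  rw [hF.invMap_apply hz]
  exact div_nonneg (by linarith [h u hu]) (by linarith)

lemma re_neg_direction_div_deriv_nonneg {e : ℂ} (he : e ∈ recCone (complImage F)) (he1 : ‖e‖ = 1)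
    {z : ℂ} (hz : z ∈ rightHalf) : 0 ≤ (-e / deriv F z).re :=
  hF.re_div_deriv_nonneg hz fun u hu => by
    have := hF.re_le_re_translate he he1 hu hz
    rwa [sub_eq_add_neg, ← mul_neg] at this

/-- Dilation about `k` by `1 + u` preserves the image of `F` by convexity of `K`. An orbit started
at `k - τ e` stays on this ray, so the result on translations already sends it to `∞`. The
hypothesis `hline` provides the starting point. -/
lemma re_sub_div_deriv_nonneg {e k : ℂ} (he : e ∈ recCone (complImage F)) (he1 : ‖e‖ = 1)
    (hk : k ∈ complImage F) (hline : ∃ τ : ℝ, 0 < τ ∧ k - τ * e ∉ complImage F) {z : ℂ}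
    (hz : z ∈ rightHalf) : 0 ≤ ((F z - k) / deriv F z).re := by
  refine hF.re_div_deriv_nonneg hz fun u hu => ?_
  obtain ⟨τ, hτ, hτm⟩ := hline
  have hge : ∀ r : ℝ, τ ≤ r → k - r * e ∉ complImage F := fun r hr h => hτm (by
    have := he _ h (r - τ) (by linarith)
    convert this using 1
    push_cast
    ring)
  have hpow : ∀ n : ℕ, τ ≤ (1 + u) ^ n * τ := fun n =>
    le_mul_of_one_le_left hτ.le (one_le_pow₀ (by linarith))
  refine re_le_re_of_orbit (ψ := fun z => invMap F (F z + u * (F z - k)))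
    (w := fun n : ℕ => invMap F (k - ((1 + u) ^ n * τ : ℝ) * e))
    (hF.differentiableOn_comp_invMap (A := fun z => F z + u * (F z - k))
      (hF.diff.add ((hF.diff.sub_const _).const_mul _))
      fun z hz => add_smul_sub_notMem hF.convex_compl hk (apply_notMem hz) hu.le)
    (fun z hz => invMap_mem (add_smul_sub_notMem hF.convex_compl hk (apply_notMem hz) hu.le))
    (fun n => invMap_mem (hge _ (hpow n))) (fun n => ?_) ?_ hz
  · rw [apply_invMap (hge _ (hpow n))]
    congr 1
    push_cast
    ring
  · have h1 := hF.tendsto_norm_invMap he he1 hτm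
    have h2 : Tendsto (fun n : ℕ => (1 + u) ^ n * τ - τ) atTop atTop :=
      tendsto_atTop_add_const_right _ _
        ((tendsto_pow_atTop_atTop_of_one_lt (by linarith)).atTop_mul_const hτ)
    refine (h1.comp h2).congr fun n => ?_
    simp only [Function.comp]
    congr 2
    push_cast
    ring

/-- If the complement of the image contains a line, then the map is affine. -/
lemma deriv_deriv_eq_zero_of_line {e : ℂ} (he : e ∈ recCone (complImage F)) (he1 : ‖e‖ = 1)
    (he' : -e ∈ recCone (complImage F)) {z : ℂ} (hz : z ∈ rightHalf) :
    deriv (deriv F) z = 0 := by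
  have h1 : ∀ w ∈ rightHalf, 0 ≤ (-e / deriv F w).re := fun w hw =>
    hF.re_neg_direction_div_deriv_nonneg he he1 hw
  have hd : DifferentiableOn ℂ (fun w => -e / deriv F w) rightHalf :=
    (differentiableOn_const _).div (hF.diff.deriv isOpen_rightHalf) fun w hw => hF.deriv_ne_zero hw
  have h2 : (-e / deriv F z).re = 0 := by
    refine le_antisymm ?_ (h1 z hz)
    have := hF.re_neg_direction_div_deriv_nonneg he' (by rwa [norm_neg]) hz
    rw [neg_div, neg_re] at this
    linarith
  have hconst : ∀ w ∈ rightHalf, deriv F w = deriv F z := fun w hw => by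
    have h3 := eq_of_re_eq_zero hd h1 hw hz h2
    have he0 : -e ≠ 0 := neg_ne_zero.2 (norm_ne_zero_iff.1 (by rw [he1]; exact one_ne_zero))
    rw [div_eq_div_iff (hF.deriv_ne_zero hw) (hF.deriv_ne_zero hz)] at h3
    exact (mul_left_cancel₀ he0 h3).symm
  have : deriv F =ᶠ[𝓝 z] fun _ => deriv F z := by
    filter_upwards [rightHalf_mem_nhds hz] with w hw using hconst w hw
  rw [this.deriv_eq, deriv_const]

end IsConcaveMap

/-! ### The regularized quotient `F'(z)/(F z - F w) - 1/(z - w)`. -/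

lemma re_div_eq (a b : ℂ) : (a / b).re = (b * conj a).re / normSq b := by
  rw [div_re, ← add_div]
  congr 1
  simp only [mul_re, conj_re, conj_im]
  ring

lemma re_div_nonneg_iff {a b : ℂ} (hb : b ≠ 0) : 0 ≤ (a / b).re ↔ 0 ≤ (b * conj a).re := by
  rw [re_div_eq]
  exact ⟨fun h => by
    have := mul_nonneg h (normSq_nonneg b)
    rwa [div_mul_cancel₀ _ (normSq_pos.2 hb).ne'] at this,
    fun h => div_nonneg h (normSq_nonneg b)⟩

lemma re_div_nonneg_comm {a b : ℂ} (h : 0 ≤ (a / b).re) : 0 ≤ (b / a).re := by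
  rw [← inv_div, inv_re]
  exact div_nonneg h (normSq_nonneg _)

/-- The holomorphic extension of `w ↦ F'(z) / (F z - F w) - 1 / (z - w)` to `w = z`. -/
def logSlope (F : ℂ → ℂ) (z w : ℂ) : ℂ := dslope (dslope F z) z w / dslope F z w

section LogSlope

variable {F : ℂ → ℂ} {U : Set ℂ}

lemma dslope_ne_zero (hU : IsOpen U) (hF : DifferentiableOn ℂ F U) (hinj : InjOn F U) {z w : ℂ}
    (hz : z ∈ U) (hw : w ∈ U) : dslope F z w ≠ 0 := by
  rcases eq_or_ne w z with rfl | hne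
  · rw [dslope_same]
    exact deriv_ne_zero_of_injOn hU hF hinj hw
  · rw [dslope_of_ne _ hne, slope_def_field]
    exact div_ne_zero (sub_ne_zero.2 fun h => hne (hinj hw hz h)) (sub_ne_zero.2 hne)

lemma differentiableOn_dslope' (hU : IsOpen U) (hF : DifferentiableOn ℂ F U) {z : ℂ}
    (hz : z ∈ U) : DifferentiableOn ℂ (dslope F z) U :=
  (Complex.differentiableOn_dslope (hU.mem_nhds hz)).2 hF

lemma differentiableOn_logSlope (hU : IsOpen U) (hF : DifferentiableOn ℂ F U) (hinj : InjOn F U)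
    {z : ℂ} (hz : z ∈ U) : DifferentiableOn ℂ (logSlope F z) U :=
  (differentiableOn_dslope' hU (differentiableOn_dslope' hU hF hz) hz).div
    (differentiableOn_dslope' hU hF hz) fun _ hw => dslope_ne_zero hU hF hinj hz hw

lemma logSlope_of_ne (hinj : InjOn F U) {z w : ℂ} (hz : z ∈ U) (hw : w ∈ U) (hne : w ≠ z) :
    logSlope F z w = deriv F z / (F z - F w) - 1 / (z - w) := by
  have h1 : w - z ≠ 0 := sub_ne_zero.2 hne
  have h2 : F w - F z ≠ 0 := sub_ne_zero.2 fun h => hne (hinj hw hz h)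
  have h3 : z - w ≠ 0 := sub_ne_zero.2 hne.symm
  have h4 : F z - F w ≠ 0 := sub_ne_zero.2 fun h => hne (hinj hw hz h.symm)
  rw [logSlope, dslope_of_ne _ hne, slope_def_field, dslope_same, dslope_of_ne _ hne,
    slope_def_field]
  have e1 : F w - F z = -(F z - F w) := by ring
  have e2 : w - z = -(z - w) := by ring
  rw [e1, e2]
  field_simp
  ring

lemma deriv_dslope_same (hU : IsOpen U) (hF : DifferentiableOn ℂ F U) {z : ℂ} (hz : z ∈ U) :
    deriv (dslope F z) z = deriv (deriv F) z / 2 := by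
  have hE := differentiableOn_dslope' hU hF hz
  have hEz : ∀ w ∈ U, HasDerivAt (dslope F z) (deriv (dslope F z) w) w := fun w hw =>
    (hE.differentiableAt (hU.mem_nhds hw)).hasDerivAt
  have h1 : ∀ w ∈ U, deriv F w = dslope F z w + (w - z) * deriv (dslope F z) w := by
    intro w hw
    have h2 : F = fun w => F z + (w - z) * dslope F z w := by
      funext w
      have := sub_smul_dslope F z w
      rw [smul_eq_mul] at this
      rw [this]; ring
    have h3 : HasDerivAt (fun w => F z + (w - z) * dslope F z w)
        (1 * dslope F z w + (w - z) * deriv (dslope F z) w) w :=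
      (((hasDerivAt_id w).sub_const z).mul (hEz w hw)).const_add (F z)
    rw [← h2] at h3
    rw [h3.deriv, one_mul]
  have h4 : deriv F =ᶠ[𝓝 z] fun w => dslope F z w + (w - z) * deriv (dslope F z) w := by
    filter_upwards [hU.mem_nhds hz] with w hw using h1 w hw
  have hE2 : DifferentiableAt ℂ (deriv (dslope F z)) z :=
    (hE.deriv hU).differentiableAt (hU.mem_nhds hz)
  have h5 := (hEz z hz).add (((hasDerivAt_id z).sub_const z).mul hE2.hasDerivAt)
  rw [h4.deriv_eq]
  have h6 : deriv (fun w => dslope F z w + (w - z) * deriv (dslope F z) w) z =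
      deriv (dslope F z) z + (1 * deriv (dslope F z) z + (z - z) * deriv (deriv (dslope F z)) z) :=
    h5.deriv
  rw [h6]
  ring

lemma logSlope_same (hU : IsOpen U) (hF : DifferentiableOn ℂ F U) {z : ℂ} (hz : z ∈ U) :
    logSlope F z z = deriv (deriv F) z / deriv F z / 2 := by
  rw [logSlope, dslope_same, dslope_same, deriv_dslope_same hU hF hz]
  ring

end LogSlope

/-! ### From the oscillation of `Im log F'` to the second order inequality. -/

lemma exists_center {S : Set ℝ} {d : ℝ} (hS : ∀ x ∈ S, ∀ y ∈ S, |x - y| ≤ d) :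
    ∃ c, ∀ x ∈ S, |x - c| ≤ d / 2 := by
  refine ⟨sSup S - d / 2, fun x hx => ?_⟩
  have hb : BddAbove S := ⟨x + d, fun y hy => by linarith [(abs_le.1 (hS y hy x hx)).2]⟩
  have h1 := le_csSup hb hx
  have h2 : sSup S ≤ x + d :=
    csSup_le ⟨x, hx⟩ fun y hy => by linarith [(abs_le.1 (hS y hy x hx)).2]
  rw [abs_le]
  constructor <;> linarith

/-- If the imaginary part of a holomorphic function on the right half-plane oscillates by at most
`m * π`, then its derivative at `z` is at most `m / Re z`. -/
lemma norm_deriv_mul_re_le_of_im {L : ℂ → ℂ} (hL : DifferentiableOn ℂ L rightHalf) {m : ℝ}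
    (hm : 0 < m) (hosc : ∀ z ∈ rightHalf, ∀ w ∈ rightHalf, |(L z).im - (L w).im| ≤ m * Real.pi)
    {z : ℂ} (hz : z ∈ rightHalf) : ‖deriv L z‖ * z.re ≤ m := by
  obtain ⟨c, hc⟩ := exists_center (S := (fun z => (L z).im) '' rightHalf) (d := m * Real.pi) (by
    rintro _ ⟨z, hz, rfl⟩ _ ⟨w, hw, rfl⟩
    exact hosc z hz w hw)
  set P : ℂ → ℂ := fun z => exp ((L z - c * I) / m) with hP
  have hPd : ∀ z ∈ rightHalf, HasDerivAt P (P z * (deriv L z / m)) z := fun z hz =>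
    (((hL.differentiableAt (rightHalf_mem_nhds hz)).hasDerivAt.sub_const _).div_const _).cexp
  have hPre : ∀ z ∈ rightHalf, 0 ≤ (P z).re := by
    intro z hz
    have h1 := abs_le.1 (hc _ (mem_image_of_mem _ hz))
    simp only [hP, exp_re, div_ofReal_im, sub_im, im_ofReal_mul, I_im, mul_one]
    refine mul_nonneg (Real.exp_pos _).le (Real.cos_nonneg_of_mem_Icc ⟨?_, ?_⟩)
    · rw [le_div_iff₀ hm]; linarith [h1.1]
    · rw [div_le_iff₀ hm]; linarith [h1.2]
  have key := norm_deriv_mul_re_le (P := P)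
    (fun z hz => (hPd z hz).differentiableAt.differentiableWithinAt) hPre hz
  rw [(hPd z hz).deriv, norm_mul, norm_div, norm_real, Real.norm_eq_abs, abs_of_pos hm] at key
  have h1 := key.trans (re_le_norm _)
  have h2 : 0 < ‖P z‖ := norm_pos_iff.2 (exp_ne_zero _)
  have h3 : ‖deriv L z‖ / m * z.re ≤ 1 := le_of_mul_le_mul_left (by linarith) h2
  rwa [div_mul_eq_mul_div, div_le_one hm] at h3

/-- For `q z ≠ 0` the claim is `Re z ≤ m Re (1 / q z)`. The bound `‖1/q‖ ≥ Re z / m` shows that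
`1/q` tends to `∞` along the positive axis and verifies Julia's hypothesis there with constant `m`.
-/
lemma re_mul_normSq_le {q : ℂ → ℂ} (hq : DifferentiableOn ℂ q rightHalf) {m : ℝ} (hm : 0 < m)
    (hre : ∀ z ∈ rightHalf, 0 ≤ (q z).re) (hn : ∀ z ∈ rightHalf, ‖q z‖ * z.re ≤ m) {z : ℂ}
    (hz : z ∈ rightHalf) : z.re * ‖q z‖ ^ 2 ≤ m * (q z).re := by
  by_cases h0 : q z = 0
  · rw [h0]; simp
  have hne : ∀ w ∈ rightHalf, q w ≠ 0 := fun w hw h => h0 (by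
    rw [eq_of_re_eq_zero hq hre hz hw (by rw [h, zero_re]), h])
  have hlow : ∀ n : ℕ, (n + 1 : ℝ) / m ≤ ‖(q ((n + 1 : ℝ) : ℂ))⁻¹‖ := by
    intro n
    have hw : ((n + 1 : ℝ) : ℂ) ∈ rightHalf := ofReal_mem_rightHalf.2 (by positivity)
    have h1 := hn _ hw
    rw [ofReal_re] at h1
    have h2 : 0 < ‖q ((n + 1 : ℝ) : ℂ)‖ := norm_pos_iff.2 (hne _ hw)
    rw [norm_inv, ← one_div, div_le_div_iff₀ hm h2]
    linarith
  have hnn : ∀ n : ℕ, ‖((n + 1 : ℝ) : ℂ)‖ = (n : ℝ) + 1 := fun n => by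
    rw [norm_real, Real.norm_eq_abs, abs_of_pos (by positivity)]
  have hatt : Tendsto (fun n : ℕ => (n : ℝ) + 1) atTop atTop :=
    tendsto_atTop_add_const_right _ _ tendsto_natCast_atTop_atTop
  have := julia (l := atTop) (P := fun z => (q z)⁻¹) (C := m) (w := fun n : ℕ => ((n + 1 : ℝ) : ℂ))
    (hq.inv hne) (fun w hw => by
      rw [inv_re]; exact div_nonneg (hre w hw) (normSq_nonneg _))
    (Eventually.of_forall fun n => ofReal_mem_rightHalf.2 (by positivity))
    (hatt.congr fun n => (hnn n).symm)
    (tendsto_atTop_mono hlow (hatt.atTop_div_const hm)) (Eventually.of_forall fun n => by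
      have h1 := hlow n
      rw [div_le_iff₀ hm] at h1
      have h2 := re_le_norm (q ((n + 1 : ℝ) : ℂ))⁻¹
      rw [hnn, ofReal_re]
      have h3 : (0 : ℝ) < (n : ℝ) + 1 := by positivity
      have h4 := norm_nonneg (q ((n + 1 : ℝ) : ℂ))⁻¹
      calc _ ≤ ‖(q ((n + 1 : ℝ) : ℂ))⁻¹‖ * (((n : ℝ) + 1) * ((n : ℝ) + 1)) := by
            rw [sq]; exact mul_le_mul_of_nonneg_right h2 (by positivity)
        _ ≤ ‖(q ((n + 1 : ℝ) : ℂ))⁻¹‖ * ((‖(q ((n + 1 : ℝ) : ℂ))⁻¹‖ * m) * ((n : ℝ) + 1)) := by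
            gcongr
        _ = _ := by ring) hz
  rw [inv_re, normSq_eq_norm_sq] at this
  have h5 : 0 < ‖q z‖ ^ 2 := pow_pos (norm_pos_iff.2 h0) 2
  rw [← mul_div_assoc, le_div_iff₀ h5] at this
  exact this

/-! ### The second order inequality for concave maps. -/

namespace IsConcaveMap

variable {F : ℂ → ℂ} (hF : IsConcaveMap F)

include hF

/-- The derivative form of Schwarz–Pick for `p ↦ invMap F (k + p ν)` at `p = δ`. It complements the
upper distortion bound. -/
lemma infDist_le {z : ℂ} (hz : z ∈ rightHalf) {k ν : ℂ} {δ : ℝ} (hν : ‖ν‖ = 1) (hδ : 0 < δ)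
    (hw : F z = k + δ * ν) (hA : ∀ p ∈ rightHalf, k + p * ν ∉ complImage F) :
    δ ≤ z.re * ‖deriv F z‖ := by
  have hPd : DifferentiableOn ℂ (fun p => invMap F (k + p * ν)) rightHalf :=
    hF.differentiableOn_comp_invMap (A := fun p => k + p * ν) (by fun_prop) hA
  have h1 := norm_deriv_mul_re_le hPd (fun p hp => le_of_lt (invMap_mem (hA p hp)))
    (ofReal_mem_rightHalf.2 hδ)
  have h2 : HasDerivAt (fun p : ℂ => invMap F (k + p * ν)) ((deriv F z)⁻¹ * ν) (δ : ℂ) := by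
    have h3 : HasDerivAt (fun p : ℂ => k + p * ν) ν (δ : ℂ) := by
      simpa using ((hasDerivAt_id (δ : ℂ)).mul_const ν).const_add k
    have h4 : HasDerivAt (invMap F) (deriv F z)⁻¹ (k + δ * ν) := hw ▸ hF.hasDerivAt_invMap hz
    exact h4.comp (δ : ℂ) h3
  rw [h2.deriv, ← hw, hF.invMap_apply hz, norm_mul, hν, mul_one, norm_inv, ofReal_re] at h1
  have h5 : 0 < ‖deriv F z‖ := norm_pos_iff.2 (hF.deriv_ne_zero hz)
  rwa [inv_mul_le_iff₀ h5, mul_comm] at h1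

/-- No boundary values of `F` are available, so one passes to a subsequence with `F (w n) → v ∈ K`.
The limit inequality `Re (F'(z)/(F z - v)) ≥ Re (1/(z - b))` is of Julia type at the finite boundary
point `b`. It is obtained for `F'/(F - k n)`, where `k n` is the point of `K` nearest to `F (w n)`.
-/
lemma eventually_re_logSlope_ge
    (hN : ∀ k ∈ complImage F, ∀ z ∈ rightHalf, 0 ≤ ((F z - k) / deriv F z).re) {z b : ℂ}
    (hz : z ∈ rightHalf) (hb : b.re = 0) {ε : ℝ} (hε : 0 < ε) :
    ∀ᶠ w in 𝓝[rightHalf] b, -ε ≤ (logSlope F z w).re := by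
  by_contra hcon
  rw [not_eventually] at hcon
  obtain ⟨w, hwb, hw⟩ := exists_seq_forall_of_frequently
    (hcon.and_eventually self_mem_nhdsWithin)
  have hwH : ∀ n, w n ∈ rightHalf := fun n => (hw n).2
  have hwt : Tendsto w atTop (𝓝 b) := hwb.mono_right nhdsWithin_le_nhds
  obtain ⟨k₀, hk₀⟩ := hF.complImage_nonempty
  have hb1 : b + 1 ∈ rightHalf := by simp [mem_rightHalf, hb]
  -- `‖F - k₀‖` increases along horizontal lines by `hN`, so its values near `b` are controlled by
  -- those near `b + 1`.
  have hbound : Bornology.IsBounded (range fun n => F (w n)) := by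
    have h1 : Tendsto (fun n => F (w n + 1)) atTop (𝓝 (F (b + 1))) :=
      ((hF.hasDerivAt hb1).continuousAt.tendsto).comp (hwt.add_const 1)
    obtain ⟨B, hB⟩ := h1.norm.bddAbove_range
    refine isBounded_iff_forall_norm_le.2 ⟨B + 2 * ‖k₀‖, ?_⟩
    rintro _ ⟨n, rfl⟩
    have h2 := norm_le_norm_add (G := fun z => F z - k₀) (hF.diff.sub_const _) (hwH n)
      (fun v hv => by
        have hv' : v ∈ rightHalf := lt_of_lt_of_le (hwH n) hv
        rw [((hF.hasDerivAt hv').sub_const k₀).deriv]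
        exact (re_div_nonneg_iff (hF.deriv_ne_zero hv')).1 (hN k₀ hk₀ v hv')) le_rfl
      (zero_le_one)
    simp only [ofReal_one] at h2
    have h3 : ‖F (w n + 1)‖ ≤ B := hB (mem_range_self n)
    have h4 := norm_sub_le (F (w n + 1)) k₀
    have h5 := norm_sub_norm_le (F (w n)) k₀
    simp only
    linarith
  obtain ⟨v, -, φ, hφ, hv⟩ := tendsto_subseq_of_bounded hbound (fun n => mem_range_self n)
  have hwφ : Tendsto (w ∘ φ) atTop (𝓝 b) := hwt.comp hφ.tendsto_atTop
  have hvK : v ∈ complImage F := by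
    by_contra hvK
    have h1 := ((hF.differentiableAt_invMap hvK).continuousAt.tendsto).comp hv
    have h2 : Tendsto (w ∘ φ) atTop (𝓝 (invMap F v)) :=
      h1.congr fun n => hF.invMap_apply (hwH _)
    have h3 := tendsto_nhds_unique hwφ h2
    have h4 : 0 < (invMap F v).re := invMap_mem hvK
    rw [← h3, hb] at h4
    exact lt_irrefl _ h4
  have hsup := fun n => hF.exists_support_apply (apply_notMem (F := F) (hwH (φ n)))
  choose k hk ν δ hν hδ hFk hδ' hν' hA using hsup
  have hδ0 : Tendsto δ atTop (𝓝 0) := by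
    have h1 : Tendsto (fun n => Metric.infDist (F (w (φ n))) (complImage F)) atTop
        (𝓝 (Metric.infDist v (complImage F))) :=
      ((Metric.continuous_infDist_pt _).tendsto v).comp hv
    rw [Metric.infDist_zero_of_mem hvK] at h1
    exact h1.congr fun n => (hδ' n).symm
  have hkv : Tendsto k atTop (𝓝 v) := by
    have h1 : Tendsto (fun n => F (w (φ n)) - k n) atTop (𝓝 0) := by
      rw [tendsto_zero_iff_norm_tendsto_zero]
      refine hδ0.congr fun n => ?_
      rw [hFk n, add_sub_cancel_left, norm_mul, hν, norm_real, Real.norm_eq_abs,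
        abs_of_pos (hδ n), mul_one]
    have h2 := hv.sub h1
    rw [sub_zero] at h2
    exact h2.congr fun n => by simp
  have hne : ∀ k ∈ complImage F, ∀ z ∈ rightHalf, F z - k ≠ 0 := fun k hk z hz =>
    sub_ne_zero.2 fun h => apply_notMem hz (h ▸ hk)
  have hineq : ∀ n, (1 - 2 * (w (φ n)).re * ‖deriv F z / (F z - k n)‖) * z.re ≤
      (deriv F z / (F z - k n)).re * ‖z + conj (w (φ n))‖ ^ 2 := by
    intro n
    have hPd : DifferentiableOn ℂ (fun z => deriv F z / (F z - k n)) rightHalf :=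
      (hF.diff.deriv isOpen_rightHalf).div (hF.diff.sub_const _) (hne _ (hk n))
    have hPre : ∀ z ∈ rightHalf, 0 ≤ (deriv F z / (F z - k n)).re := fun z hz =>
      re_div_nonneg_comm (hN _ (hk n) z hz)
    have hsp := schwarz_pick_add hPd hPre hz (hwH (φ n))
    have hx : 0 < (w (φ n)).re := hwH (φ n)
    -- The nearest point is used here: `infDist_le` makes the function at `w (φ n)` at least as
    -- large as `1 / Re (w (φ n))`, the size of a boundary pole.
    have hp : 1 ≤ (w (φ n)).re * ‖deriv F (w (φ n)) / (F (w (φ n)) - k n)‖ := by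
      have h1 := hF.infDist_le (hwH (φ n)) (hν n) (hδ n) (hFk n) (hA n)
      have h2 : ‖F (w (φ n)) - k n‖ = δ n := by
        rw [hFk n, add_sub_cancel_left, norm_mul, hν, norm_real, Real.norm_eq_abs,
          abs_of_pos (hδ n), mul_one]
      rw [norm_div, h2, ← mul_div_assoc, le_div_iff₀ (hδ n)]
      linarith
    set a := deriv F z / (F z - k n) with ha
    set c := deriv F (w (φ n)) / (F (w (φ n)) - k n) with hc
    have hare : 0 ≤ a.re := hPre z hz
    have hz0 : 0 < z.re := hz
    have hcpos : 0 < ‖c‖ := by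
      by_contra h
      have : ‖c‖ = 0 := le_antisymm (not_lt.1 h) (norm_nonneg _)
      rw [this, mul_zero] at hp
      linarith
    have h3 : (‖c‖ - ‖a‖) ^ 2 ≤ ‖a + conj c‖ ^ 2 := by
      rw [← sq_abs]
      refine pow_le_pow_left₀ (abs_nonneg _) ?_ 2
      have := abs_norm_sub_norm_le (conj c) (-a)
      rwa [norm_conj, norm_neg, sub_neg_eq_add, add_comm] at this
    have h4 : ‖c‖ * (‖c‖ - 2 * ‖a‖) * (z.re * (w (φ n)).re) ≤
        a.re * ‖c‖ * ‖z + conj (w (φ n))‖ ^ 2 := by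
      calc _ ≤ ‖a + conj c‖ ^ 2 * (z.re * (w (φ n)).re) := by
            refine mul_le_mul_of_nonneg_right ?_ (by positivity)
            nlinarith [norm_nonneg a]
        _ ≤ _ := hsp
        _ ≤ _ := by
            refine mul_le_mul_of_nonneg_right ?_ (by positivity)
            exact mul_le_mul_of_nonneg_left (re_le_norm c) hare
    have h5 : (‖c‖ - 2 * ‖a‖) * (z.re * (w (φ n)).re) ≤ a.re * ‖z + conj (w (φ n))‖ ^ 2 :=
      le_of_mul_le_mul_left (by linarith) hcpos
    refine le_trans ?_ h5
    have h6 : (1 - 2 * (w (φ n)).re * ‖a‖) * z.re ≤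
        ((w (φ n)).re * ‖c‖ - 2 * (w (φ n)).re * ‖a‖) * z.re :=
      mul_le_mul_of_nonneg_right (by linarith) hz0.le
    linarith
  have hxt : Tendsto (fun n => (w (φ n)).re) atTop (𝓝 0) := by
    have := (continuous_re.tendsto b).comp hwφ
    rwa [hb] at this
  have hNt : Tendsto (fun n => deriv F z / (F z - k n)) atTop (𝓝 (deriv F z / (F z - v))) :=
    (tendsto_const_nhds).div (hkv.const_sub _) (hne v hvK z hz)
  have hlim1 : Tendsto (fun n => (1 - 2 * (w (φ n)).re * ‖deriv F z / (F z - k n)‖) * z.re) atTop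
      (𝓝 ((1 - 2 * 0 * ‖deriv F z / (F z - v)‖) * z.re)) :=
    (((hxt.const_mul 2).mul hNt.norm).const_sub 1).mul_const _
  have hlim2 : Tendsto (fun n => (deriv F z / (F z - k n)).re * ‖z + conj (w (φ n))‖ ^ 2) atTop
      (𝓝 ((deriv F z / (F z - v)).re * ‖z + conj b‖ ^ 2)) :=
    ((continuous_re.tendsto _).comp hNt).mul
      ((((continuous_conj.tendsto b).comp hwφ).const_add z).norm.pow 2)
  have hfinal := le_of_tendsto_of_tendsto' hlim1 hlim2 hineq
  have hbz : z - b ≠ 0 := fun h => by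
    have := congrArg re h
    have hz0 : 0 < z.re := hz
    simp only [sub_re, hb, zero_re] at this
    linarith
  have hDlim : Tendsto (fun n => (deriv F z / (F z - F (w (φ n))) - 1 / (z - w (φ n))).re) atTop
      (𝓝 (deriv F z / (F z - v) - 1 / (z - b)).re) :=
    (continuous_re.tendsto _).comp ((tendsto_const_nhds.div (hv.const_sub _) (hne v hvK z hz)).sub
      (tendsto_const_nhds.div (hwφ.const_sub _) hbz))
  have hneg := le_of_tendsto hDlim (b := -ε) (by
    have hnz : ∀ᶠ n in atTop, w (φ n) ≠ z := hwφ.eventually_ne fun h => hbz (by rw [h, sub_self])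
    filter_upwards [hnz] with n hn
    rw [← logSlope_of_ne hF.inj hz (hwH _) hn]
    exact (not_le.1 (hw (φ n)).1).le)
  have hconj : z + conj b = z - b := by
    apply Complex.ext <;> simp [hb]
    ring
  have h7 : (1 / (z - b)).re = z.re / ‖z - b‖ ^ 2 := by
    rw [one_div, inv_re, normSq_eq_norm_sq, sub_re, hb, sub_zero]
  have h8 : 0 < ‖z - b‖ ^ 2 := pow_pos (norm_pos_iff.2 hbz) 2
  rw [hconj, mul_zero, zero_mul, sub_zero, one_mul, ← div_le_iff₀ h8] at hfinal
  rw [sub_re, h7] at hneg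
  linarith

/-- Minimum principle for `w ↦ logSlope F z w`: its real part has nonnegative lower limits on the
imaginary axis, both of its terms vanish at `∞`, and its value at `w = z` is `F''/(2 F')`. -/
lemma re_deriv_deriv_div_nonneg
    (hN : ∀ k ∈ complImage F, ∀ z ∈ rightHalf, 0 ≤ ((F z - k) / deriv F z).re) {z : ℂ}
    (hz : z ∈ rightHalf) : 0 ≤ (deriv (deriv F) z / deriv F z).re := by
  have key := re_nonneg_of_eventually isOpen_rightHalf
    (differentiableOn_logSlope isOpen_rightHalf hF.diff hF.inj hz) (fun ε hε => ?_)
    (fun b hb ε hε => hF.eventually_re_logSlope_ge hN hz (frontier_rightHalf_re hb) hε) hz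
  · rw [logSlope_same isOpen_rightHalf hF.diff hz] at key
    have h1 : (deriv (deriv F) z / deriv F z / 2).re = (deriv (deriv F) z / deriv F z).re / 2 := by
      rw [← Nat.cast_ofNat, div_natCast_re, Nat.cast_ofNat]
    rw [h1] at key
    linarith
  · obtain ⟨R, hR⟩ := hF.tendsto (‖F z‖ + 2 * ‖deriv F z‖ / ε + 1)
    refine ⟨max R (‖z‖ + 2 / ε), fun w hw hwR => ?_⟩
    have h1 := hR w hw ((le_max_left _ _).trans hwR)
    have h2 := (le_max_right _ _).trans hwR
    have hε2 : 0 < 2 / ε := by positivity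
    have hne : w ≠ z := by
      rintro rfl
      linarith
    rw [logSlope_of_ne hF.inj hz hw hne]
    have h3 : 2 * ‖deriv F z‖ / ε + 1 ≤ ‖F z - F w‖ := by
      have := norm_sub_norm_le (F w) (F z)
      rw [norm_sub_rev] at this
      linarith
    have h4 : 2 / ε ≤ ‖z - w‖ := by
      have := norm_sub_norm_le w z
      rw [norm_sub_rev] at this
      linarith
    have h5 : ‖deriv F z / (F z - F w)‖ ≤ ε / 2 := by
      have h6 : 0 < ‖F z - F w‖ := lt_of_lt_of_le (by positivity) h3
      rw [norm_div, div_le_iff₀ h6]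
      have h7 := mul_le_mul_of_nonneg_left h3 (half_pos hε).le
      have h8 : ε / 2 * (2 * ‖deriv F z‖ / ε + 1) = ‖deriv F z‖ + ε / 2 := by field_simp
      linarith
    have h6 : ‖1 / (z - w)‖ ≤ ε / 2 := by
      rw [norm_div, norm_one, div_le_iff₀ (hε2.trans_le h4)]
      have h7 := mul_le_mul_of_nonneg_left h4 (half_pos hε).le
      have h8 : ε / 2 * (2 / ε) = 1 := by field_simp
      linarith
    have h7 := norm_sub_le (deriv F z / (F z - F w)) (1 / (z - w))
    have h8 := (abs_le.1 (abs_re_le_norm (deriv F z / (F z - F w) - 1 / (z - w)))).1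
    linarith

/-- Each recession angle lies within `π / 2` of `arg (W z) + arg e` for every `z`. Over a period
centred at `arg e`, where no wrap-around occurs, these angles therefore fill at most `π` minus the
difference of the two arguments, while `hang` requires at least `(1 - m) π`. -/
lemma abs_arg_sub_le {e : ℂ} (he1 : ‖e‖ = 1) {m : ℝ}
    (hang : (1 - m) * Real.pi ≤
      (volume (recAngles (complImage F) ∩ Ioc (-Real.pi) Real.pi)).toReal)
    (hpos : ∀ z ∈ rightHalf, 0 < (deriv F z * conj (-e)).re) {z w : ℂ} (hz : z ∈ rightHalf)
    (hw : w ∈ rightHalf) :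
    arg (deriv F w * conj (-e)) - arg (deriv F z * conj (-e)) ≤ m * Real.pi := by
  set W : ℂ → ℂ := fun z => deriv F z * conj (-e) with hW
  have harg : ∀ z ∈ rightHalf, |arg (W z)| < Real.pi / 2 := fun z hz =>
    abs_arg_lt_pi_div_two_iff.2 (Or.inl (hpos z hz))
  have hπ := Real.pi_pos
  have hz' := abs_lt.1 (harg z hz)
  have hw' := abs_lt.1 (harg w hw)
  change arg (W w) - arg (W z) ≤ m * Real.pi
  have heexp : exp (arg e * I) = e := by
    have := norm_mul_exp_arg_mul_I e
    rwa [he1, ofReal_one, one_mul] at this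
  have hcos : ∀ θ ∈ recAngles (complImage F), ∀ z ∈ rightHalf,
      0 ≤ Real.cos (arg (W z) + arg e - θ) := by
    intro θ hθ z hz
    have h1 := hF.re_neg_direction_div_deriv_nonneg hθ (norm_exp_ofReal_mul_I θ) hz
    rw [re_div_nonneg_iff (hF.deriv_ne_zero hz)] at h1
    have hee : conj e * e = 1 := by rw [mul_comm, mul_conj, normSq_eq_norm_sq, he1]; simp
    have h2 : deriv F z * conj (-exp (θ * I)) = ‖W z‖ * exp ((arg (W z) + arg e - θ : ℝ) * I) := by
      have h3 : deriv F z = -(W z * e) := by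
        rw [hW]
        simp only [map_neg]
        linear_combination (-deriv F z) * hee
      have h4 : conj (exp (θ * I)) = exp (-θ * I) := by
        rw [← exp_conj, map_mul, conj_ofReal, conj_I]; ring_nf
      have h5 : exp (((arg (W z) + arg e - θ : ℝ) : ℂ) * I) =
          exp (arg (W z) * I) * exp (arg e * I) * exp (-θ * I) := by
        rw [← exp_add, ← exp_add]
        push_cast
        ring_nf
      rw [h5, heexp, map_neg, h4, h3]
      have h6 := norm_mul_exp_arg_mul_I (W z)
      linear_combination (-(e * exp (-θ * I))) * h6
    rw [h2, re_ofReal_mul, exp_ofReal_mul_I_re] at h1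
    have h7 : 0 < ‖W z‖ := norm_pos_iff.2 fun h => by
      have := hpos z hz
      simp only [hW] at h
      rw [h, zero_re] at this
      exact lt_irrefl _ this
    exact (mul_nonneg_iff_of_pos_left h7).1 h1
  have hle : ∀ θ ∈ Ioc (arg e - Real.pi) (arg e - Real.pi + 2 * Real.pi),
      ∀ l : ℝ, |l| < Real.pi / 2 → 0 ≤ Real.cos (l + arg e - θ) → |l + arg e - θ| ≤ Real.pi / 2 := by
    intro θ hθ l hl hc
    have hl' := abs_lt.1 hl
    by_contra hcon
    push Not at hcon
    rw [← Real.cos_abs] at hc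
    have h1 : |l + arg e - θ| < Real.pi + Real.pi / 2 := by
      rw [abs_lt]
      constructor <;> linarith [hθ.1, hθ.2]
    exact absurd hc (not_le.2 (Real.cos_neg_of_pi_div_two_lt_of_lt hcon h1))
  have hsub : recAngles (complImage F) ∩ Ioc (arg e - Real.pi) (arg e - Real.pi + 2 * Real.pi) ⊆
      Icc (arg (W w) + arg e - Real.pi / 2) (arg (W z) + arg e + Real.pi / 2) := by
    rintro θ ⟨hθ, hθI⟩
    have h1 := abs_le.1 (hle θ hθI _ (harg z hz) (hcos θ hθ z hz))
    have h2 := abs_le.1 (hle θ hθI _ (harg w hw) (hcos θ hθ w hw))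
    constructor <;> linarith
  have hvol := measure_mono (μ := volume) hsub
  rw [← volume_recAngles_inter_Ioc hF.isClosed_complImage, Real.volume_Icc] at hvol
  have h3 := ENNReal.toReal_mono ENNReal.ofReal_ne_top hvol
  rw [ENNReal.toReal_ofReal (by linarith)] at h3
  nlinarith

/-- The second order inequality satisfied by concave maps of the right half-plane. -/
theorem re_mul_normSq_deriv_le {m φ : ℝ} (hm : 0 < m)
    (hφ : HasOpeningAngleAtInfinity (F '' rightHalf) φ) (hφm : φ ≤ Real.pi * (1 + m)) {z : ℂ}
    (hz : z ∈ rightHalf) : z.re * ‖deriv (deriv F) z / deriv F z‖ ^ 2 ≤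
      m * (deriv (deriv F) z / deriv F z).re := by
  obtain ⟨e, he, he1⟩ := hF.exists_direction
  by_cases hline : -e ∈ recCone (complImage F)
  · rw [hF.deriv_deriv_eq_zero_of_line he he1 hline hz]
    simp
  have hN : ∀ k ∈ complImage F, ∀ z ∈ rightHalf, 0 ≤ ((F z - k) / deriv F z).re := by
    intro k hk z hz
    refine hF.re_sub_div_deriv_nonneg he he1 hk ?_ hz
    by_contra hcon
    push Not at hcon
    refine hline (mem_recCone_of_ray hF.isClosed_complImage hF.convex_compl (k := k) fun t ht => ?_)
    rw [mul_neg, ← sub_eq_add_neg]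
    exact hcon t ht
  have hang : (1 - m) * Real.pi ≤
      (volume (recAngles (complImage F) ∩ Ioc (-Real.pi) Real.pi)).toReal := by
    have h1 := tendsto_angularMeasure_compl hF.isClosed_complImage hF.convex_compl
      hF.complImage_nonempty
    rw [complImage, compl_compl] at h1
    have h2 := tendsto_nhds_unique h1 hφ
    rw [complImage]
    linarith
  have hd1 : DifferentiableOn ℂ (deriv F) rightHalf := hF.diff.deriv isOpen_rightHalf
  have hWd : DifferentiableOn ℂ (fun z => deriv F z * conj (-e)) rightHalf := hd1.mul_const _
  have hWre : ∀ z ∈ rightHalf, 0 ≤ (deriv F z * conj (-e)).re := fun z hz =>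
    (re_div_nonneg_iff (hF.deriv_ne_zero hz)).1 (hF.re_neg_direction_div_deriv_nonneg he he1 hz)
  have hce : conj (-e) ≠ 0 := by
    rw [Ne, map_eq_zero, neg_eq_zero, ← norm_eq_zero, he1]
    exact one_ne_zero
  -- If the real part vanishes at one point, rigidity makes `F'` constant; otherwise `log (F' * conj
  -- (-e))` is available.
  by_cases hzero : ∃ w ∈ rightHalf, (deriv F w * conj (-e)).re = 0
  · obtain ⟨w, hw, hw0⟩ := hzero
    have hconst : deriv F =ᶠ[𝓝 z] fun _ => deriv F w := by
      filter_upwards [rightHalf_mem_nhds hz] with v hv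
      exact mul_right_cancel₀ hce (eq_of_re_eq_zero hWd hWre hv hw hw0)
    rw [hconst.deriv_eq, deriv_const]
    simp
  · have hpos : ∀ z ∈ rightHalf, 0 < (deriv F z * conj (-e)).re := fun z hz =>
      lt_of_le_of_ne (hWre z hz) fun h => hzero ⟨z, hz, h.symm⟩
    have hWder : ∀ z ∈ rightHalf, HasDerivAt (fun z => log (deriv F z * conj (-e)))
        (deriv (deriv F) z / deriv F z) z := by
      intro z hz
      have h1 := ((hd1.differentiableAt (rightHalf_mem_nhds hz)).hasDerivAt.mul_const
        (conj (-e))).clog (Or.inl (hpos z hz))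
      refine h1.congr_deriv ?_
      rw [mul_div_mul_right _ _ hce]
    refine re_mul_normSq_le (hd1.deriv isOpen_rightHalf |>.div hd1 fun z hz => hF.deriv_ne_zero hz)
      hm (fun z hz => hF.re_deriv_deriv_div_nonneg hN hz) (fun z hz => ?_) hz
    have := norm_deriv_mul_re_le_of_im (L := fun z => log (deriv F z * conj (-e)))
      (fun z hz => (hWder z hz).differentiableAt.differentiableWithinAt) hm (fun z hz w hw => by
        simp only [log_im]
        exact abs_sub_le_iff.2 ⟨hF.abs_arg_sub_le he1 hang hpos hw hz,
          hF.abs_arg_sub_le he1 hang hpos hz hw⟩) hz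
    rwa [(hWder z hz).deriv] at this

end IsConcaveMap

/-! ### Converse: univalence and the quotient inequality. -/

lemma monotoneOn_of_hasDerivAt {f f' : ℝ → ℝ} {s : Set ℝ} (hs : Convex ℝ s)
    (hd : ∀ x ∈ s, HasDerivAt f (f' x) x) (h : ∀ x ∈ s, 0 ≤ f' x) : MonotoneOn f s := by
  refine monotoneOn_of_deriv_nonneg hs (fun x hx => (hd x hx).continuousAt.continuousWithinAt)
    (fun x hx => (hd x (interior_subset hx)).differentiableAt.differentiableWithinAt)
    fun x hx => ?_
  rw [(hd x (interior_subset hx)).deriv]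
  exact h x (interior_subset hx)

/-- The Phragmén–Lindelöf principle for the real part of a bounded holomorphic function. -/
lemma re_nonneg_of_bounded {h : ℂ → ℂ} (hd : DifferentiableOn ℂ h rightHalf) {x₀ : ℝ} (hx₀ : 0 < x₀)
    {C : ℝ} (hC : ∀ z : ℂ, x₀ ≤ z.re → ‖h z‖ ≤ C) (hbd : ∀ z : ℂ, z.re = x₀ → 0 ≤ (h z).re) {z : ℂ}
    (hz : x₀ ≤ z.re) : 0 ≤ (h z).re := by
  set f : ℂ → ℂ := fun v => exp (-h (v + x₀)) with hf
  have hmem : ∀ v : ℂ, 0 ≤ v.re → v + x₀ ∈ rightHalf := fun v hv => by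
    simp only [mem_rightHalf, add_re, ofReal_re]; linarith
  have hfd : ∀ v : ℂ, 0 ≤ v.re → DifferentiableAt ℂ f v := by
    intro v hv
    have h1 : DifferentiableAt ℂ h (v + x₀) :=
      hd.differentiableAt (rightHalf_mem_nhds (hmem v hv))
    have h2 : DifferentiableAt ℂ (fun v : ℂ => h (v + x₀)) v :=
      DifferentiableAt.comp (g := h) v h1 (by fun_prop)
    exact h2.neg.cexp
  have hfb : ∀ v : ℂ, 0 ≤ v.re → ‖f v‖ ≤ Real.exp C := by
    intro v hv
    rw [hf]
    simp only [norm_exp, neg_re, Real.exp_le_exp]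
    have h1 := hC (v + x₀) (by simp only [add_re, ofReal_re]; linarith)
    have h2 := (abs_le.1 (abs_re_le_norm (h (v + x₀)))).1
    linarith
  have hcl : closure {z : ℂ | 0 < z.re} = {z : ℂ | 0 ≤ z.re} := closure_setOfPred_lt_re 0
  have key := PhragmenLindelof.right_half_plane_of_bounded_on_real (f := f) (C := 1)
    (z := z - x₀) ⟨fun v hv => (hfd v (le_of_lt hv)).differentiableWithinAt, by
      rw [hcl]
      exact fun v hv => (hfd v hv).continuousAt.continuousWithinAt⟩
    ⟨1, by norm_num, 0, by
      refine Asymptotics.IsBigO.of_bound (Real.exp C) ?_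
      refine eventually_inf_principal.2 (Eventually.of_forall fun v hv => ?_)
      simpa using hfb v (le_of_lt hv)⟩
    ⟨Real.exp C, by
      rw [eventually_map]
      filter_upwards [eventually_ge_atTop 0] with x hx
      exact hfb _ (by simpa using hx)⟩
    (fun x => by
      rw [hf]
      simp only [norm_exp, neg_re, Real.exp_le_one_iff]
      have := hbd (x * I + x₀) (by simp)
      linarith) (by simpa using hz)
  rw [hf] at key
  simp only [norm_exp, neg_re, sub_add_cancel, Real.exp_le_one_iff] at key
  linarith

lemma deriv_deriv_div_of_exp {F L : ℂ → ℂ} (hF : ∀ z ∈ rightHalf, HasDerivAt F (exp (L z)) z)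
    (hL : DifferentiableOn ℂ L rightHalf) {z : ℂ} (hz : z ∈ rightHalf) :
    deriv (deriv F) z / deriv F z = deriv L z := by
  have h1 : deriv F =ᶠ[𝓝 z] fun w => exp (L w) := by
    filter_upwards [rightHalf_mem_nhds hz] with w hw using (hF w hw).deriv
  rw [h1.deriv_eq, (hF z hz).deriv,
    (hL.differentiableAt (rightHalf_mem_nhds hz)).hasDerivAt.cexp.deriv,
    mul_div_cancel_left₀ _ (exp_ne_zero _)]

/-- A function `F` with `F' = exp L`, where `L` satisfies the second order inequality for concave
maps and its imaginary part oscillates by at most `m * π`. -/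
structure IsSector (F L : ℂ → ℂ) (m : ℝ) : Prop where
  der : ∀ z ∈ rightHalf, HasDerivAt F (exp (L z)) z
  diff : DifferentiableOn ℂ L rightHalf
  bound : ∀ z ∈ rightHalf, z.re * ‖deriv L z‖ ^ 2 ≤ m * (deriv L z).re
  osc : ∀ z ∈ rightHalf, ∀ w ∈ rightHalf, |(L z).im - (L w).im| ≤ m * Real.pi
  pos : 0 < m
  le_one : m ≤ 1

namespace IsSector

variable {F L : ℂ → ℂ} {m : ℝ} (hF : IsSector F L m)

include hF

lemma diff_map : DifferentiableOn ℂ F rightHalf := fun z hz =>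
  (hF.der z hz).differentiableAt.differentiableWithinAt

lemma deriv_eq {z : ℂ} (hz : z ∈ rightHalf) : deriv F z = exp (L z) := (hF.der z hz).deriv

lemma hasDerivAt_log {z : ℂ} (hz : z ∈ rightHalf) : HasDerivAt L (deriv L z) z :=
  (hF.diff.differentiableAt (rightHalf_mem_nhds hz)).hasDerivAt

lemma deriv_deriv_div {z : ℂ} (hz : z ∈ rightHalf) : deriv (deriv F) z / deriv F z = deriv L z :=
  deriv_deriv_div_of_exp hF.der hF.diff hz

lemma re_deriv_nonneg {z : ℂ} (hz : z ∈ rightHalf) : 0 ≤ (deriv L z).re := by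
  have h1 := hF.bound z hz
  have h2 : 0 ≤ z.re * ‖deriv L z‖ ^ 2 := mul_nonneg (le_of_lt hz) (by positivity)
  exact nonneg_of_mul_nonneg_right (h2.trans h1) hF.pos

lemma norm_deriv_le {z : ℂ} (hz : z ∈ rightHalf) : ‖deriv L z‖ * z.re ≤ 1 :=
  (norm_deriv_mul_re_le_of_im hF.diff hF.pos hF.osc hz).trans hF.le_one

/-- Centring `Im L` puts `exp (L - c I)` in the closed half-plane only, since the oscillation may
equal `π`. If the real part vanishes somewhere, `exp L` is constant and its own argument serves as
`c`. -/
lemma exists_rotation : ∃ c : ℝ, ∀ z ∈ rightHalf, 0 < (exp (L z - c * I)).re := by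
  obtain ⟨c, hc⟩ := exists_center (S := (fun z => (L z).im) '' rightHalf) (d := m * Real.pi) (by
    rintro _ ⟨z, hz, rfl⟩ _ ⟨w, hw, rfl⟩
    exact hF.osc z hz w hw)
  have hre : ∀ z ∈ rightHalf, 0 ≤ (exp (L z - c * I)).re := by
    intro z hz
    have h1 := abs_le.1 (hc _ (mem_image_of_mem _ hz))
    have h2 : m * Real.pi ≤ Real.pi := mul_le_of_le_one_left Real.pi_pos.le hF.le_one
    simp only [exp_re, sub_im, im_ofReal_mul, I_im, mul_one]
    exact mul_nonneg (Real.exp_pos _).le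
      (Real.cos_nonneg_of_mem_Icc ⟨by linarith [h1.1], by linarith [h1.2]⟩)
  by_cases h0 : ∃ w ∈ rightHalf, (exp (L w - c * I)).re = 0
  · obtain ⟨w, hw, hw0⟩ := h0
    have hd : DifferentiableOn ℂ (fun z => exp (L z - c * I)) rightHalf :=
      (hF.diff.sub_const _).cexp
    refine ⟨(L w).im, fun z hz => ?_⟩
    have h1 : exp (L z - c * I) = exp (L w - c * I) := eq_of_re_eq_zero hd hre hz hw hw0
    have h2 : exp (L z - (L w).im * I) = exp ((L w).re : ℂ) := by
      have e1 : L z - (L w).im * I = (L z - c * I) + (c * I - (L w).im * I) := by ring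
      have e2 : ((L w).re : ℂ) = (L w - c * I) + (c * I - (L w).im * I) := by
        linear_combination re_add_im (L w)
      rw [e1, exp_add, h1, ← exp_add, ← e2]
    rw [h2, exp_ofReal_re]
    exact Real.exp_pos _
  · exact ⟨c, fun z hz => lt_of_le_of_ne (hre z hz) fun h => h0 ⟨z, hz, h.symm⟩⟩

/-- The Noshiro–Warschawski argument: Rolle's theorem on the segment joining two points with equal
image would give a zero of the real part of the rotated derivative. -/
lemma injOn : InjOn F rightHalf := by
  obtain ⟨c, hc⟩ := hF.exists_rotation
  intro w hw z hz h
  by_contra hne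
  have hv : z - w ≠ 0 := sub_ne_zero.2 (Ne.symm hne)
  have hmem : ∀ t ∈ Icc (0 : ℝ) 1, w + t * (z - w) ∈ rightHalf := by
    intro t ht
    have := convex_rightHalf hw hz (a := 1 - t) (b := t) (by linarith [ht.2]) ht.1 (by ring)
    convert this using 1
    rw [real_smul, real_smul]
    push_cast
    ring
  have hd : ∀ t ∈ Icc (0 : ℝ) 1, HasDerivAt
      (fun t : ℝ => (exp (-(c * I)) * F (w + t * (z - w)) / (z - w)).re)
      (exp (L (w + t * (z - w)) - c * I)).re t := by
    intro t ht
    have h1 := hasDerivAt_comp_line (hF.der _ (hmem t ht))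
    have h2 := hasDerivAt_re_comp ((h1.const_mul (exp (-(c * I)))).div_const (z - w))
    refine h2.congr_deriv ?_
    rw [sub_eq_add_neg (L _), exp_add]
    congr 1
    field_simp
  obtain ⟨t, ht, ht0⟩ := exists_hasDerivAt_eq_zero (a := (0 : ℝ)) (b := 1) zero_lt_one
    (fun t ht => (hd t ht).continuousAt.continuousWithinAt) (by
      simp only [ofReal_zero, zero_mul, add_zero, ofReal_one, one_mul, add_sub_cancel, h])
    fun t ht => hd t (Ioo_subset_Icc_self ht)
  exact absurd (hc _ (hmem t (Ioo_subset_Icc_self ht))) (by rw [ht0]; exact lt_irrefl 0)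

lemma norm_log_sub_le {x₁ : ℝ} (hx₁ : 0 < x₁) {z w : ℂ} (hz : x₁ ≤ z.re) (hw : x₁ ≤ w.re) :
    ‖L z - L w‖ ≤ x₁⁻¹ * ‖z - w‖ := by
  have hmem : ∀ v ∈ {v : ℂ | x₁ ≤ v.re}, v ∈ rightHalf := fun v hv => lt_of_lt_of_le hx₁ hv
  refine (convex_halfSpace_re_ge x₁).norm_image_sub_le_of_norm_hasDerivWithin_le
    (f' := deriv L) (fun v hv => (hF.hasDerivAt_log (hmem v hv)).hasDerivWithinAt) (fun v hv => ?_)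
    hw hz
  have h1 := hF.norm_deriv_le (hmem v hv)
  have h2 : 0 < v.re := hmem v hv
  have h3 : x₁ ≤ v.re := hv
  rw [← one_div, le_div_iff₀ hx₁]
  exact (mul_le_mul_of_nonneg_left h3 (norm_nonneg _)).trans h1

lemma norm_sub_ge_of_near {x₀ : ℝ} (hx₀ : 0 < x₀) {z v : ℂ} (hz : x₀ ≤ z.re)
    (hv : ‖v - z‖ ≤ x₀ / 16) : ‖exp (L z)‖ / 2 * ‖v - z‖ ≤ ‖F v - F z‖ := by
  have hre : ∀ u ∈ Metric.closedBall z (x₀ / 16), x₀ / 2 ≤ u.re := by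
    intro u hu
    rw [mem_closedBall_iff_norm] at hu
    have := (abs_le.1 ((abs_re_le_norm (u - z)).trans hu)).1
    rw [sub_re] at this
    linarith
  have hd : ∀ u ∈ Metric.closedBall z (x₀ / 16),
      HasDerivWithinAt (fun u => F u - exp (L z) * u) (exp (L u) - exp (L z))
        (Metric.closedBall z (x₀ / 16)) u := by
    intro u hu
    have h1 := (hF.der u (lt_of_lt_of_le (by positivity) (hre u hu))).sub
      ((hasDerivAt_id u).const_mul (exp (L z)))
    rw [mul_one] at h1
    exact h1.hasDerivWithinAt
  have hb : ∀ u ∈ Metric.closedBall z (x₀ / 16),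
      ‖exp (L u) - exp (L z)‖ ≤ ‖exp (L z)‖ / 2 := by
    intro u hu
    have h1 := hF.norm_log_sub_le (half_pos hx₀) (hre u hu) (by linarith : x₀ / 2 ≤ z.re)
    rw [mem_closedBall_iff_norm] at hu
    have h2 : ‖L u - L z‖ ≤ 1 / 4 := by
      refine h1.trans ?_
      rw [← div_eq_inv_mul, div_le_iff₀ (half_pos hx₀)]
      linarith
    have h3 := norm_exp_sub_one_le (h2.trans (by norm_num))
    have h4 : exp (L u) - exp (L z) = exp (L z) * (exp (L u - L z) - 1) := by
      rw [mul_sub, mul_one, ← exp_add, add_sub_cancel]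
    rw [h4, norm_mul]
    have h5 := norm_nonneg (exp (L z))
    nlinarith
  have key := (convex_closedBall z (x₀ / 16)).norm_image_sub_le_of_norm_hasDerivWithin_le hd hb
    (Metric.mem_closedBall_self (by positivity)) (mem_closedBall_iff_norm.2 hv)
  have h1 : F v - exp (L z) * v - (F z - exp (L z) * z) =
      (F v - F z) - exp (L z) * (v - z) := by ring
  rw [h1] at key
  have h2 := norm_sub_norm_le (exp (L z) * (v - z)) (F v - F z)
  rw [norm_mul, norm_sub_rev (exp (L z) * (v - z)) (F v - F z)] at h2
  linarith

/-- Near `z` the derivative of `F` is close to `exp (L z)`. For distant `w`, the image of a small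
disk about `z` contains a ball about `F z`, and injectivity keeps `F w` out of it. The resulting
boundedness of `F'(z)/(F z - F w)` is what Phragmén–Lindelöf requires. -/
lemma norm_sub_ge {x₀ : ℝ} (hx₀ : 0 < x₀) {z w : ℂ} (hz : x₀ ≤ z.re) (hw : w ∈ rightHalf) :
    ‖exp (L z)‖ / 4 * min ‖z - w‖ (x₀ / 16) ≤ ‖F z - F w‖ := by
  have hE := norm_nonneg (exp (L z))
  have hE' : 0 < ‖exp (L z)‖ := norm_pos_iff.2 (exp_ne_zero _)
  rcases le_or_gt ‖w - z‖ (x₀ / 16) with h | h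
  · have h1 := hF.norm_sub_ge_of_near hx₀ hz h
    rw [norm_sub_rev, norm_sub_rev (F w)] at h1
    have h2 := min_le_left ‖z - w‖ (x₀ / 16)
    have h3 := norm_nonneg (z - w)
    nlinarith [mul_nonneg hE h3]
  · have hre : Metric.closedBall z (x₀ / 16) ⊆ rightHalf := by
      intro u hu
      rw [mem_closedBall_iff_norm] at hu
      have := (abs_le.1 ((abs_re_le_norm (u - z)).trans hu)).1
      rw [sub_re] at this
      rw [mem_rightHalf]
      linarith
    have hzH : z ∈ rightHalf := lt_of_lt_of_le hx₀ hz
    have h1 := DiffContOnCl.ball_subset_image_closedBall (f := F) (z₀ := z) (r := x₀ / 16)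
      (ε := ‖exp (L z)‖ / 2 * (x₀ / 16))
      (hF.diff_map.mono (by
        rw [closure_ball _ (by positivity)]; exact hre)).diffContOnCl (by positivity) (by
        intro v hv
        rw [mem_sphere_iff_norm] at hv
        have := hF.norm_sub_ge_of_near hx₀ hz hv.le
        rwa [hv] at this)
      (fun hcon => not_eventually_const_of_injOn isOpen_rightHalf hF.injOn hzH
        (hcon.mono fun v hv => not_not.1 hv))
    by_contra hcon
    push Not at hcon
    have h2 : F w ∈ Metric.ball (F z) (‖exp (L z)‖ / 2 * (x₀ / 16) / 2) := by
      rw [mem_ball_iff_norm, norm_sub_rev]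
      refine hcon.trans_le ?_
      have := min_le_right ‖z - w‖ (x₀ / 16)
      nlinarith
    obtain ⟨v, hv, hvw⟩ := h1 h2
    have := hF.injOn (hre hv) hw hvw
    rw [this, mem_closedBall_iff_norm] at hv
    linarith

lemma norm_deriv_div_sub_le {x₀ : ℝ} (hx₀ : 0 < x₀) {z w : ℂ} (hz : x₀ ≤ z.re)
    (hw : w ∈ rightHalf) (hd : 1 ≤ ‖z - w‖) :
    ‖deriv F z / (F z - F w) - 1 / (z - w)‖ ≤ 4 / min 1 (x₀ / 16) + 1 := by
  have h0 : 0 < min 1 (x₀ / 16) := lt_min one_pos (by positivity)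
  have hzH : z ∈ rightHalf := lt_of_lt_of_le hx₀ hz
  have h1 : ‖exp (L z)‖ / 4 * min 1 (x₀ / 16) ≤ ‖F z - F w‖ := by
    refine le_trans ?_ (hF.norm_sub_ge hx₀ hz hw)
    gcongr
  have hE' : 0 < ‖exp (L z)‖ := norm_pos_iff.2 (exp_ne_zero _)
  have h2 : ‖deriv F z / (F z - F w)‖ ≤ 4 / min 1 (x₀ / 16) := by
    rw [hF.deriv_eq hzH, norm_div, div_le_div_iff₀ (lt_of_lt_of_le (by positivity) h1) h0]
    linarith
  have h3 : ‖1 / (z - w)‖ ≤ 1 := by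
    rw [norm_div, norm_one, div_le_one (by linarith)]
    exact hd
  exact (norm_sub_le _ _).trans (add_le_add h2 h3)

lemma im_log_mono {x y₁ y₂ : ℝ} (hx : 0 < x) (h : y₁ ≤ y₂) :
    (L (x + y₁ * I)).im ≤ (L (x + y₂ * I)).im := by
  have hmem : ∀ y : ℝ, (x : ℂ) + y * I ∈ rightHalf := fun y => by simpa [mem_rightHalf] using hx
  refine monotoneOn_of_hasDerivAt (s := univ) (f := fun y : ℝ => (L (x + y * I)).im)
    (f' := fun y => (deriv L (x + y * I)).re) convex_univ (fun y _ => ?_)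
    (fun y _ => hF.re_deriv_nonneg (hmem y)) (mem_univ _) (mem_univ _) h
  have := hasDerivAt_im_comp (hasDerivAt_comp_line (hF.hasDerivAt_log (hmem y)))
  exact this.congr_deriv (by simp)

/-- The image of a vertical line has tangent direction `I * exp L`, which turns monotonically and by
at most `π`. It therefore stays on one side of its tangent at `F z`: the derivative of `g` has the
sign of `sin (θ y)`, so `g` is least at `z.im`. -/
lemma re_sub_div_nonneg_of_re_eq {z w : ℂ} (hz : z ∈ rightHalf) (hre : w.re = z.re) :
    0 ≤ ((F z - F w) / exp (L z)).re := by
  have hz0 : 0 < z.re := hz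
  have hmem : ∀ y : ℝ, (z.re : ℂ) + y * I ∈ rightHalf := fun y => by
    simpa [mem_rightHalf] using hz0
  have hzz : (z.re : ℂ) + z.im * I = z := re_add_im z
  have hww : (z.re : ℂ) + w.im * I = w := by rw [← hre]; exact re_add_im w
  set g : ℝ → ℝ := fun y => ((F z - F (z.re + y * I)) / exp (L z)).re with hg
  set θ : ℝ → ℝ := fun y => (L (z.re + y * I)).im - (L z).im with hθ
  have hder : ∀ y : ℝ, HasDerivAt g
      (Real.exp ((L (z.re + y * I)).re - (L z).re) * Real.sin (θ y)) y := by
    intro y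
    have h1 := hasDerivAt_re_comp
      (((hasDerivAt_comp_line (hF.der _ (hmem y))).const_sub (F z)).div_const (exp (L z)))
    refine h1.congr_deriv ?_
    rw [show -(exp (L (z.re + y * I)) * I) / exp (L z) = -(exp (L (z.re + y * I) - L z) * I) by
      rw [exp_sub]; ring]
    simp only [neg_re, mul_I_re, neg_neg, exp_im, sub_re, sub_im]
    rfl
  have hosc : ∀ y, |θ y| ≤ Real.pi := fun y =>
    (hF.osc _ (hmem y) z hz).trans (mul_le_of_le_one_left Real.pi_pos.le hF.le_one)
  have hg0 : g z.im = 0 := by simp only [hg]; rw [hzz]; simp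
  have hgw : g w.im = ((F z - F w) / exp (L z)).re := by simp only [hg]; rw [hww]
  rw [← hgw, ← hg0]
  rcases le_total w.im z.im with h | h
  · have := monotoneOn_of_hasDerivAt (s := Iic z.im) (f := fun y => -g y) (convex_Iic _)
      (fun y _ => (hder y).neg) (fun y hy => by
        rw [neg_nonneg]
        refine mul_nonpos_of_nonneg_of_nonpos (Real.exp_pos _).le
          (Real.sin_nonpos_of_nonpos_of_neg_pi_le ?_ (abs_le.1 (hosc y)).1)
        have := hF.im_log_mono hz0 hy
        rw [hzz] at this
        simp only [hθ]
        linarith) h self_mem_Iic h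
    simp only at this
    linarith
  · refine monotoneOn_of_hasDerivAt (s := Ici z.im) (convex_Ici _)
      (fun y _ => hder y) (fun y hy => ?_) self_mem_Ici h h
    refine mul_nonneg (Real.exp_pos _).le
      (Real.sin_nonneg_of_nonneg_of_le_pi ?_ (abs_le.1 (hosc y)).2)
    have := hF.im_log_mono hz0 hy
    rw [hzz] at this
    simp only [hθ]
    linarith

omit hF in
lemma exists_bound_of_far {h : ℂ → ℂ} (hd : DifferentiableOn ℂ h rightHalf) {x₀ B : ℝ}
    (hx₀ : 0 < x₀) {w : ℂ} (hB : ∀ z : ℂ, x₀ ≤ z.re → 1 ≤ ‖z - w‖ → ‖h z‖ ≤ B) :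
    ∃ C, ∀ z : ℂ, x₀ ≤ z.re → ‖h z‖ ≤ C := by
  have hcpt : IsCompact (Metric.closedBall w 1 ∩ {z | x₀ ≤ z.re}) :=
    (isCompact_closedBall w 1).inter_right (isClosed_le continuous_const continuous_re)
  obtain ⟨C, hC⟩ := (hcpt.image_of_continuousOn (hd.continuousOn.mono
    fun z hz => lt_of_lt_of_le hx₀ hz.2)).isBounded.exists_norm_le
  refine ⟨max B C, fun z hz => ?_⟩
  rcases le_total 1 ‖z - w‖ with h1 | h1
  · exact (hB z hz h1).trans (le_max_left _ _)
  · exact (hC _ ⟨z, ⟨mem_closedBall_iff_norm.2 h1, hz⟩, rfl⟩).trans (le_max_right _ _)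

lemma deriv_dslope_div_eq {z w : ℂ} (hz : z ∈ rightHalf) (hw : w ∈ rightHalf) (hne : z ≠ w) :
    deriv (dslope F w) z / dslope F w z = deriv F z / (F z - F w) - 1 / (z - w) := by
  have h1 : z - w ≠ 0 := sub_ne_zero.2 hne
  have h2 : F z - F w ≠ 0 := sub_ne_zero.2 fun h => hne (hF.injOn hz hw h)
  have h3 : dslope F w =ᶠ[𝓝 z] fun v => (F v - F w) / (v - w) := by
    filter_upwards [isOpen_ne.mem_nhds hne] with v hv
    rw [dslope_of_ne _ hv, slope_def_field]
  have h4 := ((hF.der z hz).sub_const (F w)).div ((hasDerivAt_id z).sub_const w) h1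
  have h5 : deriv (fun v => (F v - F w) / (v - w)) z =
      (exp (L z) * (z - w) - (F z - F w) * 1) / (z - w) ^ 2 := h4.deriv
  rw [h3.deriv_eq, h3.eq_of_nhds, h5, hF.deriv_eq hz]
  field_simp

lemma re_deriv_dslope_div_nonneg_of_re_eq {z w : ℂ} (hz : z ∈ rightHalf) (hre : w.re = z.re) :
    0 ≤ (deriv (dslope F w) z / dslope F w z).re := by
  have hw : w ∈ rightHalf := by rw [mem_rightHalf, hre]; exact hz
  rcases eq_or_ne z w with rfl | hne
  · rw [deriv_dslope_same isOpen_rightHalf hF.diff_map hz, dslope_same, div_right_comm,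
      hF.deriv_deriv_div hz, ← Nat.cast_ofNat, div_natCast_re]
    exact div_nonneg (hF.re_deriv_nonneg hz) (by positivity)
  · rw [hF.deriv_dslope_div_eq hz hw hne, sub_re, hF.deriv_eq hz]
    have h1 := re_div_nonneg_comm (hF.re_sub_div_nonneg_of_re_eq hz hre)
    have h2 : (1 / (z - w)).re = 0 := by
      rw [one_div, inv_re, sub_re, hre, sub_self, zero_div]
    rw [h2, sub_zero]
    exact h1

/-- For fixed `w`, the sign known on the line `Re z = Re w` spreads to its right by
Phragmén–Lindelöf in `z`. -/
lemma re_deriv_dslope_div_nonneg {z w : ℂ} (hw : w ∈ rightHalf) (hre : w.re ≤ z.re) :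
    0 ≤ (deriv (dslope F w) z / dslope F w z).re := by
  have hd : DifferentiableOn ℂ (fun z => deriv (dslope F w) z / dslope F w z) rightHalf := by
    have h1 := differentiableOn_dslope' isOpen_rightHalf hF.diff_map hw
    exact (h1.deriv isOpen_rightHalf).div h1 fun z hz =>
      dslope_ne_zero isOpen_rightHalf hF.diff_map hF.injOn hw hz
  have hw0 : 0 < w.re := hw
  obtain ⟨C, hC⟩ := exists_bound_of_far (w := w) hd hw0 (fun z hz h1 => by
    have hne : z ≠ w := by
      rintro rfl
      rw [sub_self, norm_zero] at h1
      linarith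
    rw [hF.deriv_dslope_div_eq (lt_of_lt_of_le hw0 hz) hw hne]
    exact hF.norm_deriv_div_sub_le hw0 hz hw h1)
  refine re_nonneg_of_bounded hd hw0 hC (fun z hz => ?_) hre
  exact hF.re_deriv_dslope_div_nonneg_of_re_eq (by rw [mem_rightHalf, hz]; exact hw0) hz.symm

/-- A second use of Phragmén–Lindelöf, now in `w` for fixed `z`: on the line of abscissa `min z.re
w.re` the previous lemma applies, and `w` lies on it or to its right. -/
lemma re_logSlope_nonneg {z w : ℂ} (hz : z ∈ rightHalf) (hw : w ∈ rightHalf) :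
    0 ≤ (logSlope F z w).re := by
  have hd := differentiableOn_logSlope isOpen_rightHalf hF.diff_map hF.injOn hz
  set x₀ := min z.re w.re with hx
  have hx₀ : 0 < x₀ := lt_min hz hw
  have hzx : x₀ ≤ z.re := min_le_left _ _
  obtain ⟨C, hC⟩ := exists_bound_of_far (w := z) hd hx₀ (fun v hv h1 => by
    have hne : v ≠ z := by
      rintro rfl
      rw [sub_self, norm_zero] at h1
      linarith
    have hvH : v ∈ rightHalf := lt_of_lt_of_le hx₀ hv
    rw [logSlope_of_ne hF.injOn hz hvH hne]
    exact hF.norm_deriv_div_sub_le hx₀ hzx hvH (by rwa [norm_sub_rev]))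
  refine re_nonneg_of_bounded hd hx₀ hC (fun v hv => ?_) (min_le_right _ _)
  have hvH : v ∈ rightHalf := by rw [mem_rightHalf, hv]; exact hx₀
  rcases eq_or_ne v z with rfl | hne
  · rw [logSlope_same isOpen_rightHalf hF.diff_map hz, hF.deriv_deriv_div hz, ← Nat.cast_ofNat,
      div_natCast_re]
    exact div_nonneg (hF.re_deriv_nonneg hz) (by positivity)
  · rw [logSlope_of_ne hF.injOn hz hvH hne, ← hF.deriv_dslope_div_eq hz hvH hne.symm]
    exact hF.re_deriv_dslope_div_nonneg hvH (by rw [hv]; exact hzx)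

lemma re_deriv_div_sub_ge {z w : ℂ} (hz : z ∈ rightHalf) (hw : w ∈ rightHalf) (hne : w ≠ z) :
    (1 / (z - w)).re ≤ (deriv F z / (F z - F w)).re := by
  have := hF.re_logSlope_nonneg hz hw
  rw [logSlope_of_ne hF.injOn hz hw hne, sub_re] at this
  linarith

end IsSector

/-! ### Growth of `F` at infinity. -/

namespace IsSector

variable {F L : ℂ → ℂ} {m : ℝ} (hF : IsSector F L m)

omit hF in
lemma ofReal_add_mul_I_mem {x : ℝ} (hx : 0 < x) (y : ℝ) : (x : ℂ) + y * I ∈ rightHalf := by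
  simpa [mem_rightHalf] using hx

include hF

lemma hasDerivAt_im_log {x : ℝ} (hx : 0 < x) (y : ℝ) :
    HasDerivAt (fun y : ℝ => (L (x + y * I)).im) (deriv L (x + y * I)).re y := by
  have := hasDerivAt_im_comp (hasDerivAt_comp_line
    (hF.hasDerivAt_log (ofReal_add_mul_I_mem hx y)))
  exact this.congr_deriv (by simp)

lemma exists_re_deriv_le {ε : ℝ} (hε : 0 < ε) (y₀ : ℝ) :
    ∃ y, y₀ ≤ y ∧ (deriv L (1 + y * I)).re ≤ ε := by
  have hN : y₀ < y₀ + Real.pi / ε := by have := Real.pi_pos; linarith [div_pos this hε]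
  obtain ⟨y, hy, hyd⟩ := exists_hasDerivAt_eq_slope (fun y : ℝ => (L ((1 : ℝ) + y * I)).im)
    (fun y => (deriv L ((1 : ℝ) + y * I)).re) hN
    (fun y _ => (hF.hasDerivAt_im_log one_pos y).continuousAt.continuousWithinAt)
    (fun y _ => hF.hasDerivAt_im_log one_pos y)
  refine ⟨y, hy.1.le, ?_⟩
  rw [ofReal_one] at hyd
  rw [hyd, add_sub_cancel_left, div_le_iff₀ (div_pos Real.pi_pos hε), mul_div_cancel₀ _ hε.ne']
  exact (le_abs_self _).trans ((hF.osc _ (ofReal_add_mul_I_mem one_pos _) _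
    (ofReal_add_mul_I_mem one_pos _)).trans (mul_le_of_le_one_left Real.pi_pos.le hF.le_one))

/-- A Harnack inequality for `Re L'` along a horizontal segment. -/
lemma re_deriv_le_mul {x : ℝ} (hx : 0 < x) (hx1 : x ≤ 1) (y : ℝ) :
    (deriv L (x + y * I)).re * x ≤ 4 * (deriv L (1 + y * I)).re := by
  have hz := ofReal_add_mul_I_mem hx y
  have hw : (1 : ℂ) + y * I ∈ rightHalf := by simpa using ofReal_add_mul_I_mem one_pos y
  have h := schwarz_pick_add (hF.diff.deriv isOpen_rightHalf)
    (fun z hz => hF.re_deriv_nonneg hz) hz hw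
  have h1 : (x : ℂ) + y * I + conj (1 + y * I) = ((x + 1 : ℝ) : ℂ) := by
    simp only [map_add, map_one, map_mul, conj_ofReal, conj_I]; push_cast; ring
  have h2 := abs_re_le_norm (deriv L (x + y * I) + conj (deriv L (1 + y * I)))
  rw [h1, norm_real, Real.norm_eq_abs, sq_abs] at h
  simp only [add_re, ofReal_re, mul_re, I_re, mul_zero, ofReal_im, I_im, mul_one, sub_self,
    add_zero, one_re, conj_re] at h h2
  have hp := hF.re_deriv_nonneg hz
  have hq := hF.re_deriv_nonneg hw
  set p := (deriv L (x + y * I)).re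
  set q := (deriv L (1 + y * I)).re
  rw [abs_of_nonneg (by positivity)] at h2
  rcases eq_or_lt_of_le hp with h0 | h0
  · rw [← h0]; linarith
  · have h3 : p ^ 2 ≤ ‖deriv L (x + y * I) + conj (deriv L (1 + y * I))‖ ^ 2 := by
      gcongr; linarith
    have h4 : p ^ 2 * x ≤ p * q * 4 := by
      refine (mul_le_mul_of_nonneg_right h3 hx.le).trans (h.trans ?_)
      refine mul_le_mul_of_nonneg_left ?_ (by positivity)
      nlinarith
    refine le_of_mul_le_mul_left ?_ h0
    linarith

/-- At some height `y' ≥ y`, `Re L'` is tiny at `1 + y' I`. Harnack and the second order inequality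
then give `‖L'‖ ≤ ε` on the segment from there to `x + y' I`, so `Im L ≤ b + ε` at its left end, and
monotonicity of `Im L` in the height brings the bound down to `y`. -/
lemma im_log_le_of_le_one {b : ℝ} (hb : ∀ y : ℝ, (L (1 + y * I)).im ≤ b) {x : ℝ} (hx : 0 < x)
    (hx1 : x ≤ 1) (y : ℝ) : (L (x + y * I)).im ≤ b := by
  refine le_of_forall_pos_le_add fun ε hε => ?_
  obtain ⟨y', hy, hy'⟩ := hF.exists_re_deriv_le (ε := (ε * x) ^ 2 / 4) (by positivity) y
  have hmem : ∀ t ∈ Icc x 1, (t : ℂ) + y' * I ∈ rightHalf := fun t ht =>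
    ofReal_add_mul_I_mem (lt_of_lt_of_le hx ht.1) y'
  have hq : ∀ t ∈ Icc x 1, ‖deriv L (t + y' * I)‖ ≤ ε := by
    intro t ht
    have ht0 := lt_of_lt_of_le hx ht.1
    have h1 := hF.re_deriv_le_mul ht0 ht.2 y'
    have h2 := hF.bound _ (hmem t ht)
    simp only [add_re, ofReal_re, mul_re, I_re, mul_zero, ofReal_im, I_im, mul_one, sub_self,
      add_zero] at h2
    have h3 := mul_le_mul_of_nonneg_right hF.le_one (hF.re_deriv_nonneg (hmem t ht))
    have h4 : (x * ‖deriv L (t + y' * I)‖) ^ 2 ≤ (ε * x) ^ 2 := by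
      have h5 : (x * ‖deriv L (t + y' * I)‖) ^ 2 ≤ (t * ‖deriv L (t + y' * I)‖) ^ 2 := by
        gcongr; exact ht.1
      nlinarith
    have h6 := (le_abs_self _).trans (abs_le_of_sq_le_sq h4 (by positivity))
    refine le_of_mul_le_mul_left ?_ hx
    linarith
  have h1 : ‖L (x + y' * I) - L ((1 : ℝ) + y' * I)‖ ≤ ε * ‖(x : ℝ) - (1 : ℝ)‖ := by
    refine (convex_Icc x 1).norm_image_sub_le_of_norm_hasDerivWithin_le
      (f := fun t : ℝ => L (t + y' * I)) (f' := fun t => deriv L (t + y' * I))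
      (fun t ht => ?_) hq (right_mem_Icc.2 hx1) (left_mem_Icc.2 hx1)
    have h2 : HasDerivAt (fun t : ℝ => L (y' * I + t * 1)) (deriv L (y' * I + t * 1) * 1) t :=
      hasDerivAt_comp_line (hF.hasDerivAt_log (by
        rw [mul_one, add_comm]; exact hmem t ht))
    simp only [mul_one, add_comm _ ((_ : ℝ) : ℂ)] at h2
    simpa only [add_comm] using h2.hasDerivWithinAt
  have h2 : ‖(x : ℝ) - (1 : ℝ)‖ ≤ 1 := by
    rw [Real.norm_eq_abs, abs_le]; constructor <;> linarith
  have h3 := (abs_le.1 ((abs_im_le_norm _).trans (h1.trans (mul_le_of_le_one_right hε.le h2)))).2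
  have h4 := hF.im_log_mono hx hy
  have h5 := hb y'
  rw [sub_im, ofReal_one] at h3
  linarith

lemma hasDerivAt_horizontal {t : ℝ} (ht : 0 < t) (y : ℝ) :
    HasDerivAt (fun t : ℝ => L (t + y * I)) (deriv L (t + y * I)) t := by
  have h2 : HasDerivAt (fun t : ℝ => L (y * I + t * 1)) (deriv L (y * I + t * 1) * 1) t :=
    hasDerivAt_comp_line (hF.hasDerivAt_log (by
      rw [mul_one, add_comm]; exact ofReal_add_mul_I_mem ht y))
  simpa only [mul_one, add_comm] using h2

/-- Follow the path `1`, `y`, `y + y I`, `1 + y I`: the first leg does not decrease `Re L`, the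
second changes it by at most `1`, and the last costs at most `log y` because `‖L'‖ ≤ 1 / Re z`. -/
lemma re_log_ge {y : ℝ} (hy : 1 ≤ y) : (L 1).re - 1 - Real.log y ≤ (L (1 + y * I)).re := by
  have hy0 : 0 < y := by linarith
  have h1 : (L 1).re ≤ (L y).re := by
    have := monotoneOn_of_hasDerivAt (s := Ioi 0) (f := fun t : ℝ => (L (t + (0 : ℝ) * I)).re)
      (convex_Ioi _) (fun t ht => hasDerivAt_re_comp (hF.hasDerivAt_horizontal ht 0))
      (fun t ht => hF.re_deriv_nonneg (ofReal_add_mul_I_mem ht 0)) (mem_Ioi.2 one_pos) hy0 hy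
    simpa using this
  have h2 : ‖L (y + y * I) - L y‖ ≤ 1 := by
    refine (hF.norm_log_sub_le hy0 (by simp) (by simp)).trans (le_of_eq ?_)
    rw [add_sub_cancel_left, norm_mul, norm_I, mul_one, norm_real, Real.norm_eq_abs,
      abs_of_pos hy0, inv_mul_cancel₀ hy0.ne']
  have h3 := monotoneOn_of_hasDerivAt (s := Ioi 0)
    (f := fun t : ℝ => Real.log t - (L (t + y * I)).re) (convex_Ioi _)
    (fun t ht => (Real.hasDerivAt_log (ne_of_gt ht)).sub
      (hasDerivAt_re_comp (hF.hasDerivAt_horizontal ht y)))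
    (fun t ht => by
      have h4 := hF.norm_deriv_le (ofReal_add_mul_I_mem ht y)
      simp only [add_re, ofReal_re, mul_re, I_re, mul_zero, ofReal_im, I_im, mul_one, sub_self,
        add_zero] at h4
      have h5 := re_le_norm (deriv L (t + y * I))
      have h6 : ‖deriv L (t + y * I)‖ ≤ t⁻¹ := by
        rw [← one_div, le_div_iff₀ ht]; exact h4
      linarith) (mem_Ioi.2 one_pos) hy0 hy
  simp only [Real.log_one, ofReal_one] at h3
  have h4 := (abs_le.1 ((abs_re_le_norm _).trans h2)).1
  rw [sub_re] at h4
  linarith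

/-- After rotation by the supremum `b` of `Im L` on `Re z = 1`, the height `G` of `F` grows along
this line at rate at least a multiple of `1 / y`, hence logarithmically. Moving left from the line
does not lower `G`, as `Im L - b` stays in `[-π, 0]`. -/
lemma exists_norm_ge_of_im_ge (M : ℝ) :
    ∃ y₁ : ℝ, ∀ z ∈ rightHalf, z.re ≤ 1 → y₁ ≤ z.im → M ≤ ‖F z‖ := by
  have hmem1 : ∀ y : ℝ, (1 : ℂ) + y * I ∈ rightHalf := fun y => by
    simpa using ofReal_add_mul_I_mem one_pos y
  have hbdd : BddAbove (range fun y : ℝ => (L (1 + y * I)).im) := by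
    refine ⟨(L 1).im + m * Real.pi, ?_⟩
    rintro _ ⟨y, rfl⟩
    have := (abs_le.1 (hF.osc _ (hmem1 y) 1 (by simp [mem_rightHalf]))).2
    simp only
    linarith
  set b := ⨆ y : ℝ, (L (1 + y * I)).im with hbdef
  have hb : ∀ y : ℝ, (L (1 + y * I)).im ≤ b := fun y => le_ciSup hbdd y
  have hpi := Real.pi_pos
  -- Within `π / 3` of the supremum the cosine of `Im L - b` is at least `1 / 2`.
  obtain ⟨y₀, hy₀⟩ := exists_lt_of_lt_ciSup (show b - Real.pi / 3 < b by linarith)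
  have hlow : ∀ z ∈ rightHalf, b - Real.pi ≤ (L z).im := by
    intro z hz
    rw [sub_le_iff_le_add]
    refine ciSup_le fun y => ?_
    have := (abs_le.1 (hF.osc _ (hmem1 y) z hz)).2
    have h2 := mul_le_of_le_one_left hpi.le hF.le_one
    linarith
  set y₂ := max y₀ 1 with hy₂
  set G : ℂ → ℝ := fun z => (exp (-(b * I)) * F z).im with hG
  have hnorm : ∀ z, |G z| ≤ ‖F z‖ := by
    intro z
    refine (abs_im_le_norm _).trans (le_of_eq ?_)
    rw [norm_mul, norm_exp]
    simp
  have hexp : ∀ z, exp (-(b * I)) * exp (L z) = exp (L z - b * I) := fun z => by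
    rw [← exp_add]; ring_nf
  set c := Real.exp ((L 1).re - 1) / 2 with hc
  have hc0 : 0 < c := by positivity
  have hmono := monotoneOn_of_hasDerivAt (s := Ici y₂)
    (f := fun y : ℝ => G (1 + y * I) - c * Real.log y)
    (f' := fun y => (exp (L (1 + y * I) - b * I)).re - c * y⁻¹) (convex_Ici _)
    (fun y hy => by
      have hy1 : 0 < y := lt_of_lt_of_le (by positivity : (0:ℝ) < y₂) hy
      have h1 := hasDerivAt_im_comp ((hasDerivAt_comp_line (hF.der _ (hmem1 y))).const_mul
        (exp (-(b * I))))
      refine (h1.sub ((Real.hasDerivAt_log hy1.ne').const_mul c)).congr_deriv ?_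
      rw [← mul_assoc, hexp, mul_I_im])
    (fun y hy => by
      have hy1 : 1 ≤ y := (le_max_right _ _).trans hy
      have hy0 : y₀ ≤ y := (le_max_left _ _).trans hy
      have h1 := hF.re_log_ge hy1
      have h2 := hF.im_log_mono one_pos hy0
      rw [ofReal_one] at h2
      simp only [exp_re, sub_re, sub_im, im_ofReal_mul, re_ofReal_mul, I_re, I_im, mul_one,
        mul_zero, sub_zero]
      have h3 : 1 / 2 ≤ Real.cos ((L (1 + y * I)).im - b) := by
        rw [← Real.cos_pi_div_three, ← Real.cos_neg (_ - b)]
        exact Real.cos_le_cos_of_nonneg_of_le_pi (by linarith [hb y]) (by linarith)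
          (by linarith)
      have h4 : Real.exp ((L 1).re - 1) * y⁻¹ ≤ Real.exp (L (1 + y * I)).re := by
        rw [← Real.exp_log (by positivity : 0 < y⁻¹), ← Real.exp_add, Real.exp_le_exp,
          Real.log_inv]
        linarith
      have h5 : 0 < Real.exp ((L 1).re - 1) * y⁻¹ := by positivity
      rw [hc]
      nlinarith)
  obtain ⟨T, hT⟩ := exists_gt ((M - G (1 + y₂ * I) + c * Real.log y₂) / c)
  refine ⟨max y₂ (Real.exp T), fun z hz hz1 hzy => ?_⟩
  have hz0 : 0 < z.re := hz
  have hzy2 : y₂ ≤ z.im := (le_max_left _ _).trans hzy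
  have h1 := hmono self_mem_Ici hzy2 hzy2
  have h2 : T ≤ Real.log z.im := by
    rw [Real.le_log_iff_exp_le (lt_of_lt_of_le (by positivity) hzy2)]
    exact (le_max_right _ _).trans hzy
  rw [div_lt_iff₀ hc0] at hT
  simp only at h1
  have h3 : M ≤ G (1 + z.im * I) := by nlinarith
  have h4 := monotoneOn_of_hasDerivAt (s := Ioc 0 1)
    (f := fun t : ℝ => -G (z.im * I + t * 1))
    (f' := fun t => -(exp (L (z.im * I + t * 1) - b * I)).im) (convex_Ioc _ _)
    (fun t ht => by
      have h5 : (z.im : ℂ) * I + t * 1 ∈ rightHalf := by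
        rw [mul_one, add_comm]; exact ofReal_add_mul_I_mem ht.1 _
      have h6 := hasDerivAt_im_comp ((hasDerivAt_comp_line (hF.der _ h5)).const_mul
        (exp (-(b * I))))
      refine h6.neg.congr_deriv ?_
      rw [← mul_assoc, hexp, mul_one])
    (fun t ht => by
      have h5 : (z.im : ℂ) * I + t * 1 ∈ rightHalf := by
        rw [mul_one, add_comm]; exact ofReal_add_mul_I_mem ht.1 _
      have h6 := hlow _ h5
      have h7 := hF.im_log_le_of_le_one hb ht.1 ht.2 z.im
      rw [add_comm] at h7
      simp only [mul_one] at h6 ⊢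
      simp only [exp_im, sub_im, im_ofReal_mul, I_im, mul_one]
      rw [neg_nonneg]
      exact mul_nonpos_of_nonneg_of_nonpos (Real.exp_pos _).le
        (Real.sin_nonpos_of_nonpos_of_neg_pi_le (by linarith) (by linarith)))
    (⟨hz0, hz1⟩ : z.re ∈ Ioc (0 : ℝ) 1) (⟨one_pos, le_rfl⟩ : (1 : ℝ) ∈ Ioc (0 : ℝ) 1) hz1
  simp only [mul_one, ofReal_one] at h4
  rw [add_comm _ (1 : ℂ), add_comm _ (z.re : ℂ), re_add_im] at h4
  exact (by linarith : M ≤ G z).trans ((le_abs_self _).trans (hnorm z))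

lemma conj_conj_map : IsSector (fun z => conj (F (conj z))) (fun z => conj (L (conj z))) m := by
  have hmem : ∀ z ∈ rightHalf, (starRingEnd ℂ) z ∈ rightHalf := fun z hz => by
    rw [mem_rightHalf, conj_re]; exact hz
  have hd : ∀ z ∈ rightHalf, HasDerivAt (fun z => (starRingEnd ℂ) (L ((starRingEnd ℂ) z)))
      ((starRingEnd ℂ) (deriv L ((starRingEnd ℂ) z))) z := fun z hz => by
    have := (hF.hasDerivAt_log (hmem z hz)).conj_conj
    rwa [conj_conj] at this
  refine ⟨fun z hz => ?_, fun z hz => (hd z hz).differentiableAt.differentiableWithinAt,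
    fun z hz => ?_, fun z hz w hw => ?_, hF.pos, hF.le_one⟩
  · have := (hF.der _ (hmem z hz)).conj_conj
    rw [conj_conj, ← exp_conj] at this
    exact this
  · rw [(hd z hz).deriv, RCLike.norm_conj, conj_re]
    have := hF.bound _ (hmem z hz)
    rwa [conj_re] at this
  · rw [conj_im, conj_im]
    have := hF.osc _ (hmem w hw) _ (hmem z hz)
    rwa [neg_sub_neg]

/-- For `Re z ≤ 1` use the previous estimate and its reflection in the real axis. For `Re z ≥ 1` the
modulus of the difference quotient based at `w = 1/2` increases along horizontal lines, which
reduces the matter to `Re z = 1`: a compact piece, where it has a positive minimum, and the part of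
large height. -/
lemma tendsto (M : ℝ) : ∃ R : ℝ, ∀ z ∈ rightHalf, R ≤ ‖z‖ → M ≤ ‖F z‖ := by
  set w : ℂ := ((1 / 2 : ℝ) : ℂ) with hw
  have hwH : w ∈ rightHalf := ofReal_mem_rightHalf.2 (by norm_num)
  obtain ⟨y₁, hy₁⟩ := hF.exists_norm_ge_of_im_ge (M + 2 * ‖F w‖)
  obtain ⟨y₂, hy₂⟩ := hF.conj_conj_map.exists_norm_ge_of_im_ge (M + 2 * ‖F w‖)
  set Y := max 0 (max y₁ y₂) with hY
  have hbig : ∀ z ∈ rightHalf, z.re ≤ 1 → Y ≤ |z.im| → M + 2 * ‖F w‖ ≤ ‖F z‖ := by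
    intro z hz hz1 hzY
    rcases le_total 0 z.im with h | h
    · rw [abs_of_nonneg h] at hzY
      exact hy₁ z hz hz1 (((le_max_left _ _).trans (le_max_right _ _)).trans hzY)
    · rw [abs_of_nonpos h] at hzY
      have := hy₂ ((starRingEnd ℂ) z) (by rw [mem_rightHalf, conj_re]; exact hz)
        (by rwa [conj_re])
        (by rw [conj_im]; exact ((le_max_right _ _).trans (le_max_right _ _)).trans hzY)
      rwa [conj_conj, RCLike.norm_conj] at this
  have hSd := differentiableOn_dslope' isOpen_rightHalf hF.diff_map hwH
  have hmono : ∀ z : ℂ, 1 ≤ z.re → ‖dslope F w (1 + z.im * I)‖ ≤ ‖dslope F w z‖ := by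
    intro z hz
    have h1 := norm_le_norm_add hSd (a := 1 / 2) (by norm_num) (z := 1 + z.im * I)
      (t := z.re - 1) (fun v hv => by
        have hv0 : v ∈ rightHalf := lt_of_lt_of_le (by norm_num) hv
        have h2 := hF.re_deriv_dslope_div_nonneg hwH (z := v) (by rw [hw, ofReal_re]; exact hv)
        have h3 := (re_div_nonneg_iff
          (dslope_ne_zero isOpen_rightHalf hF.diff_map hF.injOn hwH hv0)).1 h2
        simp only [mul_re, conj_re, conj_im] at h3 ⊢
        linarith) (by simp; norm_num) (by linarith)
    have h2 : 1 + z.im * I + ((z.re - 1 : ℝ) : ℂ) = z := by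
      conv_rhs => rw [← re_add_im z]
      push_cast
      ring
    rwa [h2] at h1
  have hS : ∀ z : ℂ, 1 ≤ z.re → ‖dslope F w z‖ = ‖F z - F w‖ / ‖z - w‖ := by
    intro z hz
    have hne : z ≠ w := by
      rintro rfl
      rw [hw, ofReal_re] at hz
      norm_num at hz
    rw [dslope_of_ne _ hne, slope_def_field, norm_div]
  have hmem1 : ∀ y : ℝ, (1 : ℂ) + y * I ∈ rightHalf := fun y => by
    simpa using ofReal_add_mul_I_mem one_pos y
  obtain ⟨y₃, -, hy₃⟩ := (isCompact_Icc (a := -Y) (b := Y)).exists_isMinOn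
    (nonempty_Icc.2 (by have : 0 ≤ Y := le_max_left _ _; linarith))
    (f := fun y : ℝ => ‖dslope F w (1 + y * I)‖)
    (fun y _ => by
      have h1 : ContinuousAt (dslope F w) (1 + y * I) :=
        (hSd.differentiableAt (rightHalf_mem_nhds (hmem1 y))).continuousAt
      have h2 : ContinuousAt (fun y : ℝ => dslope F w (1 + y * I)) y :=
        ContinuousAt.comp (g := dslope F w) h1 (by fun_prop)
      exact h2.norm.continuousWithinAt)
  set c := ‖dslope F w (1 + y₃ * I)‖ with hc
  have hc0 : 0 < c :=
    norm_pos_iff.2 (dslope_ne_zero isOpen_rightHalf hF.diff_map hF.injOn hwH (hmem1 y₃))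
  refine ⟨max (Y + 1) ((M + ‖F w‖) / c + ‖w‖), fun z hz hzR => ?_⟩
  have hz0 : 0 < z.re := hz
  have hR1 := (le_max_left _ _).trans hzR
  have hR2 := (le_max_right _ _).trans hzR
  have hFw := norm_nonneg (F w)
  rcases le_total z.re 1 with h | h
  · have h1 := norm_le_abs_re_add_abs_im z
    rw [abs_of_pos hz0] at h1
    have := hbig z hz h (by linarith)
    linarith
  have hzw : 0 < ‖z - w‖ := norm_pos_iff.2 (sub_ne_zero.2 (by
    rintro rfl
    rw [hw, ofReal_re] at h
    norm_num at h))
  have hmz := hmono z h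
  rw [hS z h] at hmz
  have h5 := norm_sub_le (F z) (F w)
  rcases le_total Y |z.im| with h' | h'
  · have h1 := hbig (1 + z.im * I) (hmem1 _) (by simp) (by simpa using h')
    rw [hS _ (by simp), div_le_div_iff₀ (norm_pos_iff.2 (sub_ne_zero.2 (by
      intro hcon
      have := congrArg re hcon
      rw [hw] at this
      norm_num at this))) hzw] at hmz
    have h2 : ‖1 + z.im * I - w‖ ≤ ‖z - w‖ := by
      rw [norm_def, norm_def]
      refine Real.sqrt_le_sqrt ?_
      simp only [normSq_apply, hw]
      simp
      norm_num
      nlinarith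
    have h3 : ‖F (1 + z.im * I) - F w‖ ≤ ‖F z - F w‖ := by
      refine le_of_mul_le_mul_right (hmz.trans ?_) hzw
      exact mul_le_mul_of_nonneg_left h2 (norm_nonneg _)
    have h4 := norm_sub_norm_le (F (1 + z.im * I)) (F w)
    linarith
  · have h1 := hy₃ (abs_le.1 h')
    have h2 : c * ‖z - w‖ ≤ ‖F z - F w‖ := by
      rw [← le_div_iff₀ hzw]
      exact le_trans h1 hmz
    have h3 : (M + ‖F w‖) / c ≤ ‖z - w‖ := by
      have := norm_sub_norm_le z w
      linarith
    rw [div_le_iff₀ hc0] at h3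
    linarith

end IsSector

/-! ### Converse: convexity of the complement and the opening angle. -/

lemma exists_first_exit {K : Set ℂ} (hK : IsClosed K) {w v : ℂ} (hw : w ∉ K) (hv : w + v ∈ K) :
    ∃ τ : ℝ, 0 < τ ∧ τ ≤ 1 ∧ w + τ * v ∈ K ∧ ∀ t : ℝ, 0 ≤ t → t < τ → w + t * v ∉ K := by
  have hcl : IsClosed {t : ℝ | w + t * v ∈ K} := hK.preimage (by fun_prop)
  obtain ⟨τ, ⟨hτ, hτK⟩, hmin⟩ := (isCompact_Icc (a := (0 : ℝ)) (b := 1)).inter_right hcl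
    |>.exists_isLeast ⟨1, ⟨zero_le_one, le_rfl⟩, by simpa using hv⟩
  refine ⟨τ, lt_of_le_of_ne hτ.1 ?_, hτ.2, hτK, fun t ht htτ hK' => ?_⟩
  · rintro rfl
    simp only [mem_ofPred_eq, ofReal_zero, zero_mul, add_zero] at hτK
    exact hw hτK
  · exact absurd (hmin ⟨⟨ht, htτ.le.trans hτ.2⟩, hK'⟩) (not_le.2 htτ)

namespace IsSector

open IsConcaveMap (invMap_mem apply_invMap apply_notMem)

variable {F L : ℂ → ℂ} {m : ℝ} (hF : IsSector F L m)

include hF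

lemma isClosed_complImage : IsClosed (complImage F) :=
  (isOpen_image_of_injOn isOpen_rightHalf hF.diff_map hF.injOn).isClosed_compl

/-- Up to the first hit of `K` the segment lifts to the half-plane. The lift is bounded because `F`
tends to `∞` at `∞`, and it cannot accumulate inside, since the hit point is not a value of `F`. -/
lemma exists_exit_point {z k : ℂ} (hz : z ∈ rightHalf) (hk : k ∈ complImage F) :
    ∃ τ : ℝ, 0 < τ ∧ (∀ t : ℝ, 0 ≤ t → t < τ → F z + t * (k - F z) ∉ complImage F) ∧
      ∃ p : ℂ, p.re = 0 ∧ ∃ t : ℕ → ℝ, (∀ n, 0 < t n ∧ t n < τ) ∧ Tendsto t atTop (𝓝 τ) ∧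
        Tendsto (fun n => invMap F (F z + t n * (k - F z))) atTop (𝓝 p) := by
  obtain ⟨τ, hτ, -, hτK, hτm⟩ := exists_first_exit hF.isClosed_complImage (apply_notMem hz)
    (v := k - F z) (by rwa [add_sub_cancel])
  refine ⟨τ, hτ, hτm, ?_⟩
  obtain ⟨s, -, hsm, hst⟩ := exists_seq_strictMono_tendsto' hτ
  have hmem : ∀ n, invMap F (F z + s n * (k - F z)) ∈ rightHalf := fun n =>
    invMap_mem (hτm _ (hsm n).1.le (hsm n).2)
  have happ : ∀ n, F (invMap F (F z + s n * (k - F z))) = F z + s n * (k - F z) := fun n =>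
    apply_invMap (hτm _ (hsm n).1.le (hsm n).2)
  have hwt : Tendsto (fun n => F z + s n * (k - F z)) atTop (𝓝 (F z + τ * (k - F z))) :=
    ((hst.ofReal).mul_const _).const_add _
  obtain ⟨M, hM⟩ := hwt.norm.bddAbove_range
  obtain ⟨R, hR⟩ := hF.tendsto (M + 1)
  have hb : ∀ n, invMap F (F z + s n * (k - F z)) ∈ Metric.closedBall (0 : ℂ) R := by
    intro n
    rw [mem_closedBall_zero_iff]
    by_contra hcon
    have h1 := hR _ (hmem n) (not_le.1 hcon).le
    rw [happ] at h1
    have h2 : ‖F z + s n * (k - F z)‖ ≤ M := hM (mem_range_self n)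
    linarith
  obtain ⟨p, -, φ, hφ, hp⟩ := (isCompact_closedBall (0 : ℂ) R).tendsto_subseq hb
  refine ⟨p, ?_, s ∘ φ, fun n => hsm _, hst.comp hφ.tendsto_atTop, hp⟩
  have hp0 : 0 ≤ p.re :=
    ge_of_tendsto' ((continuous_re.tendsto p).comp hp) fun n => le_of_lt (hmem (φ n))
  refine le_antisymm (not_lt.1 fun hlt => ?_) hp0
  have h1 : Tendsto (fun n => F (invMap F (F z + s (φ n) * (k - F z)))) atTop (𝓝 (F p)) :=
    (hF.der p hlt).continuousAt.tendsto.comp hp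
  simp only [happ] at h1
  have h2 := tendsto_nhds_unique h1 (hwt.comp hφ.tendsto_atTop)
  exact apply_notMem (F := F) hlt (by rw [h2]; exact hτK)

/-- Pass to the limit in `re_deriv_div_sub_ge` along the lifted segment. The differences `F z - F w`
are positive multiples of `F z - k`, and `Re (1/(z - p)) > 0` because `p` is on the imaginary axis.
-/
lemma re_deriv_div_pos {z k : ℂ} (hz : z ∈ rightHalf) (hk : k ∈ complImage F) :
    0 < (deriv F z / (F z - k)).re := by
  obtain ⟨τ, hτ, hτm, p, hp, t, ht, htt, htp⟩ := hF.exists_exit_point hz hk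
  have hz0 : 0 < z.re := hz
  have hne : F z - k ≠ 0 := sub_ne_zero.2 fun h => apply_notMem hz (h ▸ hk)
  have h1 : ∀ n, (1 / (z - invMap F (F z + t n * (k - F z)))).re ≤
      (deriv F z / (t n * (F z - k))).re := by
    intro n
    have hm := hτm _ (ht n).1.le (ht n).2
    have h2 : invMap F (F z + t n * (k - F z)) ≠ z := by
      intro h
      have h3 := apply_invMap hm
      rw [h, left_eq_add, mul_eq_zero, ofReal_eq_zero] at h3
      rcases h3 with h3 | h3
      · exact (ht n).1.ne' h3
      · exact hne (by rw [← neg_sub, h3, neg_zero])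
    have h3 := hF.re_deriv_div_sub_ge hz (invMap_mem hm) h2
    rwa [apply_invMap hm, show F z - (F z + t n * (k - F z)) = t n * (F z - k) by ring] at h3
  have hzp : z - p ≠ 0 := by
    intro h
    have := congrArg re h
    rw [sub_re, hp, zero_re] at this
    linarith
  have h2 : Tendsto (fun n => (1 / (z - invMap F (F z + t n * (k - F z)))).re) atTop
      (𝓝 (1 / (z - p)).re) :=
    (continuous_re.tendsto _).comp (tendsto_const_nhds.div (tendsto_const_nhds.sub htp) hzp)
  have h3 : Tendsto (fun n => (deriv F z / (t n * (F z - k))).re) atTop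
      (𝓝 (deriv F z / (τ * (F z - k))).re) :=
    (continuous_re.tendsto _).comp (tendsto_const_nhds.div (htt.ofReal.mul_const _)
      (mul_ne_zero (ofReal_ne_zero.2 hτ.ne') hne))
  have h4 := le_of_tendsto_of_tendsto' h2 h3 h1
  have h5 : 0 < (1 / (z - p)).re := by
    rw [one_div, inv_re, sub_re, hp, sub_zero]
    exact div_pos hz0 (normSq_pos.2 hzp)
  have h6 : deriv F z / (τ * (F z - k)) = (deriv F z / (F z - k)) / τ := by
    rw [mul_comm, div_div]
  rw [h6, div_ofReal_re] at h4
  exact (div_pos_iff_of_pos_right hτ).1 (h5.trans_le h4)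

/-- At a value `F z` strictly between `k₁` and `k₂` in `K`, the numbers `F z - k₁` and `F z - k₂`
are opposite up to positive factors, so both quotients of `re_deriv_div_pos` cannot have positive
real part. -/
lemma convex_complImage : Convex ℝ (complImage F) := by
  intro k₁ h₁ k₂ h₂ a b ha hb hab
  by_contra hcon
  rcases eq_or_lt_of_le ha with rfl | ha
  · rw [zero_add] at hab
    subst hab
    simp only [zero_smul, one_smul, zero_add] at hcon
    exact hcon h₂
  rcases eq_or_lt_of_le hb with rfl | hb
  · rw [add_zero] at hab
    subst hab
    simp only [zero_smul, one_smul, add_zero] at hcon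
    exact hcon h₁
  have hz := invMap_mem hcon
  have hab' : (a : ℂ) = 1 - b := by
    rw [← ofReal_one, ← ofReal_sub, ← hab, add_sub_cancel_right]
  have e₁ : F (invMap F (a • k₁ + b • k₂)) - k₁ = b * (k₂ - k₁) := by
    rw [apply_invMap hcon, real_smul, real_smul, hab']; ring
  have e₂ : F (invMap F (a • k₁ + b • k₂)) - k₂ = (-a : ℝ) * (k₂ - k₁) := by
    rw [apply_invMap hcon, real_smul, real_smul, ofReal_neg, show (b : ℂ) = 1 - a by
      rw [hab']; ring]
    ring
  have p₁ := hF.re_deriv_div_pos hz h₁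
  have p₂ := hF.re_deriv_div_pos hz h₂
  rw [e₁, mul_comm, ← div_div, div_ofReal_re] at p₁
  rw [e₂, mul_comm, ← div_div, div_ofReal_re, div_neg, neg_pos] at p₂
  exact absurd (div_pos ((div_pos_iff_of_pos_right hb).1 p₁) ha) p₂.not_gt

theorem isConcaveMap : IsConcaveMap F where
  diff := hF.diff_map
  inj := hF.injOn
  convex_compl := hF.convex_complImage
  tendsto := hF.tendsto

/-- If `k + t e` were a value `F z`, moving from it towards `k` would not decrease the real part of
the preimage, which nevertheless reaches `0` at the exit point. -/
lemma mem_recCone {e : ℂ} (he : ∀ z ∈ rightHalf, 0 ≤ (-e / deriv F z).re) :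
    e ∈ recCone (complImage F) := by
  intro k hk t ht
  by_contra hcon
  have hz := invMap_mem hcon
  have happ := apply_invMap hcon
  set z := invMap F (k + t * e) with hzdef
  obtain ⟨τ, hτ, hτm, p, hp, s, hs, -, hsp⟩ := hF.exists_exit_point hz hk
  have hmono := monotoneOn_of_hasDerivAt (s := Ico 0 τ)
    (f := fun u : ℝ => (invMap F (F z + u * (k - F z))).re)
    (f' := fun u => ((deriv F (invMap F (F z + u * (k - F z))))⁻¹ * (k - F z)).re) (convex_Ico _ _)
    (fun u hu => hasDerivAt_re_comp (hasDerivAt_comp_line (by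
      have h1 := hF.isConcaveMap.hasDerivAt_invMap (invMap_mem (hτm u hu.1 hu.2))
      rwa [apply_invMap (hτm u hu.1 hu.2)] at h1)))
    (fun u hu => by
      have h1 := he _ (invMap_mem (hτm u hu.1 hu.2))
      rw [happ, show (deriv F (invMap F (k + t * e + u * (k - (k + t * e)))))⁻¹ *
        (k - (k + t * e)) = t * (-e / deriv F (invMap F (k + t * e + u * (k - (k + t * e))))) by
          ring, re_ofReal_mul]
      rw [happ] at h1
      exact mul_nonneg ht h1)
  have h2 : ∀ n, z.re ≤ (invMap F (F z + s n * (k - F z))).re := by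
    intro n
    have := hmono ⟨le_rfl, hτ⟩ ⟨(hs n).1.le, (hs n).2⟩ (hs n).1.le
    simp only [ofReal_zero, zero_mul, add_zero] at this
    rwa [hF.isConcaveMap.invMap_apply hz] at this
  have h3 := ge_of_tendsto' ((continuous_re.tendsto p).comp hsp) h2
  rw [hp] at h3
  exact absurd hz (not_lt.2 h3)

theorem exists_openingAngle :
    ∃ φ : ℝ, HasOpeningAngleAtInfinity (F '' rightHalf) φ ∧ φ ≤ Real.pi * (1 + m) := by
  have hcl := hF.isClosed_complImage
  have h1 := tendsto_angularMeasure_compl hcl hF.convex_complImage hF.isConcaveMap.complImage_nonempty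
  rw [complImage, compl_compl] at h1
  refine ⟨_, h1, ?_⟩
  obtain ⟨c, hc⟩ := exists_center (S := (fun z => (L z).im) '' rightHalf) (d := m * Real.pi) (by
    rintro _ ⟨z, hz, rfl⟩ _ ⟨w, hw, rfl⟩
    exact hF.osc z hz w hw)
  have hpi := Real.pi_pos
  have hmpi : 0 ≤ m * Real.pi := mul_nonneg hF.pos.le hpi.le
  -- For these `θ` the number `θ - Im L` stays in `[π/2, 3π/2]`, so `Re (-exp (θ I) / F') ≥ 0`. The
  -- interval has length `(1 - m) π`.
  have hsub : Icc (c + m * Real.pi / 2 + Real.pi / 2) (c - m * Real.pi / 2 + 3 * Real.pi / 2) ⊆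
      recAngles (complImage F) ∩ Ioc c (c + 2 * Real.pi) := by
    intro θ hθ
    refine ⟨hF.mem_recCone fun z hz => ?_, by linarith [hθ.1], by linarith [hθ.2]⟩
    have h2 := abs_le.1 (hc _ (mem_image_of_mem _ hz))
    rw [hF.deriv_eq hz, neg_div, ← exp_sub, neg_re, exp_re, neg_nonneg]
    refine mul_nonpos_of_nonneg_of_nonpos (Real.exp_pos _).le ?_
    simp only [sub_im, im_ofReal_mul, I_im, mul_one]
    exact Real.cos_nonpos_of_pi_div_two_le_of_le (by linarith [hθ.1]) (by linarith [hθ.2])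
  have h3 := measure_mono (μ := volume) hsub
  rw [← volume_recAngles_inter_Ioc hcl c, Real.volume_Icc] at h3
  have h4 : volume (recAngles (complImage F) ∩ Ioc (-Real.pi) Real.pi) ≠ ⊤ :=
    ((measure_mono inter_subset_right).trans_lt measure_Ioc_lt_top).ne
  have h5 := (ENNReal.ofReal_le_iff_le_toReal h4).1 h3
  rw [complImage] at h5
  linarith

end IsSector

/-! ### The unit disk: primitives, logarithms and the pointwise Kaplan condition. -/

lemma mem_unitDisk {z : ℂ} : z ∈ unitDisk ↔ ‖z‖ < 1 := mem_ball_zero_iff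

lemma isOpen_unitDisk : IsOpen unitDisk := Metric.isOpen_ball

lemma unitDisk_mem_nhds {z : ℂ} (hz : z ∈ unitDisk) : unitDisk ∈ 𝓝 z := isOpen_unitDisk.mem_nhds hz

lemma zero_mem_unitDisk : (0 : ℂ) ∈ unitDisk := by simp [mem_unitDisk]

lemma mul_mem_unitDisk {z : ℂ} (hz : z ∈ unitDisk) {u : ℝ} (hu : u ∈ Icc (0 : ℝ) 1) :
    (u : ℂ) * z ∈ unitDisk := by
  rw [mem_unitDisk] at *
  rw [norm_mul, norm_real, Real.norm_eq_abs, abs_of_nonneg hu.1]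
  exact (mul_le_of_le_one_left (norm_nonneg z) hu.2).trans_lt hz

lemma re_one_sub_pos {z : ℂ} (hz : z ∈ unitDisk) : 0 < (1 - z).re := by
  rw [mem_unitDisk] at hz
  have := (re_le_norm z).trans_lt hz
  rw [sub_re, one_re]
  linarith

lemma one_sub_mem_slitPlane {z : ℂ} (hz : z ∈ unitDisk) : 1 - z ∈ slitPlane :=
  Or.inl (re_one_sub_pos hz)

lemma one_sub_ne_zero {z : ℂ} (hz : z ∈ unitDisk) : 1 - z ≠ 0 :=
  slitPlane_ne_zero (one_sub_mem_slitPlane hz)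

lemma segmentIntegral_eq_sub {g Φ : ℂ → ℂ} (hg : DifferentiableOn ℂ g unitDisk)
    (hΦ : ∀ z ∈ unitDisk, HasDerivAt Φ (g z) z) {z : ℂ} (hz : z ∈ unitDisk) :
    segmentIntegral g z = Φ z - Φ 0 := by
  have h1 : ∀ u ∈ uIcc (0 : ℝ) 1, HasDerivAt (fun u : ℝ => Φ (u * z)) (g (u * z) * z) u := by
    intro u hu
    rw [uIcc_of_le zero_le_one] at hu
    have := hasDerivAt_comp_line (z := 0) (v := z) (u := u)
      (by rw [zero_add]; exact hΦ _ (mul_mem_unitDisk hz hu))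
    simpa only [zero_add] using this
  have h2 : ContinuousOn (fun u : ℝ => g (u * z) * z) (uIcc (0 : ℝ) 1) := by
    refine ContinuousOn.mul (hg.continuousOn.comp (f := fun u : ℝ => (u : ℂ) * z) (by fun_prop)
      fun u hu => ?_) continuousOn_const
    rw [uIcc_of_le zero_le_one] at hu
    exact mul_mem_unitDisk hz hu
  have := intervalIntegral.integral_eq_sub_of_hasDerivAt h1 h2.intervalIntegrable
  rw [segmentIntegral, this]
  simp

lemma eq_segmentIntegral_iff {f g : ℂ → ℂ} (hg : DifferentiableOn ℂ g unitDisk) :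
    (∀ z ∈ unitDisk, f z = segmentIntegral g z) ↔
      f 0 = 0 ∧ ∀ z ∈ unitDisk, HasDerivAt f (g z) z := by
  constructor
  · intro h
    obtain ⟨Φ, hΦ⟩ := hg.isExactOn_ball
    have h1 : ∀ z ∈ unitDisk, f z = Φ z - Φ 0 := fun z hz => by
      rw [h z hz, segmentIntegral_eq_sub hg hΦ hz]
    refine ⟨by rw [h1 0 zero_mem_unitDisk, sub_self], fun z hz => ?_⟩
    refine ((hΦ z hz).sub_const (Φ 0)).congr_of_eventuallyEq ?_
    filter_upwards [unitDisk_mem_nhds hz] with w hw using h1 w hw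
  · rintro ⟨h0, h⟩ z hz
    rw [segmentIntegral_eq_sub hg h hz, h0, sub_zero]

lemma differentiableOn_one_sub_cpow (a : ℂ) :
    DifferentiableOn ℂ (fun z : ℂ => (1 - z) ^ a) unitDisk := fun z hz => by
  have h : DifferentiableAt ℂ (fun z : ℂ => 1 - z) z := by fun_prop
  exact (h.cpow_const (one_sub_mem_slitPlane hz)).differentiableWithinAt

lemma one_sub_cpow_ne_zero {z : ℂ} (hz : z ∈ unitDisk) (a : ℂ) : (1 - z) ^ a ≠ 0 := by
  rw [cpow_def_of_ne_zero (one_sub_ne_zero hz)]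
  exact exp_ne_zero _

/-- The pointwise form of the condition defining the Kaplan class `K(m, 0)`. -/
structure IsPointwiseKaplan (m : ℝ) (s : ℂ → ℂ) : Prop where
  diff : DifferentiableOn ℂ s unitDisk
  ne_zero : ∀ z ∈ unitDisk, s z ≠ 0
  apply_zero : s 0 = 1
  re_lt : ∀ z ∈ unitDisk, (z * deriv s z / s z).re < m / 2

lemma exists_log {s : ℂ → ℂ} (hs : DifferentiableOn ℂ s unitDisk) (h0 : ∀ z ∈ unitDisk, s z ≠ 0)
    (h1 : s 0 = 1) : ∃ l : ℂ → ℂ, (∀ z ∈ unitDisk, HasDerivAt l (deriv s z / s z) z) ∧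
      ∀ z ∈ unitDisk, exp (l z) = s z := by
  have hd : DifferentiableOn ℂ (fun z => deriv s z / s z) unitDisk :=
    (hs.deriv isOpen_unitDisk).div hs h0
  obtain ⟨l, hl0, hl⟩ := hd.isExactOn_ball.with_val_at 0 0
  refine ⟨l, hl, fun z hz => ?_⟩
  have h2 : ∀ w ∈ unitDisk, HasDerivAt (fun w => s w * exp (-l w)) 0 w := by
    intro w hw
    have := (hs.differentiableAt (unitDisk_mem_nhds hw)).hasDerivAt.mul (hl w hw).neg.cexp
    refine this.congr_deriv ?_
    have := h0 w hw
    field_simp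
    ring
  have h3 : s z * exp (-l z) = s 0 * exp (-l 0) :=
    (show Convex ℝ unitDisk from convex_ball 0 1).is_const_of_fderivWithin_eq_zero (𝕜 := ℂ)
      (f := fun w => s w * exp (-l w))
      (fun w hw => (h2 w hw).differentiableAt.differentiableWithinAt) (fun w hw => by
        rw [fderivWithin_of_isOpen isOpen_unitDisk hw]
        ext
        simpa using (h2 w hw).deriv) hz zero_mem_unitDisk
  rw [h1, hl0, neg_zero, exp_zero, one_mul, exp_neg] at h3
  exact (eq_of_mul_inv_eq_one h3).symm

lemma circleMap_mem_unitDisk {r : ℝ} (hr : 0 < r) (hr1 : r < 1) (θ : ℝ) :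
    circleMap 0 r θ ∈ unitDisk := by
  rw [mem_unitDisk, norm_circleMap_zero, abs_of_pos hr]
  exact hr1

lemma hasDerivAt_im_circleMap {l l' : ℂ → ℂ} (hl : ∀ z ∈ unitDisk, HasDerivAt l (l' z) z)
    {r : ℝ} (hr : 0 < r) (hr1 : r < 1) (m θ : ℝ) :
    HasDerivAt (fun θ : ℝ => (l (circleMap 0 r θ)).im - m / 2 * θ)
      ((circleMap 0 r θ * l' (circleMap 0 r θ)).re - m / 2) θ := by
  have h1 := (hl _ (circleMap_mem_unitDisk hr hr1 θ)).comp_of_eq θ (hasDerivAt_circleMap 0 r θ) rfl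
  have h2 := (hasDerivAt_im_comp h1).sub ((hasDerivAt_id θ).const_mul (m / 2))
  refine h2.congr_deriv ?_
  rw [mul_one, ← mul_assoc, mul_I_im, mul_comm]

lemma integral_circleMap_eq {s l : ℂ → ℂ} (hs : DifferentiableOn ℂ s unitDisk)
    (h0 : ∀ z ∈ unitDisk, s z ≠ 0) (hl : ∀ z ∈ unitDisk, HasDerivAt l (deriv s z / s z) z)
    {r : ℝ} (hr : 0 < r) (hr1 : r < 1) (m θ₁ θ₂ : ℝ) :
    (∫ θ in θ₁..θ₂, ((circleMap 0 r θ * deriv s (circleMap 0 r θ) /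
        s (circleMap 0 r θ)).re - m / 2)) =
      ((l (circleMap 0 r θ₂)).im - m / 2 * θ₂) - ((l (circleMap 0 r θ₁)).im - m / 2 * θ₁) := by
  refine intervalIntegral.integral_eq_sub_of_hasDerivAt
    (f := fun θ : ℝ => (l (circleMap 0 r θ)).im - m / 2 * θ) (fun θ _ => ?_) ?_
  · simpa only [mul_div_assoc] using hasDerivAt_im_circleMap hl hr hr1 m θ
  · refine Continuous.intervalIntegrable ?_ _ _
    have h1 : ContinuousOn (fun z => z * deriv s z / s z) unitDisk :=
      (continuousOn_id.mul (hs.deriv isOpen_unitDisk).continuousOn).div hs.continuousOn h0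
    exact (continuous_re.comp (h1.comp_continuous (continuous_circleMap 0 r)
      (circleMap_mem_unitDisk hr hr1))).sub continuous_const

lemma IsPointwiseKaplan.antitone {m : ℝ} {s l : ℂ → ℂ} (hs : IsPointwiseKaplan m s)
    (hl : ∀ z ∈ unitDisk, HasDerivAt l (deriv s z / s z) z) {r : ℝ} (hr : 0 < r) (hr1 : r < 1) :
    Antitone fun θ : ℝ => (l (circleMap 0 r θ)).im - m / 2 * θ := by
  refine antitone_of_hasDerivAt_nonpos (fun θ => hasDerivAt_im_circleMap hl hr hr1 m θ) fun θ => ?_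
  have := hs.re_lt _ (circleMap_mem_unitDisk hr hr1 θ)
  rw [← mul_div_assoc]
  exact sub_nonpos.2 this.le

/-! ### Passage between the disk and the half-plane. -/

/-- The Cayley transform of the right half-plane onto the unit disk. -/
def cayley (z : ℂ) : ℂ := (z - 1) / (z + 1)

/-- The inverse of the Cayley transform. -/
def cayleyInv (z : ℂ) : ℂ := (1 + z) / (1 - z)

lemma add_one_ne_zero {z : ℂ} (hz : z ∈ rightHalf) : z + 1 ≠ 0 := by
  intro h
  have := congrArg re h
  rw [mem_rightHalf] at hz
  simp only [add_re, one_re, zero_re] at this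
  linarith

lemma cayley_mem {z : ℂ} (hz : z ∈ rightHalf) : cayley z ∈ unitDisk := by
  rw [mem_unitDisk, cayley, norm_div, div_lt_one (norm_pos_iff.2 (add_one_ne_zero hz)), norm_def,
    norm_def]
  rw [mem_rightHalf] at hz
  refine Real.sqrt_lt_sqrt (normSq_nonneg _) ?_
  simp only [normSq_apply, sub_re, add_re, one_re, sub_im, add_im, one_im]
  nlinarith

lemma cayleyInv_mem {z : ℂ} (hz : z ∈ unitDisk) : cayleyInv z ∈ rightHalf := by
  have h := one_sub_ne_zero hz
  rw [mem_rightHalf, cayleyInv, re_div_eq]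
  refine div_pos ?_ (normSq_pos.2 h)
  rw [mem_unitDisk] at hz
  have h1 : ‖z‖ ^ 2 < 1 := by nlinarith [norm_nonneg z]
  rw [Complex.sq_norm, normSq_apply] at h1
  simp only [mul_re, sub_re, one_re, conj_re, add_re, sub_im, one_im, conj_im, add_im]
  linarith

lemma one_sub_cayley {z : ℂ} (hz : z ∈ rightHalf) : 1 - cayley z = 2 / (z + 1) := by
  have := add_one_ne_zero hz
  rw [cayley]
  field_simp
  ring

lemma cayleyInv_cayley {z : ℂ} (hz : z ∈ rightHalf) : cayleyInv (cayley z) = z := by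
  have := add_one_ne_zero hz
  rw [cayleyInv, one_sub_cayley hz, cayley]
  field_simp
  ring

lemma cayley_cayleyInv {z : ℂ} (hz : z ∈ unitDisk) : cayley (cayleyInv z) = z := by
  have := one_sub_ne_zero hz
  have h2 : (1 + z) / (1 - z) + 1 = 2 / (1 - z) := by
    field_simp
    ring
  rw [cayley, cayleyInv, h2]
  field_simp
  ring

lemma image_comp_cayley (f : ℂ → ℂ) : (f ∘ cayley) '' rightHalf = f '' unitDisk := by
  rw [image_comp]
  congr 1
  ext z
  constructor
  · rintro ⟨w, hw, rfl⟩
    exact cayley_mem hw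
  · exact fun hz => ⟨_, cayleyInv_mem hz, cayley_cayleyInv hz⟩

lemma hasDerivAt_cayley {z : ℂ} (hz : z ∈ rightHalf) :
    HasDerivAt cayley (2 / (z + 1) ^ 2) z := by
  have := ((hasDerivAt_id z).sub_const 1).div ((hasDerivAt_id z).add_const 1) (add_one_ne_zero hz)
  refine this.congr_deriv ?_
  simp only [id]
  ring

lemma injOn_comp_cayley {f : ℂ → ℂ} : InjOn (f ∘ cayley) rightHalf ↔ InjOn f unitDisk := by
  constructor
  · intro h z hz w hw hzw
    have := h (cayleyInv_mem hz) (cayleyInv_mem hw)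
      (by simpa only [Function.comp_apply, cayley_cayleyInv hz, cayley_cayleyInv hw] using hzw)
    rw [← cayley_cayleyInv hz, this, cayley_cayleyInv hw]
  · intro h z hz w hw hzw
    have := h (cayley_mem hz) (cayley_mem hw) hzw
    rw [← cayleyInv_cayley hz, this, cayleyInv_cayley hw]

/-- The condition `Re P > 0` on `P = 1 - 2 z s'/(m s)`, transferred to the half-plane. -/
lemma re_identity (z Q : ℂ) : (z + (1 - z ^ 2) * Q).re =
    z.re * ‖1 - (z + 1) * Q‖ ^ 2 + ‖z + 1‖ ^ 2 * (Q.re - z.re * ‖Q‖ ^ 2) := by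
  simp only [Complex.sq_norm, normSq_apply]
  simp only [add_re, mul_re, sub_re, one_re, add_im, mul_im, sub_im, one_im, pow_two]
  ring

/-- Dividing the integral over a shrinking arc by its length gives the weak pointwise bound;
equality would propagate to the centre, where the left side is `0`. Conversely, the primitive of the
integrand is nonincreasing in the angle and drops by exactly `m π` per turn, which gives both
integral bounds. -/
theorem isPi_iff {m : ℝ} (hm : 0 < m) {s : ℂ → ℂ} : IsPi m s ↔ IsPointwiseKaplan m s := by
  have h1 : IsPi m s ↔ IsKaplan m 0 s :=
    ⟨fun h => h.elim And.right fun h => absurd h.1 hm.not_gt, fun h => Or.inl ⟨hm.le, h⟩⟩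
  rw [h1]
  constructor
  · intro h
    obtain ⟨l, hl, -⟩ := exists_log h.analytic h.ne_zero h.apply_zero
    have hle : ∀ z ∈ unitDisk, (z * deriv s z / s z).re ≤ m / 2 := by
      intro z hz
      rcases eq_or_ne z 0 with rfl | hz0
      · simp only [zero_mul, zero_div, zero_re]
        positivity
      have hr : 0 < ‖z‖ := norm_pos_iff.2 hz0
      have hr1 : ‖z‖ < 1 := mem_unitDisk.1 hz
      have hzc : circleMap 0 ‖z‖ (arg z) = z := by
        rw [circleMap, zero_add, norm_mul_exp_arg_mul_I]
      have h2 := hasDerivAt_im_circleMap hl hr hr1 m (arg z)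
      rw [hzc, ← mul_div_assoc] at h2
      have h3 := (hasDerivAt_iff_tendsto_slope.1 h2).mono_left
        (nhdsWithin_mono (arg z) (s := Ioi (arg z)) fun x hx => ne_of_gt hx)
      refine sub_nonpos.1 (le_of_tendsto h3 ?_)
      filter_upwards [Ioo_mem_nhdsGT (show arg z < arg z + 2 * Real.pi by
        linarith [Real.pi_pos])] with θ hθ
      have h4 := (h.integral_bounds ‖z‖ hr hr1 (arg z) θ hθ.1 hθ.2).2
      rw [sub_zero, integral_circleMap_eq h.analytic h.ne_zero hl hr hr1, zero_mul] at h4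
      rw [slope_def_field]
      exact div_nonpos_of_nonpos_of_nonneg h4 (by linarith [hθ.1])
    refine ⟨h.analytic, h.ne_zero, h.apply_zero, fun z hz => lt_of_le_of_ne (hle z hz) fun he => ?_⟩
    have hPd : DifferentiableOn ℂ (fun w => m / 2 - cayley w * deriv s (cayley w) / s (cayley w))
        rightHalf := by
      have h2 : DifferentiableOn ℂ (fun w => m / 2 - w * deriv s w / s w) unitDisk :=
        (differentiableOn_const _).sub ((differentiableOn_id.mul
          (h.analytic.deriv isOpen_unitDisk)).div h.analytic h.ne_zero)
      exact h2.comp (fun w hw => (hasDerivAt_cayley hw).differentiableAt.differentiableWithinAt)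
        fun w hw => cayley_mem hw
    have h2 := eq_of_re_eq_zero hPd (fun w hw => by
      have := hle _ (cayley_mem hw)
      rw [sub_re, ← ofReal_ofNat, ← ofReal_div, ofReal_re]
      linarith) (z := 1) (by simp [mem_rightHalf]) (cayleyInv_mem hz) (by
      rw [cayley_cayleyInv hz, sub_re, he, ← ofReal_ofNat, ← ofReal_div, ofReal_re, sub_self])
    have h3 := congrArg re h2
    rw [cayley_cayleyInv hz, sub_re, sub_re, he] at h3
    simp [cayley] at h3
    exact hm.ne' h3
  · intro h
    obtain ⟨l, hl, -⟩ := exists_log h.diff h.ne_zero h.apply_zero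
    refine ⟨h.diff, h.ne_zero, h.apply_zero, fun r hr hr1 θ₁ θ₂ h12 h21 => ?_⟩
    rw [sub_zero, integral_circleMap_eq h.diff h.ne_zero hl hr hr1, zero_mul]
    have hant := h.antitone hl hr hr1
    have h2 := hant h12.le
    have h3 := hant h21.le
    have h4 : circleMap 0 r (θ₁ + 2 * Real.pi) = circleMap 0 r θ₁ := periodic_circleMap 0 r θ₁
    simp only [h4] at h2 h3
    constructor <;> linarith

section Transform

variable {α : ℝ} {f : ℂ → ℂ}

lemma one_sub_cpow_eq {z : ℂ} (hz : z ∈ unitDisk) (a : ℂ) : (1 - z) ^ a = exp (a * log (1 - z)) := by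
  rw [cpow_def_of_ne_zero (one_sub_ne_zero hz), mul_comm]

lemma hasDerivAt_log_one_sub {z : ℂ} (hz : z ∈ unitDisk) :
    HasDerivAt (fun z => log (1 - z)) (-1 / (1 - z)) z :=
  ((hasDerivAt_id z).const_sub 1).clog (one_sub_mem_slitPlane hz)

lemma differentiableOn_kaplanTransform (hf : DifferentiableOn ℂ f unitDisk) :
    DifferentiableOn ℂ (kaplanTransform α f) unitDisk :=
  (differentiableOn_one_sub_cpow _).mul (hf.deriv isOpen_unitDisk)

lemma kaplanTransform_zero : kaplanTransform α f 0 = deriv f 0 := by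
  rw [kaplanTransform, sub_zero, one_cpow, one_mul]

lemma kaplanTransform_ne_zero_iff {z : ℂ} (hz : z ∈ unitDisk) :
    kaplanTransform α f z ≠ 0 ↔ deriv f z ≠ 0 := by
  rw [kaplanTransform, mul_ne_zero_iff]
  exact and_iff_right (one_sub_cpow_ne_zero hz _)

lemma deriv_kaplanTransform_div (hf : DifferentiableOn ℂ f unitDisk) {z : ℂ} (hz : z ∈ unitDisk)
    (h0 : deriv f z ≠ 0) : deriv (kaplanTransform α f) z / kaplanTransform α f z =
      deriv (deriv f) z / deriv f z - (α + 1) / (1 - z) := by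
  have h1 : kaplanTransform α f =ᶠ[𝓝 z] fun w => exp ((α + 1) * log (1 - w)) * deriv f w := by
    filter_upwards [unitDisk_mem_nhds hz] with w hw
    rw [kaplanTransform, one_sub_cpow_eq hw]
  have h2 := (((hasDerivAt_log_one_sub hz).const_mul ((α : ℂ) + 1)).cexp).mul
    ((hf.deriv isOpen_unitDisk).differentiableAt (unitDisk_mem_nhds hz)).hasDerivAt
  have h3 : deriv (fun w => exp ((α + 1) * log (1 - w)) * deriv f w) z = _ := h2.deriv
  rw [h1.deriv_eq, h1.eq_of_nhds, h3]
  have h4 := one_sub_ne_zero hz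
  have h5 := exp_ne_zero (((α : ℂ) + 1) * log (1 - z))
  generalize exp (((α : ℂ) + 1) * log (1 - z)) = E at h5
  field_simp
  ring

lemma hasDerivAt_comp_cayley (hf : DifferentiableOn ℂ f unitDisk) {z : ℂ} (hz : z ∈ rightHalf) :
    HasDerivAt (f ∘ cayley) (deriv f (cayley z) * (2 / (z + 1) ^ 2)) z :=
  (hf.differentiableAt (unitDisk_mem_nhds (cayley_mem hz))).hasDerivAt.comp z (hasDerivAt_cayley hz)

lemma deriv_deriv_comp_cayley_div (hf : DifferentiableOn ℂ f unitDisk) {z : ℂ} (hz : z ∈ rightHalf)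
    (h0 : deriv f (cayley z) ≠ 0) :
    deriv (deriv (f ∘ cayley)) z / deriv (f ∘ cayley) z =
      deriv (deriv f) (cayley z) / deriv f (cayley z) * (2 / (z + 1) ^ 2) - 2 / (z + 1) := by
  have h1 : deriv (f ∘ cayley) =ᶠ[𝓝 z] fun w => deriv f (cayley w) * (2 / (w + 1) ^ 2) := by
    filter_upwards [rightHalf_mem_nhds hz] with w hw using (hasDerivAt_comp_cayley hf hw).deriv
  have hz1 := add_one_ne_zero hz
  have h2 := (hasDerivAt_comp_cayley (hf.deriv isOpen_unitDisk) hz).mul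
    ((hasDerivAt_const z (2 : ℂ)).div (((hasDerivAt_id z).add_const 1).pow 2)
      (pow_ne_zero 2 hz1))
  have h3 : deriv (fun w => deriv f (cayley w) * (2 / (w + 1) ^ 2)) z = _ := h2.deriv
  rw [h1.deriv_eq, h1.eq_of_nhds, h3]
  simp only [id, Function.comp_apply, Nat.cast_ofNat, Pi.div_apply, Pi.pow_apply]
  field_simp
  ring

/-- The bridge between the two pictures: Kaplan's condition is positivity of the real part of an
expression in `F''/F'`, of the form treated in `re_identity`. -/
lemma kaplan_identity (hα : 1 < α) (hf : DifferentiableOn ℂ f unitDisk) {z : ℂ} (hz : z ∈ rightHalf)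
    (h0 : deriv f (cayley z) ≠ 0) :
    z + (1 - z ^ 2) * (deriv (deriv (f ∘ cayley)) z / deriv (f ∘ cayley) z / (α - 1 : ℝ)) =
      1 - (2 / (α - 1) : ℝ) * (cayley z * deriv (kaplanTransform α f) (cayley z) /
        kaplanTransform α f (cayley z)) := by
  have hz1 := add_one_ne_zero hz
  have hm : (α : ℂ) - 1 ≠ 0 := by
    rw [← ofReal_one, ← ofReal_sub, ofReal_ne_zero]
    linarith
  rw [mul_div_assoc, deriv_kaplanTransform_div hf (cayley_mem hz) h0,
    deriv_deriv_comp_cayley_div hf hz h0, one_sub_cayley hz]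
  generalize deriv (deriv f) (cayley z) / deriv f (cayley z) = w
  rw [cayley]
  push_cast
  field_simp
  ring

lemma re_kaplan_identity (hα : 1 < α) (hf : DifferentiableOn ℂ f unitDisk) {z : ℂ}
    (hz : z ∈ rightHalf) (h0 : deriv f (cayley z) ≠ 0) :
    (z + (1 - z ^ 2) * (deriv (deriv (f ∘ cayley)) z / deriv (f ∘ cayley) z / (α - 1 : ℝ))).re =
      1 - (2 / (α - 1) : ℝ) * (cayley z * deriv (kaplanTransform α f) (cayley z) /
        kaplanTransform α f (cayley z)).re := by
  rw [kaplan_identity hα hf hz h0, sub_re, one_re, re_ofReal_mul]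

end Transform

lemma IsConcaveMap.of_isCo {α : ℝ} {f : ℂ → ℂ} (h : IsCo α f) : IsConcaveMap (f ∘ cayley) where
  diff := fun _ hz => (hasDerivAt_comp_cayley h.analytic hz).differentiableAt.differentiableWithinAt
  inj := injOn_comp_cayley.2 h.injOn
  convex_compl := by rw [image_comp_cayley]; exact h.convex_compl
  tendsto := by
    intro M
    have h1 := (tendsto_norm_cobounded_atTop.comp h.map_one).eventually_ge_atTop M
    obtain ⟨δ, hδ, h2⟩ := Metric.nhdsWithin_basis_ball.eventually_iff.1 h1
    refine ⟨2 / δ + 2, fun z hz hR => h2 ⟨?_, cayley_mem hz⟩⟩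
    have h3 : 2 / δ < ‖z + 1‖ := by
      have := norm_sub_norm_le z (-1)
      rw [sub_neg_eq_add, norm_neg, norm_one] at this
      linarith
    rw [mem_ball_iff_norm, norm_sub_rev, one_sub_cayley hz, norm_div, RCLike.norm_ofNat,
      div_lt_iff₀ ((div_pos two_pos hδ).trans h3), ← div_lt_iff₀' hδ]
    exact h3

lemma tendsto_cobounded_of_comp_cayley {f : ℂ → ℂ}
    (h : ∀ M : ℝ, ∃ R : ℝ, ∀ z ∈ rightHalf, R ≤ ‖z‖ → M ≤ ‖(f ∘ cayley) z‖) :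
    Tendsto f (𝓝[unitDisk] 1) (Bornology.cobounded ℂ) := by
  rw [← tendsto_norm_atTop_iff_cobounded, tendsto_atTop]
  intro M
  obtain ⟨R, hR⟩ := h M
  have hR0 : 0 < max R 0 + 1 := by positivity
  refine Metric.nhdsWithin_basis_ball.eventually_iff.2 ⟨2 / (max R 0 + 1), by positivity, ?_⟩
  rintro z ⟨hz1, hz⟩
  have h1 := hR _ (cayleyInv_mem hz) ?_
  · rwa [Function.comp_apply, cayley_cayleyInv hz] at h1
  have h0 := one_sub_ne_zero hz
  rw [mem_ball_iff_norm, norm_sub_rev, lt_div_iff₀ hR0,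
    ← lt_div_iff₀' (norm_pos_iff.2 h0)] at hz1
  have h2 : cayleyInv z + 1 = 2 / (1 - z) := by
    rw [cayleyInv]
    field_simp
    ring
  have h3 := norm_add_le (cayleyInv z) 1
  rw [h2, norm_div, RCLike.norm_ofNat, norm_one] at h3
  have := le_max_left R 0
  linarith

/-- With `Q = q / m`, both terms in `re_identity` are nonnegative by the second order inequality.
Strictness follows by rigidity, since the function equals `1` at `z = 1`. -/
theorem IsPointwiseKaplan.of_isCo {α : ℝ} (hα : 1 < α) {f : ℂ → ℂ} (h : IsCo α f) :
    IsPointwiseKaplan (α - 1) (kaplanTransform α f) := by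
  have hF := IsConcaveMap.of_isCo h
  obtain ⟨φ, hφ, hφα⟩ := h.opening_angle
  rw [← image_comp_cayley] at hφ
  have hm : 0 < α - 1 := sub_pos.2 hα
  have h0 : ∀ z ∈ unitDisk, deriv f z ≠ 0 := fun z hz =>
    deriv_ne_zero_of_injOn isOpen_unitDisk h.analytic h.injOn hz
  refine ⟨differentiableOn_kaplanTransform h.analytic,
    fun z hz => (kaplanTransform_ne_zero_iff hz).2 (h0 z hz),
    kaplanTransform_zero.trans h.deriv_zero, ?_⟩
  have hre : ∀ z ∈ rightHalf, 0 ≤ (z + (1 - z ^ 2) *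
      (deriv (deriv (f ∘ cayley)) z / deriv (f ∘ cayley) z / (α - 1 : ℝ))).re := by
    intro z hz
    have h1 := hF.re_mul_normSq_deriv_le hm hφ (hφα.trans (le_of_eq (by ring))) hz
    rw [re_identity]
    generalize deriv (deriv (f ∘ cayley)) z / deriv (f ∘ cayley) z = q at h1
    have hz0 : 0 < z.re := hz
    refine add_nonneg (by positivity) (mul_nonneg (by positivity) ?_)
    rw [div_ofReal_re, norm_div, norm_real, Real.norm_eq_abs, abs_of_pos hm, div_pow, sub_nonneg,
      ← mul_div_assoc, div_le_div_iff₀ (by positivity) hm, pow_two (α - 1), ← mul_assoc]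
    refine (mul_le_mul_of_nonneg_right h1 hm.le).trans (le_of_eq (by ring))
  have hd : DifferentiableOn ℂ (fun z => z + (1 - z ^ 2) *
      (deriv (deriv (f ∘ cayley)) z / deriv (f ∘ cayley) z / (α - 1 : ℝ))) rightHalf := by
    have h1 := hF.diff.deriv isOpen_rightHalf
    have h2 := ((h1.deriv isOpen_rightHalf).div h1 fun z hz => hF.deriv_ne_zero hz).div_const
      ((α - 1 : ℝ) : ℂ)
    have h3 : DifferentiableOn ℂ (fun z : ℂ => 1 - z ^ 2) rightHalf := by fun_prop
    exact differentiableOn_id.add (h3.mul h2)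
  have hpos : ∀ z ∈ rightHalf, 0 < (z + (1 - z ^ 2) *
      (deriv (deriv (f ∘ cayley)) z / deriv (f ∘ cayley) z / (α - 1 : ℝ))).re := by
    intro z hz
    refine lt_of_le_of_ne (hre z hz) fun he => ?_
    have h1 := congrArg re (eq_of_re_eq_zero hd hre (z := 1) (by simp [mem_rightHalf]) hz he.symm)
    simp only [← he] at h1
    norm_num at h1
  intro z hz
  have h1 := hpos _ (cayleyInv_mem hz)
  rw [re_kaplan_identity hα h.analytic (cayleyInv_mem hz)
    (by rw [cayley_cayleyInv hz]; exact h0 z hz), cayley_cayleyInv hz, sub_pos, div_mul_eq_mul_div,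
    div_lt_one hm] at h1
  linarith

/-! ### From Kaplan's condition back to the half-plane. -/

lemma re_nonneg_on_unitDisk {h : ℂ → ℂ} (hd : DifferentiableOn ℂ h unitDisk)
    (hbd : ∀ b : ℂ, ‖b‖ = 1 → b ≠ 1 → ContinuousAt h b ∧ 0 ≤ (h b).re)
    (h1 : ∀ ε > 0, ∀ᶠ z in 𝓝[unitDisk] 1, -ε ≤ (h z).re) {z : ℂ} (hz : z ∈ unitDisk) :
    0 ≤ (h z).re := by
  refine re_nonneg_of_eventually isOpen_unitDisk hd (fun ε _ => ⟨1, fun z hz h => ?_⟩)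
    (fun b hb ε hε => ?_) hz
  · exact absurd (mem_unitDisk.1 hz) (not_lt.2 h)
  · rw [unitDisk, frontier_ball _ one_ne_zero, mem_sphere_zero_iff_norm] at hb
    rcases eq_or_ne b 1 with rfl | hb1
    · exact h1 ε hε
    · obtain ⟨hc, h0⟩ := hbd b hb hb1
      have h2 : Tendsto (fun z => (h z).re) (𝓝[unitDisk] b) (𝓝 (h b).re) :=
        ((continuous_re.continuousAt.comp hc).tendsto).mono_left nhdsWithin_le_nhds
      exact (h2.eventually (lt_mem_nhds (by linarith))).mono fun _ h => h.le

lemma arg_one_add_exp {φ : ℝ} (h1 : -Real.pi < φ) (h2 : φ < Real.pi) :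
    arg (1 + exp (φ * I)) = φ / 2 := by
  have hc : 0 < Real.cos (φ / 2) := Real.cos_pos_of_mem_Ioo ⟨by linarith, by linarith⟩
  have h3 : 1 + exp (φ * I) = ((2 * Real.cos (φ / 2) : ℝ) : ℂ) *
      (cos (φ / 2 : ℝ) + sin (φ / 2 : ℝ) * I) := by
    have e : (φ : ℂ) = 2 * ((φ / 2 : ℝ) : ℂ) := by push_cast; ring
    rw [exp_mul_I, e, cos_two_mul, sin_two_mul]
    push_cast
    ring
  rw [h3, arg_mul_cos_add_sin_mul_I (by linarith)]
  constructor <;> linarith [Real.pi_pos]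

/-- On the unit circle `arg (1 - b)` is half of `arg (-b)`, and `r b` has angle `arg (-b) + π` in
`[0, 2π]`; comparing the antitone function with its values at both ends gives the bound. The minimum
principle carries it inside. At `1`, where the argument jumps, `|arg (1 - z)| ≤ π / 2` suffices. -/
lemma IsPointwiseKaplan.abs_im_sub_le {m : ℝ} (hm : 0 < m) {s l : ℂ → ℂ}
    (hs : IsPointwiseKaplan m s) (hl : ∀ z ∈ unitDisk, HasDerivAt l (deriv s z / s z) z) {r : ℝ}
    (hr : 0 < r) (hr1 : r < 1) {z : ℂ} (hz : z ∈ unitDisk) :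
    |(l r).im - (l (r * z)).im + m * arg (1 - z)| ≤ m * Real.pi / 2 := by
  have hrz : ∀ z : ℂ, ‖z‖ ≤ 1 → (r : ℂ) * z ∈ unitDisk := by
    intro z hz
    rw [mem_unitDisk, norm_mul, norm_real, Real.norm_eq_abs, abs_of_pos hr]
    exact (mul_le_of_le_one_right hr.le hz).trans_lt hr1
  have hlr : ∀ z : ℂ, ‖z‖ ≤ 1 → DifferentiableAt ℂ (fun z => l (r * z)) z := by
    intro z hz
    exact DifferentiableAt.comp (g := l) z (hl _ (hrz z hz)).differentiableAt (by fun_prop)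
  have hlog : ∀ z : ℂ, ‖z‖ ≤ 1 → z ≠ 1 → 1 - z ∈ slitPlane := by
    intro z hz hz1
    rw [mem_slitPlane_iff_not_le_zero]
    intro h
    apply hz1
    have h1 := (le_def.1 h).1
    have h2 := (le_def.1 h).2
    rw [sub_re, one_re, zero_re] at h1
    rw [sub_im, one_im, zero_im] at h2
    have h3 := re_le_norm z
    apply Complex.ext
    · rw [one_re]; linarith
    · rw [one_im]; linarith
  set X : ℂ → ℝ := fun z => (l r).im - (l (r * z)).im + m * arg (1 - z) with hX
  have hant := hs.antitone hl hr hr1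
  have hXb : ∀ b : ℂ, ‖b‖ = 1 → b ≠ 1 → |X b| ≤ m * Real.pi / 2 := by
    intro b hb hb1
    have hbe : exp (arg (-b) * I) = -b := by
      have := norm_mul_exp_arg_mul_I (-b)
      rwa [norm_neg, hb, ofReal_one, one_mul] at this
    have hφ : arg (-b) < Real.pi := by
      refine lt_of_le_of_ne (arg_le_pi _) fun h => hb1 ?_
      rw [h, exp_pi_mul_I] at hbe
      exact (neg_injective hbe).symm
    have hφ' := neg_pi_lt_arg (-b)
    have harg : arg (1 - b) = arg (-b) / 2 := by
      rw [← arg_one_add_exp hφ' hφ, hbe, sub_eq_add_neg]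
    have hc0 : circleMap 0 r 0 = r := by simp [circleMap]
    have hc1 : circleMap 0 r (2 * Real.pi) = r := by
      have := periodic_circleMap 0 r 0
      rwa [zero_add, hc0] at this
    have hcb : circleMap 0 r (arg (-b) + Real.pi) = r * b := by
      rw [circleMap, zero_add, ofReal_add, add_mul, exp_add, exp_pi_mul_I, hbe]
      ring
    have h1 := hant (show 0 ≤ arg (-b) + Real.pi by linarith)
    have h2 := hant (show arg (-b) + Real.pi ≤ 2 * Real.pi by linarith)
    simp only [hc0, hc1, hcb] at h1 h2
    rw [abs_le, hX]
    simp only [harg]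
    constructor <;> linarith
  have key : ∀ σ : ℝ, |σ| = 1 → 0 ≤ m * Real.pi / 2 + σ * X z := by
    intro σ hσ
    set h : ℂ → ℂ := fun z => (m * Real.pi / 2 : ℝ) +
      (σ : ℂ) * ((l r).im + I * (l (r * z) - m * log (1 - z))) with hh
    have hre : ∀ z, (h z).re = m * Real.pi / 2 + σ * X z := by
      intro z
      rw [hh, hX]
      simp only [add_re, ofReal_re, re_ofReal_mul, I_mul_re, sub_im, im_ofReal_mul, log_im]
      ring
    have hhd : ∀ z : ℂ, ‖z‖ ≤ 1 → z ≠ 1 → DifferentiableAt ℂ h z := by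
      intro z hz hz1
      have e1 := hlr z hz
      have e2 : DifferentiableAt ℂ (fun z : ℂ => log (1 - z)) z :=
        DifferentiableAt.clog (by fun_prop) (hlog z hz hz1)
      exact ((((e1.sub (e2.const_mul _)).const_mul I).const_add _).const_mul _).const_add _
    have hσX : ∀ x : ℝ, -|x| ≤ σ * x := fun x => by
      have := neg_abs_le (σ * x)
      rwa [abs_mul, hσ, one_mul] at this
    rw [← hre]
    refine re_nonneg_on_unitDisk (fun w hw => (hhd w (mem_unitDisk.1 hw).le ?_).differentiableWithinAt)
      (fun b hb hb1 => ⟨(hhd b hb.le hb1).continuousAt, ?_⟩) (fun ε hε => ?_) hz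
    · rintro rfl
      simp [mem_unitDisk] at hw
    · rw [hre]
      have := hσX (X b)
      have := hXb b hb hb1
      linarith
    · have h1 : Tendsto (fun z => |(l r).im - (l (r * z)).im|) (𝓝[unitDisk] 1) (𝓝 0) := by
        have h2 : ContinuousAt (fun z => |(l r).im - (l (r * z)).im|) 1 :=
          (continuousAt_const.sub (continuous_im.continuousAt.comp
            (hlr 1 (by simp)).continuousAt)).abs
        have h3 := h2.tendsto.mono_left (nhdsWithin_le_nhds (s := unitDisk))
        simpa using h3
      filter_upwards [h1.eventually (gt_mem_nhds hε), self_mem_nhdsWithin] with w hw hwD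
      have h4 := abs_arg_le_pi_div_two_iff.2 (re_one_sub_pos hwD).le
      have h5 : |X w| ≤ ε + m * (Real.pi / 2) := by
        refine (abs_add_le _ _).trans (add_le_add hw.le ?_)
        rw [abs_mul, abs_of_pos hm]
        exact mul_le_mul_of_nonneg_left h4 hm.le
      rw [hre]
      have := hσX (X w)
      linarith
  have h1 := key 1 (by simp)
  have h2 := key (-1) (by simp)
  rw [abs_le]
  constructor <;> linarith

lemma IsPointwiseKaplan.abs_im_sub_log_le {m : ℝ} (hm : 0 < m) {s l : ℂ → ℂ}
    (hs : IsPointwiseKaplan m s) (hl : ∀ z ∈ unitDisk, HasDerivAt l (deriv s z / s z) z) {z w : ℂ}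
    (hz : z ∈ unitDisk) (hw : w ∈ unitDisk) :
    |(l z - m * log (1 - z)).im - (l w - m * log (1 - w)).im| ≤ m * Real.pi := by
  have ht : ∀ z ∈ unitDisk, Tendsto (fun r : ℝ => (l (r * z) - m * log (1 - z)).im) (𝓝[<] 1)
      (𝓝 (l z - m * log (1 - z)).im) := by
    intro z hz
    have h1 : ContinuousAt (fun r : ℝ => (l (r * z) - m * log (1 - z)).im) 1 := by
      have h2 : ContinuousAt (fun r : ℝ => l (r * z)) 1 :=
        ContinuousAt.comp (g := l) (by simpa using (hl z hz).continuousAt) (by fun_prop)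
      exact continuous_im.continuousAt.comp (h2.sub continuousAt_const)
    have h3 := h1.tendsto.mono_left (nhdsWithin_le_nhds (s := Iio 1))
    simpa using h3
  refine le_of_tendsto ((ht z hz).sub (ht w hw)).abs ?_
  filter_upwards [Ioo_mem_nhdsLT (zero_lt_one' ℝ)] with r hr
  have h1 := abs_le.1 (hs.abs_im_sub_le hm hl hr.1 hr.2 hz)
  have h2 := abs_le.1 (hs.abs_im_sub_le hm hl hr.1 hr.2 hw)
  simp only [sub_im, im_ofReal_mul, log_im]
  rw [abs_le]
  constructor <;> linarith [h1.1, h1.2, h2.1, h2.2]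

/-- The factor `(1 - cayley z)² / 2` from the derivative of `cayley` lowers the exponent `α + 1` to
`m`, so `log F' = l - m log (1 - ·) - log 2` at `cayley z`, and the oscillation bound on the disk
applies. -/
theorem exists_isSector {α : ℝ} (hα₁ : 1 < α) (hα₂ : α ≤ 2) {f : ℂ → ℂ}
    (hf : DifferentiableOn ℂ f unitDisk) (hs : IsPointwiseKaplan (α - 1) (kaplanTransform α f)) :
    ∃ L : ℂ → ℂ, IsSector (f ∘ cayley) L (α - 1) := by
  have hm : 0 < α - 1 := sub_pos.2 hα₁
  obtain ⟨l, hl, hle⟩ := exists_log hs.diff hs.ne_zero hs.apply_zero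
  set Λ : ℂ → ℂ := fun z => l z - (α - 1 : ℝ) * log (1 - z) with hΛ
  set L : ℂ → ℂ := fun z => Λ (cayley z) - Real.log 2 with hL
  have h0 : ∀ z ∈ unitDisk, deriv f z ≠ 0 := fun z hz =>
    (kaplanTransform_ne_zero_iff hz).1 (hs.ne_zero z hz)
  have hLd : DifferentiableOn ℂ L rightHalf := by
    intro z hz
    have h1 : DifferentiableAt ℂ Λ (cayley z) := (hl _ (cayley_mem hz)).differentiableAt.sub
      ((hasDerivAt_log_one_sub (cayley_mem hz)).differentiableAt.const_mul _)
    exact ((h1.comp z (hasDerivAt_cayley hz).differentiableAt).sub_const _).differentiableWithinAt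
  have hder : ∀ z ∈ rightHalf, HasDerivAt (f ∘ cayley) (exp (L z)) z := by
    intro z hz
    refine (hasDerivAt_comp_cayley hf hz).congr_deriv ?_
    have hz1 := add_one_ne_zero hz
    have hc := cayley_mem hz
    have hw := one_sub_ne_zero hc
    have h2 : deriv f (cayley z) = exp (l (cayley z)) * exp (-((α + 1) * log (1 - cayley z))) := by
      rw [hle _ hc, kaplanTransform, one_sub_cpow_eq hc, mul_right_comm, ← exp_add, add_neg_cancel,
        exp_zero, one_mul]
    have h3 : 2 / (z + 1) ^ 2 = exp (2 * log (1 - cayley z)) * exp (-Real.log 2) := by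
      rw [two_mul, exp_add, exp_log hw, one_sub_cayley hz, exp_neg, ← ofReal_exp,
        Real.exp_log two_pos]
      push_cast
      field_simp
    rw [h2, h3, ← exp_add, ← exp_add, ← exp_add, hL, hΛ]
    congr 1
    push_cast
    ring
  refine ⟨L, hder, hLd, ?_, fun z hz w hw => ?_, hm, by linarith⟩
  · have hq : ∀ z ∈ rightHalf, deriv (deriv (f ∘ cayley)) z / deriv (f ∘ cayley) z = deriv L z :=
      fun z hz => deriv_deriv_div_of_exp hder hLd hz
    set P : ℂ → ℂ := fun z => z + (1 - z ^ 2) * (deriv L z / (α - 1 : ℝ)) with hP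
    have hLdd := hLd.deriv isOpen_rightHalf
    have hPd : DifferentiableOn ℂ P rightHalf := by
      have h3 : DifferentiableOn ℂ (fun z : ℂ => 1 - z ^ 2) rightHalf := by fun_prop
      exact differentiableOn_id.add (h3.mul (hLdd.div_const _))
    have hPre : ∀ z ∈ rightHalf, 0 ≤ (P z).re := by
      intro z hz
      have h1 := re_kaplan_identity hα₁ hf hz (h0 _ (cayley_mem hz))
      rw [hq z hz] at h1
      have h2 := hs.re_lt _ (cayley_mem hz)
      rw [hP]
      simp only
      rw [h1, sub_nonneg, div_mul_eq_mul_div, div_le_one hm]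
      linarith
    have hne : ∀ z ∈ rightHalf, z ≠ 1 →
        0 ≤ (α - 1) * (deriv L z).re - z.re * ‖deriv L z‖ ^ 2 := by
      intro z hz hz1
      -- As `P 1 = 1` and `P z - P 1` contains the factor `z - 1`, Schwarz–Pick cancels the first
      -- term of `re_identity` and leaves the second order inequality. The excluded point `z = 1`
      -- follows by continuity.
      have h1 := schwarz_pick hPd hPre hz (w := 1) (by simp [mem_rightHalf])
      have h2 : P z - P 1 = (z - 1) * (1 - (z + 1) * (deriv L z / (α - 1 : ℝ))) := by
        rw [hP]
        ring
      have h3 : P 1 = 1 := by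
        rw [hP]
        ring
      rw [h2, h3, one_re, mul_one, mul_one, norm_mul, hP, re_identity] at h1
      set Q := deriv L z / ((α - 1 : ℝ) : ℂ) with hQ
      have hz0 : 0 < ‖z - 1‖ := norm_pos_iff.2 (sub_ne_zero.2 hz1)
      have hz2 : 0 < ‖z + 1‖ := norm_pos_iff.2 (add_one_ne_zero hz)
      have h4 : 0 ≤ ‖z + 1‖ ^ 2 * (Q.re - z.re * ‖Q‖ ^ 2) * ‖z - 1‖ ^ 2 := by linarith
      have h5 := nonneg_of_mul_nonneg_right (nonneg_of_mul_nonneg_left h4 (by positivity))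
        (by positivity)
      have h6 : deriv L z = (α - 1 : ℝ) * Q := by
        rw [hQ, mul_div_cancel₀ _ (ofReal_ne_zero.2 hm.ne')]
      rw [h6, re_ofReal_mul, norm_mul, norm_real, Real.norm_eq_abs, abs_of_pos hm, mul_pow]
      have := mul_nonneg (mul_nonneg hm.le hm.le) h5
      linarith
    intro z hz
    rw [← sub_nonneg]
    rcases eq_or_ne z 1 with rfl | hz1
    · have h1 : ContinuousAt (fun z => (α - 1) * (deriv L z).re - z.re * ‖deriv L z‖ ^ 2) 1 := by
        have h2 := (hLdd.differentiableAt (rightHalf_mem_nhds hz)).continuousAt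
        exact (continuousAt_const.mul (continuous_re.continuousAt.comp h2)).sub
          (continuous_re.continuousAt.mul (h2.norm.pow 2))
      refine ge_of_tendsto (h1.tendsto.mono_left (nhdsWithin_le_nhds (s := {(1 : ℂ)}ᶜ))) ?_
      filter_upwards [self_mem_nhdsWithin, nhdsWithin_le_nhds (rightHalf_mem_nhds hz)] with w hw hwH
      exact hne w hwH hw
    · exact hne z hz hz1
  · have := hs.abs_im_sub_log_le hm hl (cayley_mem hz) (cayley_mem hw)
    simp only [hL]
    rwa [sub_im (Λ _), sub_im (Λ _), sub_sub_sub_cancel_right]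

theorem isCo_iff {α : ℝ} (hα₁ : 1 < α) (hα₂ : α ≤ 2) {f : ℂ → ℂ} :
    IsCo α f ↔ DifferentiableOn ℂ f unitDisk ∧ f 0 = 0 ∧
      IsPointwiseKaplan (α - 1) (kaplanTransform α f) := by
  constructor
  · exact fun h => ⟨h.analytic, h.apply_zero, IsPointwiseKaplan.of_isCo hα₁ h⟩
  · rintro ⟨hf, hf0, hs⟩
    obtain ⟨L, hL⟩ := exists_isSector hα₁ hα₂ hf hs
    have hF := hL.isConcaveMap
    obtain ⟨φ, hφ, hφα⟩ := hL.exists_openingAngle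
    refine ⟨hf, hf0, kaplanTransform_zero.symm.trans hs.apply_zero,
      tendsto_cobounded_of_comp_cayley hF.tendsto, injOn_comp_cayley.1 hF.inj, ?_, φ, ?_,
      hφα.trans (le_of_eq (by ring))⟩
    · rw [← image_comp_cayley]
      exact hF.convex_compl
    · rwa [← image_comp_cayley]

lemma IsPointwiseKaplan.congr {m : ℝ} {s t : ℂ → ℂ} (hs : IsPointwiseKaplan m s)
    (h : EqOn t s unitDisk) : IsPointwiseKaplan m t := by
  refine ⟨hs.diff.congr h, fun z hz => ?_, ?_, fun z hz => ?_⟩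
  · rw [h hz]
    exact hs.ne_zero z hz
  · rw [h zero_mem_unitDisk]
    exact hs.apply_zero
  · rw [h hz, (h.eventuallyEq_of_mem (unitDisk_mem_nhds hz)).deriv_eq]
    exact hs.re_lt z hz

lemma eq_segmentIntegral_div_iff {α : ℝ} {f s : ℂ → ℂ} (hs : DifferentiableOn ℂ s unitDisk) :
    (∀ z ∈ unitDisk, f z = segmentIntegral (fun t => s t / (1 - t) ^ ((α : ℂ) + 1)) z) ↔
      DifferentiableOn ℂ f unitDisk ∧ f 0 = 0 ∧ EqOn s (kaplanTransform α f) unitDisk := by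
  rw [eq_segmentIntegral_iff (g := fun t => s t / (1 - t) ^ ((α : ℂ) + 1))
    (hs.div (differentiableOn_one_sub_cpow _) fun z hz => one_sub_cpow_ne_zero hz _)]
  constructor
  · rintro ⟨h0, h⟩
    refine ⟨fun z hz => (h z hz).differentiableAt.differentiableWithinAt, h0, fun z hz => ?_⟩
    rw [kaplanTransform, (h z hz).deriv, mul_div_cancel₀ _ (one_sub_cpow_ne_zero hz _)]
  · rintro ⟨hf, h0, h⟩
    refine ⟨h0, fun z hz => ?_⟩
    refine (hf.differentiableAt (unitDisk_mem_nhds hz)).hasDerivAt.congr_deriv ?_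
    rw [h hz, kaplanTransform, mul_div_cancel_left₀ _ (one_sub_cpow_ne_zero hz _)]

end Concave

end

theorem mainTheorem6 (α : ℝ) (hα₁ : 1 < α) (hα₂ : α ≤ 2) (f : ℂ → ℂ) :
    -- the representation by a function of the Kaplan-type class
    (Concave.IsCo α f ↔
      ∃ s : ℂ → ℂ, Concave.IsPi (α - 1) s ∧
        ∀ z ∈ Concave.unitDisk,
          f z = Concave.segmentIntegral (fun t => s t / (1 - t) ^ ((α : ℂ) + 1)) z) ∧
    -- the function `s` in the representation is `(1 - z)^(α + 1) f'(z)`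
    (∀ s : ℂ → ℂ, Concave.IsPi (α - 1) s →
      (∀ z ∈ Concave.unitDisk,
        f z = Concave.segmentIntegral (fun t => s t / (1 - t) ^ ((α : ℂ) + 1)) z) →
      ∀ z ∈ Concave.unitDisk, s z = Concave.kaplanTransform α f z) ∧
    -- the equivalent condition on `s = (1 - z)^(α + 1) f'`
    (Concave.IsCo α f ↔
      DifferentiableOn ℂ f Concave.unitDisk ∧ f 0 = 0 ∧ deriv f 0 = 1 ∧
      (∀ z ∈ Concave.unitDisk, Concave.kaplanTransform α f z ≠ 0) ∧
      ∀ z ∈ Concave.unitDisk,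
        (z * deriv (Concave.kaplanTransform α f) z / Concave.kaplanTransform α f z).re
          < (α - 1) / 2) := by
  have hm : 0 < α - 1 := sub_pos.2 hα₁
  refine ⟨?_, fun s hs h => ?_, ?_⟩
  · rw [Concave.isCo_iff hα₁ hα₂]
    constructor
    · rintro ⟨hf, h0, hs⟩
      exact ⟨_, (Concave.isPi_iff hm).2 hs,
        (Concave.eq_segmentIntegral_div_iff hs.diff).2 ⟨hf, h0, fun z _ => rfl⟩⟩
    · rintro ⟨s, hs, h⟩
      rw [Concave.isPi_iff hm] at hs
      obtain ⟨hf, h0, he⟩ := (Concave.eq_segmentIntegral_div_iff hs.diff).1 h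
      exact ⟨hf, h0, hs.congr he.symm⟩
  · exact ((Concave.eq_segmentIntegral_div_iff ((Concave.isPi_iff hm).1 hs).diff).1 h).2.2
  · rw [Concave.isCo_iff hα₁ hα₂]
    constructor
    · rintro ⟨hf, h0, hs⟩
      exact ⟨hf, h0, Concave.kaplanTransform_zero.symm.trans hs.apply_zero, hs.ne_zero, hs.re_lt⟩
    · rintro ⟨hf, h0, h1, hne, hre⟩
      exact ⟨hf, h0, Concave.differentiableOn_kaplanTransform hf, hne,
        Concave.kaplanTransform_zero.trans h1, hre⟩
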